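/- **Conventions.** An embedded affine cubic surface is $\mathcal X=\{f=0\}\subset\mathbb C^3$ with $f\in\mathbb C[x_1,x_2,x_3]$ of degree $3$. Its projective completion $\overline{\mathcal X}\subset\mathbb P^3$ is the zero locus of the homogenisation $F(X_0,X_1,X_2,X_3)=X_0^3f(X_1/X_0,X_2/X_0,X_3/X_0)$. It has a *triangle of lines at infinity* if $F(0,X_1,X_2,X_3)=L_1L_2L_3$ with linear forms $L_k$ such that the lines $L_k=0$ in the plane $X_0=0$ meet pairwise in single points and the three intersection points (the *corners*) are distinct. Two surfaces are affinely equivalent if an affine automorphism of $\mathbb C^3$ maps one onto the other. A point of $\overline{\mathcal X}$ is a singularity of type $A_n$ ($n\ge1$) if the local equation of $\overline{\mathcal X}$ there is $v_2v_3+v_1^{n+1}$ in suitable local holomorphic coordinates; the symbol $-$ denotes a regular point. For $\epsilon\in\{0,1\}^3$ and $\omega\in\mathbb C^4$ put $$N_{\epsilon,\omega}=x_1x_2x_3+\epsilon_1x_1^2+\epsilon_2x_2^2+\epsilon_3x_3^2+\omega_1x_1+\omega_2x_2+\omega_3x_3+\omega_4 .$$ **(1) Normal form.** Every embedded affine cubic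 surface with a triangle of lines at infinity is affinely equivalent to $\{N_{\epsilon,\omega}=0\}$ for some $\epsilon\in\{0,1\}^3$, $\omega\in\mathbb C^4$. **(2) Corners.** For all $\epsilon\in\{0,1\}^3$, $\omega\in\mathbb C^4$, the surface $\mathcal X=\{N_{\epsilon,\omega}=0\}$ has the triangle of lines $X_0=X_k=0$ ($k=1,2,3$) at infinity, with corners $p_1=[0:1:0:0]$, $p_2=[0:0:1:0]$, $p_3=[0:0:0:1]$. The singular points of $\overline{\mathcal X}$ at infinity are exactly the $p_k$ with $\epsilon_k=0$, and $p_k$ is regular if and only if $\epsilon_k=1$. Suppose moreover that $N_{\epsilon,\omega}$ is irreducible, $\{i,j,k\}=\{1,2,3\}$ and $\epsilon_k=0$. Then $p_k$ is a singularity of type - $A_1$ if and only if $\omega_k\ne0$; - $A_2$ if and only if $\omega_k=0$, $\omega_4\neq0$; - $A_3$ if and only if $\omega_k=\omega_4=0$, $\omega_i\omega_j\ne0$; - $A_4$ if and only if $\omega_k=\omega_4=0$, $\omega_i\omega_j=0$, $\omega_i+\omega_j\neq0$; and never of type $A_n$ with $n\ge5$. In the remaining case $\omega=0$ one has $\epsilon_i=\epsilon_j=1$,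 and $\overline{\mathcal X}$ is singular along the line $X_i=X_j=0$. **(3) Smooth surfaces.** Let $\mathcal X$ be a smooth embedded affine cubic surface with a triangle of lines at infinity. Then $\overline{\mathcal X}$ is singular at most at the three corners. There is exactly one row of the following table whose types are, in a suitable ordering, the types of the three corners of $\mathcal X$. The number of (affine) lines contained in $\mathcal X$ is the one stated in that row, and $\mathcal X$ is affinely equivalent to the zero set of the cubic of that row for some values of the parameters $\omega_i$ occurring in it (with $\omega_3^2\ne1$ in the second row). | types | #lines | cubic | |---|---|---| | $-,-,-$ | 24 | $x_1x_2x_3+x_1^2+x_2^2+x_3^2+\omega_1x_1+\omega_2x_2+\omega_3x_3+\omega_4$ | | $-,-,A_1$ | 18 | $x_1x_2x_3+x_1^2+x_2^2+\omega_1x_1+\omega_2x_2+\omega_3x_3+R$ | | $-,-,A_2$ | 12 | $x_1x_2x_3+x_1^2+x_2^2+\omega_1x_1+\omega_2x_2+\omega_1-1$ | | $-,-,A_3$ | 7 | $x_1x_2x_3+x_1^2+x_2^2+\omega_1x_1-x_2$ | | $-,-,A_4$ | 3 | $x_1x_2x_3+x_1^2+x_2^2-x_2$ | | $-,A_1,A_1$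 | 13 | $x_1x_2x_3+x_1^2+\omega_1x_1+\omega_2(x_2+x_3)+\omega_2(1+\omega_1-\omega_2)$ | | $A_1,A_1,A_1$ | 9 | $x_1x_2x_3-x_1+\omega_2x_2-x_3-\omega_2+1$ | | $-,A_1,A_2$ | 8 | $x_1x_2x_3+x_1^2+\omega_1x_1-x_2+1$ | | $A_1,A_1,A_2$ | 5 | $x_1x_2x_3-x_1-x_2+1$ | | $-,A_2,A_2$ | 4 | $x_1x_2x_3+x_1^2+\omega_1x_1+1$ | | $-,A_1,A_3$ | 4 | $x_1x_2x_3+x_1^2-x_1-x_2$ | | $A_1,A_1,A_3$ | 2 | $x_1x_2x_3-x_1-x_2$ | | $A_1,A_2,A_2$ | 2 | $x_1x_2x_3-x_1+1$ | | $-,A_1,A_4$ | 1 | $x_1x_2x_3+x_1^2-x_2$ | | $A_2,A_2,A_2$ | 0 | $x_1x_2x_3+1$ | Here $R=1+\omega_3^2-\dfrac{\omega_3(\omega_2+\omega_1\omega_3)(\omega_1+\omega_2\omega_3)}{(\omega_3^2-1)^2}$. **(4) Every row occurs.** For each row and all parameters outside the zero set of some nonzero polynomial, the listed cubic is defined, its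 zero set is smooth, its corners $[0:1:0:0],[0:0:1:0],[0:0:0:1]$ have the listed types in this order, and it contains exactly the stated number of affine lines. -/

import Mathlib

open scoped Topology

noncomputable section

namespace AffineCubic

open MvPolynomial

/-- Polynomials in the affine coordinates `x₁, x₂, x₃` of `ℂ³` (indices `0, 1, 2`). -/
abbrev AffPoly : Type := MvPolynomial (Fin 3) ℂ

/-- Polynomials in the homogeneous coordinates `X₀, X₁, X₂, X₃` of `ℙ³`;
the plane at infinity is `X₀ = 0`. -/
abbrev ProjPoly : Type := MvPolynomial (Fin 4) ℂ

/-- The embedded affine surface `{f = 0} ⊆ ℂ³`. -/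
def zeroSet (f : AffPoly) : Set (Fin 3 → ℂ) := {x | eval x f = 0}

/-- `{f = 0}` and `{g = 0}` are affinely equivalent: an affine automorphism of `ℂ³` maps one
onto the other. -/
def AffinelyEquivalent (f g : AffPoly) : Prop :=
  ∃ φ : (Fin 3 → ℂ) ≃ᵃ[ℂ] (Fin 3 → ℂ), φ '' zeroSet f = zeroSet g

/-- The affine surface `{f = 0}` is smooth: the gradient of `f` vanishes at none of its points. -/
def IsSmoothAffine (f : AffPoly) : Prop :=
  ∀ x : Fin 3 → ℂ, eval x f = 0 → ∃ i, eval x (pderiv i f) ≠ 0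

/-- The (affine) lines contained in the affine surface `{f = 0}`. -/
def affineLines (f : AffPoly) : Set (AffineSubspace ℂ (Fin 3 → ℂ)) :=
  {l | Module.finrank ℂ l.direction = 1 ∧ (l : Set (Fin 3 → ℂ)) ⊆ zeroSet f}

/-- The cubic form `X₀³ f(X₁/X₀, X₂/X₀, X₃/X₀)`, which defines the canonical projective completion
of `{f = 0}` when `f` is a cubic polynomial. -/
def completion (f : AffPoly) : ProjPoly :=
  ∑ d ∈ Finset.range 4, X 0 ^ (3 - d) * rename Fin.succ (homogeneousComponent d f)

/-- Homogeneous coordinates of the point `[0 : y₁ : y₂ : y₃]` at infinity. -/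
def atInfinity (y : Fin 3 → ℂ) : Fin 4 → ℂ := Fin.cons 0 y

/-- `f` is a cubic polynomial, and the curve at infinity of the projective completion of `{f = 0}`
is the product of the three lines `L k = 0`, which form a triangle: any two of the lines meet in
exactly one point, and the three intersection points are distinct. The corner `P k` is (a
homogeneous coordinate vector of) the intersection point of the two lines other than `L k`. -/
structure HasTriangleAtInfinity (f : AffPoly) (L : Fin 3 → Module.Dual ℂ (Fin 3 → ℂ))
    (P : Fin 3 → Fin 3 → ℂ) : Prop where
  totalDegree_eq : f.totalDegree = 3
  curve_at_infinity : ∀ y, eval (atInfinity y) (completion f) = ∏ k, L k y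
  corner_ne_zero : ∀ k, P k ≠ 0
  inter_eq_corner : ∀ i j k, i ≠ j → j ≠ k → k ≠ i →
    LinearMap.ker (L i) ⊓ LinearMap.ker (L j) = Submodule.span ℂ {P k}
  corners_distinct : ∀ k l, k ≠ l → Submodule.span ℂ {P k} ≠ Submodule.span ℂ {P l}

/-- `[p]` is a singular point of the projective surface `{F = 0}`. -/
def IsSingularPt (F : ProjPoly) (p : Fin 4 → ℂ) : Prop :=
  eval p F = 0 ∧ ∀ i, eval p (pderiv i F) = 0

/-- `[p]` is a regular point of the projective surface `{F = 0}`. -/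
def IsRegularPt (F : ProjPoly) (p : Fin 4 → ℂ) : Prop :=
  eval p F = 0 ∧ ∃ i, eval p (pderiv i F) ≠ 0

/-- The function germ `h` at `a ∈ ℂ³` is of Arnol'd type `A_n`: there are local holomorphic
coordinates `v = g(u)` centred at `a` in which `h = v₂ v₃ + v₁ ^ (n + 1)`. -/
def IsGermOfTypeA (n : ℕ) (h : (Fin 3 → ℂ) → ℂ) (a : Fin 3 → ℂ) : Prop :=
  ∃ g : (Fin 3 → ℂ) → (Fin 3 → ℂ), AnalyticAt ℂ g a ∧ g a = 0 ∧ (fderiv ℂ g a).IsInvertible ∧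
    ∀ᶠ u in 𝓝 a, h u = g u 1 * g u 2 + g u 0 ^ (n + 1)

/-- The projective surface `{F = 0}` has at `[p]` a singularity of type `A_n` (`n ≥ 1`): in an
affine chart `u ↦ [p + u₁ b₁ + u₂ b₂ + u₃ b₃]` of `ℙ³` centred at `[p]`, its local equation is
a germ of type `A_n`. -/
def HasSingularityA (n : ℕ) (F : ProjPoly) (p : Fin 4 → ℂ) : Prop :=
  1 ≤ n ∧ ∃ b : Module.Basis (Fin 4) ℂ (Fin 4 → ℂ), b 0 = p ∧
    IsGermOfTypeA n (fun u => eval (b 0 + ∑ j : Fin 3, u j • b j.succ) F) 0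

/-- The point `[p]` of `{F = 0}` has type `A_n` for `n ≥ 1`; for `n = 0` it is a regular point
(the symbol `-`). -/
def HasPointType (F : ProjPoly) (p : Fin 4 → ℂ) (n : ℕ) : Prop :=
  (n = 0 ∧ IsRegularPt F p) ∨ HasSingularityA n F p

/-- `x₁x₂x₃ + ε₁x₁² + ε₂x₂² + ε₃x₃² + ω₁x₁ + ω₂x₂ + ω₃x₃ + ω₄`
(with `ε₁, ε₂, ε₃ = ε 0, ε 1, ε 2` and `ω₁, …, ω₄ = ω 0, …, ω 3`). -/
def normalForm (ε : Fin 3 → ℂ) (ω : Fin 4 → ℂ) : AffPoly :=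
  X 0 * X 1 * X 2 + ∑ i, C (ε i) * X i ^ 2 + ∑ i : Fin 3, C (ω i.castSucc) * X i + C (ω 3)

/-- The `k`-th coordinate vector of `ℂ³`; `[0 : 1 : 0 : 0]`, `[0 : 0 : 1 : 0]`, `[0 : 0 : 0 : 1]`
are the points `atInfinity (coordPt k)`. -/
def coordPt (k : Fin 3) : Fin 3 → ℂ := Pi.single k 1

/-- The coordinate forms `x₁, x₂, x₃`. -/
def coordForm (k : Fin 3) : Module.Dual ℂ (Fin 3 → ℂ) := LinearMap.proj k

/-- A row of the classification table. -/
structure TableRow where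
  /-- types at the three corners: `n` stands for `A_n`, and `0` for a regular point -/
  types : Fin 3 → ℕ
  /-- number of affine lines -/
  lines : ℕ
  /-- the `ε`'s of the listed normal form -/
  eps : Fin 3 → ℂ
  /-- the coefficients `ω₁, …, ω₄` of the listed normal form in terms of its parameters
  (of which only those that are written are present) -/
  coeff : (Fin 4 → ℂ) → Fin 4 → ℂ
  /-- the parameters for which these coefficients are defined -/
  domain : (Fin 4 → ℂ) → Prop := fun _ => True

/-- The function `R` of the second row. -/
def R (a b c : ℂ) : ℂ := 1 + c ^ 2 - c * (b + a * c) * (a + b * c) / (c ^ 2 - 1) ^ 2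

/-- The classification table. -/
def table : Fin 15 → TableRow := ![
  { types := ![0, 0, 0], lines := 24, eps := ![1, 1, 1], coeff := fun w => w },
  { types := ![0, 0, 1], lines := 18, eps := ![1, 1, 0],
    coeff := fun w => ![w 0, w 1, w 2, R (w 0) (w 1) (w 2)], domain := fun w => w 2 ^ 2 ≠ 1 },
  { types := ![0, 0, 2], lines := 12, eps := ![1, 1, 0],
    coeff := fun w => ![w 0, w 1, 0, w 0 - 1] },
  { types := ![0, 0, 3], lines := 7, eps := ![1, 1, 0], coeff := fun w => ![w 0, -1, 0, 0] },
  { types := ![0, 0, 4], lines := 3, eps := ![1, 1, 0], coeff := fun _ => ![0, -1, 0, 0] },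
  { types := ![0, 1, 1], lines := 13, eps := ![1, 0, 0],
    coeff := fun w => ![w 0, w 1, w 1, w 1 * (1 + w 0 - w 1)] },
  { types := ![1, 1, 1], lines := 9, eps := ![0, 0, 0],
    coeff := fun w => ![-1, w 1, -1, -w 1 + 1] },
  { types := ![0, 1, 2], lines := 8, eps := ![1, 0, 0], coeff := fun w => ![w 0, -1, 0, 1] },
  { types := ![1, 1, 2], lines := 5, eps := ![0, 0, 0], coeff := fun _ => ![-1, -1, 0, 1] },
  { types := ![0, 2, 2], lines := 4, eps := ![1, 0, 0], coeff := fun w => ![w 0, 0, 0, 1] },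
  { types := ![0, 1, 3], lines := 4, eps := ![1, 0, 0], coeff := fun _ => ![-1, -1, 0, 0] },
  { types := ![1, 1, 3], lines := 2, eps := ![0, 0, 0], coeff := fun _ => ![-1, -1, 0, 0] },
  { types := ![1, 2, 2], lines := 2, eps := ![0, 0, 0], coeff := fun _ => ![-1, 0, 0, 1] },
  { types := ![0, 1, 4], lines := 1, eps := ![1, 0, 0], coeff := fun _ => ![0, -1, 0, 0] },
  { types := ![2, 2, 2], lines := 0, eps := ![0, 0, 0], coeff := fun _ => ![0, 0, 0, 1] }]

/-- The cubic listed in row `r`, for the parameters `w`. -/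
def tableCubic (r : Fin 15) (w : Fin 4 → ℂ) : AffPoly :=
  normalForm (table r).eps ((table r).coeff w)

/-- After a relabelling of the corners `P k` at infinity, the projective completion of `{f = 0}`
has at them the point types listed in row `r`. -/
def HasConfiguration (f : AffPoly) (P : Fin 3 → Fin 3 → ℂ) (r : Fin 15) : Prop :=
  ∃ σ : Equiv.Perm (Fin 3), ∀ k,
    HasPointType (completion f) (atInfinity (P (σ k))) ((table r).types k)

end AffineCubic

end

noncomputable section

namespace AffineCubic

open MvPolynomial

/-! ### Evaluation of polynomials as differentiable functions -/

/-! Normal form. The three linear forms at infinity are independent, so they serve as coordinates. A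
translation then absorbs the mixed quadratic terms, and a diagonal scaling turns the nonzero ε's
into 1.

Corners. In the chart X_k = 1 with ε_k = 0, put z = X₀. The local equation is a quadratic polynomial
in (x_i, x_j) whose coefficients are polynomials in z and whose quadratic part at z = 0 is x_i x_j.
Factoring the quadratic part and completing the square leaves the critical value ω_k z² + ω₄ z³ + z⁴
(ε_j ω_i² z + ε_i ω_j² z - ω_i ω_j) / (1 - 4 ε_i ε_j z²), and if this vanishes to order n + 1 the
type is A_n (`isGermOfTypeA_of_remainder`). The type is well defined because n is the largest order
to which the differential can vanish along an immersed curve through the point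
(`HasSingularityA.le_of_hasContact`).

Table. Permutations and scalings of the coordinates bring every smooth normal form to a listed cubic
(`hasRow_of_isSmoothAffine`). Smoothness makes certain coefficients nonzero; in the row with ε = (1,
1, 0) and ω₃ ≠ 0 it also supplies a degenerate plane section x₃ = u with u² ≠ 4, from which the
parameter of R is read off. Since types are unique, the row is determined.

Lines. If v is the direction of a line on the surface, the leading coefficient v₁v₂v₃ of the
restricted cubic vanishes. The lines are therefore sorted by the coordinates that vanish on v
(`encard_affineLines_normalForm`). In each class they are counted by nonzero roots of explicit
polynomials of degree at most four, or in pairs by the degenerate conics in planes x_k = c. A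
multiple root would produce a singular point of the surface, so on a smooth surface the relevant
roots are simple and degrees give the numbers.

Generic smoothness. In the rows that need it, the parameters with a singular point lie in the image
of a hypersurface under a polynomial map between spaces of equal dimension. Such an image lies in a
hypersurface (`exists_ne_zero_eval_eq_zero`). The other rows are settled directly. -/

theorem hasFDerivAt_eval {n : ℕ} (F : MvPolynomial (Fin n) ℂ) (p : Fin n → ℂ) :
    HasFDerivAt (fun x : Fin n → ℂ => eval x F)
      (∑ i, eval p (pderiv i F) • (ContinuousLinearMap.proj i : (Fin n → ℂ) →L[ℂ] ℂ)) p := by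
  induction F using MvPolynomial.induction_on with
  | C a => 
    refine ((hasFDerivAt_const (𝕜 := ℂ) a p).congr_fderiv ?_).congr_of_eventuallyEq
      (Filter.Eventually.of_forall fun x => by simp)
    ext v
    simp
  | add f g hf hg =>
    refine ((hf.fun_add hg).congr_fderiv ?_).congr_of_eventuallyEq
      (Filter.Eventually.of_forall fun x => by simp)
    ext v
    simp [add_mul, Finset.sum_add_distrib]
  | mul_X f i hf =>
    have hi : HasFDerivAt (fun x : Fin n → ℂ => x i) (ContinuousLinearMap.proj i) p :=
      (ContinuousLinearMap.proj (R := ℂ) (φ := fun _ : Fin n => ℂ) i).hasFDerivAt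
    refine ((hf.fun_mul hi).congr_fderiv ?_).congr_of_eventuallyEq
      (Filter.Eventually.of_forall fun x => by simp)
    ext v
    simp [Pi.single_apply, pderiv_X, Finset.mul_sum, apply_ite (eval p), add_mul,
      Finset.sum_add_distrib, mul_assoc]

/-- Trades formal partial derivatives for the Fréchet derivative, so that singular points can be
followed through coordinate changes by the chain rule. -/
theorem fderiv_eval_eq_zero_iff {n : ℕ} (F : MvPolynomial (Fin n) ℂ) (p : Fin n → ℂ) :
    fderiv ℂ (fun x : Fin n → ℂ => eval x F) p = 0 ↔ ∀ i, eval p (pderiv i F) = 0 := by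
  rw [(hasFDerivAt_eval F p).fderiv]
  constructor
  · intro h i
    have := congrArg (fun L : (Fin n → ℂ) →L[ℂ] ℂ => L (Pi.single i 1)) h
    simpa [Pi.single_apply] using this
  · intro h
    ext v
    simp [h]

theorem isSingularPt_iff (F : ProjPoly) (p : Fin 4 → ℂ) :
    IsSingularPt F p ↔ eval p F = 0 ∧ fderiv ℂ (fun x : Fin 4 → ℂ => eval x F) p = 0 := by
  rw [fderiv_eval_eq_zero_iff]; rfl

theorem isRegularPt_iff (F : ProjPoly) (p : Fin 4 → ℂ) :
    IsRegularPt F p ↔ eval p F = 0 ∧ fderiv ℂ (fun x : Fin 4 → ℂ => eval x F) p ≠ 0 := by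
  rw [Ne, fderiv_eval_eq_zero_iff, not_forall]; rfl

theorem isSmoothAffine_iff (f : AffPoly) :
    IsSmoothAffine f ↔
      ∀ x, eval x f = 0 → fderiv ℂ (fun x : Fin 3 → ℂ => eval x f) x ≠ 0 := by
  simp only [IsSmoothAffine, Ne, fderiv_eval_eq_zero_iff, not_forall]

/-! ### The completion of a cubic polynomial -/

theorem completion_isHomogeneous (f : AffPoly) : (completion f).IsHomogeneous 3 := by
  refine IsHomogeneous.sum _ _ _ fun d hd => ?_
  have hd' : d < 4 := Finset.mem_range.1 hd
  have h := ((isHomogeneous_X ℂ (0 : Fin 4)).pow (3 - d)).mul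
    ((homogeneousComponent_isHomogeneous d f).rename_isHomogeneous (f := Fin.succ))
  convert h using 1
  omega

theorem eval_smul_of_isHomogeneous {n d : ℕ} {F : MvPolynomial (Fin n) ℂ} (hF : F.IsHomogeneous d)
    (c : ℂ) (x : Fin n → ℂ) : eval (c • x) F = c ^ d * eval x F := by
  rw [eval_eq', eval_eq', Finset.mul_sum]
  refine Finset.sum_congr rfl fun m hm => ?_
  have h : ∑ i, m i = d := by
    have := hF (mem_support_iff.1 hm)
    rw [Finsupp.weight_apply, Finsupp.sum_fintype] at this <;> simp_all
  simp only [Pi.smul_apply, smul_eq_mul, mul_pow, Finset.prod_mul_distrib, Finset.prod_pow_eq_pow_sum]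
  rw [h]; ring

theorem eval_completion (f : AffPoly) (p : Fin 4 → ℂ) :
    eval p (completion f) =
      ∑ d ∈ Finset.range 4, p 0 ^ (3 - d) * eval (Fin.tail p) (homogeneousComponent d f) := by
  simp only [completion, map_sum, map_mul, map_pow, eval_X, eval_rename]
  rfl

theorem eval_eq_sum_homogeneousComponent {f : AffPoly} (hf : f.totalDegree ≤ 3)
    (x : Fin 3 → ℂ) :
    eval x f = ∑ d ∈ Finset.range 4, eval x (homogeneousComponent d f) := by
  conv_lhs => rw [← sum_homogeneousComponent f]
  rw [map_sum]
  refine Finset.sum_subset (fun d hd => ?_) fun d _ hd => ?_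
  · simp only [Finset.mem_range] at hd ⊢; omega
  · rw [homogeneousComponent_eq_zero _ _ (by simpa using hd), map_zero]

/-- Together with the density of X₀ ≠ 0 this turns identities between completions into identities
between affine polynomials. -/
theorem eval_completion_of_ne {f : AffPoly} (hf : f.totalDegree ≤ 3) {p : Fin 4 → ℂ}
    (hp : p 0 ≠ 0) : eval p (completion f) = p 0 ^ 3 * eval ((p 0)⁻¹ • Fin.tail p) f := by
  rw [eval_completion, eval_eq_sum_homogeneousComponent hf, Finset.mul_sum]
  refine Finset.sum_congr rfl fun d hd => ?_
  rw [eval_smul_of_isHomogeneous (homogeneousComponent_isHomogeneous d f), ← mul_assoc]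
  have hd' : d < 4 := Finset.mem_range.1 hd
  have h3 : p 0 ^ 3 = p 0 ^ (3 - d) * p 0 ^ d := by rw [← pow_add]; congr 1; omega
  rw [h3, inv_pow, mul_assoc (p 0 ^ (3 - d)), mul_inv_cancel₀ (pow_ne_zero _ hp), mul_one]

theorem continuous_eval_point {n : ℕ} (F : MvPolynomial (Fin n) ℂ) :
    Continuous fun x : Fin n → ℂ => eval x F :=
  MvPolynomial.continuous_eval F

/-- Continuous functions on `ℂ⁴` that agree off the plane `X₀ = 0` are equal. -/
theorem eq_of_eq_off_infinity {u v : (Fin 4 → ℂ) → ℂ} (hu : Continuous u) (hv : Continuous v)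
    (h : ∀ p : Fin 4 → ℂ, p 0 ≠ 0 → u p = v p) : u = v := by
  have hd : Dense {p : Fin 4 → ℂ | p 0 ≠ 0} := by
    have h0 : Dense ({0}ᶜ : Set ℂ) := dense_compl_singleton 0
    exact h0.preimage (isOpenMap_eval 0)
  exact hu.ext_on hd hv fun p hp => h p hp

theorem eval_normalForm (ε : Fin 3 → ℂ) (ω : Fin 4 → ℂ) (x : Fin 3 → ℂ) :
    eval x (normalForm ε ω) = x 0 * x 1 * x 2 +
      (ε 0 * x 0 ^ 2 + ε 1 * x 1 ^ 2 + ε 2 * x 2 ^ 2) +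
      (ω 0 * x 0 + ω 1 * x 1 + ω 2 * x 2) + ω 3 := by
  simp [normalForm, Fin.sum_univ_three]

theorem totalDegree_normalForm_le (ε : Fin 3 → ℂ) (ω : Fin 4 → ℂ) :
    (normalForm ε ω).totalDegree ≤ 3 := by
  unfold normalForm
  refine (totalDegree_add _ _).trans (max_le ((totalDegree_add _ _).trans
    (max_le ((totalDegree_add _ _).trans (max_le ?_ ?_)) ?_)) (by simp))
  · refine (totalDegree_mul _ _).trans ?_
    have h := totalDegree_mul (X 0 : AffPoly) (X 1)
    simp only [totalDegree_X] at h ⊢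
    omega
  · refine totalDegree_finsetSum_le fun i _ => (totalDegree_mul _ _).trans ?_
    simp [totalDegree_X_pow]
  · refine totalDegree_finsetSum_le fun i _ => (totalDegree_mul _ _).trans ?_
    simp [totalDegree_X]

theorem completion_normalForm (ε : Fin 3 → ℂ) (ω : Fin 4 → ℂ) :
    completion (normalForm ε ω) = X 1 * X 2 * X 3 +
      X 0 * (C (ε 0) * X 1 ^ 2 + C (ε 1) * X 2 ^ 2 + C (ε 2) * X 3 ^ 2) +
      X 0 ^ 2 * (C (ω 0) * X 1 + C (ω 1) * X 2 + C (ω 2) * X 3) + C (ω 3) * X 0 ^ 3 := by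
  refine MvPolynomial.funext fun p => ?_
  refine congrFun (eq_of_eq_off_infinity (continuous_eval_point _) (continuous_eval_point _)
    fun q hq => ?_) p
  rw [eval_completion_of_ne (totalDegree_normalForm_le ε ω) hq, eval_normalForm]
  simp only [Fin.tail, Pi.smul_apply, smul_eq_mul, map_add, map_mul, map_pow, eval_X, eval_C]
  have e1 : (1 : Fin 3).succ = (2 : Fin 4) := rfl
  have e2 : (2 : Fin 3).succ = (3 : Fin 4) := rfl
  simp only [Fin.succ_zero_eq_one, e1, e2]
  field_simp

theorem eval_completion_normalForm (ε : Fin 3 → ℂ) (ω : Fin 4 → ℂ) (p : Fin 4 → ℂ) :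
    eval p (completion (normalForm ε ω)) = p 1 * p 2 * p 3 +
      p 0 * (ε 0 * p 1 ^ 2 + ε 1 * p 2 ^ 2 + ε 2 * p 3 ^ 2) +
      p 0 ^ 2 * (ω 0 * p 1 + ω 1 * p 2 + ω 2 * p 3) + ω 3 * p 0 ^ 3 := by
  simp [completion_normalForm]

theorem isSingularPt_normalForm_iff (ε : Fin 3 → ℂ) (ω : Fin 4 → ℂ) (p : Fin 4 → ℂ) :
    IsSingularPt (completion (normalForm ε ω)) p ↔
      eval p (completion (normalForm ε ω)) = 0 ∧
      (ε 0 * p 1 ^ 2 + ε 1 * p 2 ^ 2 + ε 2 * p 3 ^ 2) +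
        2 * p 0 * (ω 0 * p 1 + ω 1 * p 2 + ω 2 * p 3) + 3 * ω 3 * p 0 ^ 2 = 0 ∧
      p 2 * p 3 + 2 * ε 0 * p 0 * p 1 + ω 0 * p 0 ^ 2 = 0 ∧
      p 1 * p 3 + 2 * ε 1 * p 0 * p 2 + ω 1 * p 0 ^ 2 = 0 ∧
      p 1 * p 2 + 2 * ε 2 * p 0 * p 3 + ω 2 * p 0 ^ 2 = 0 := by
  refine and_congr_right fun _ => ?_
  rw [Fin.forall_fin_succ, Fin.forall_fin_succ, Fin.forall_fin_succ, Fin.forall_fin_one]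
  simp only [completion_normalForm]
  simp [pderiv_X, Fin.ext_iff]
  ring_nf

theorem isSmoothAffine_normalForm_iff (ε : Fin 3 → ℂ) (ω : Fin 4 → ℂ) :
    IsSmoothAffine (normalForm ε ω) ↔ ∀ x : Fin 3 → ℂ, eval x (normalForm ε ω) = 0 →
      x 1 * x 2 + 2 * ε 0 * x 0 + ω 0 = 0 → x 0 * x 2 + 2 * ε 1 * x 1 + ω 1 = 0 →
      x 0 * x 1 + 2 * ε 2 * x 2 + ω 2 = 0 → False := by
  have key : ∀ x : Fin 3 → ℂ, (∃ i, eval x (pderiv i (normalForm ε ω)) ≠ 0) ↔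
      ¬ (x 1 * x 2 + 2 * ε 0 * x 0 + ω 0 = 0 ∧ x 0 * x 2 + 2 * ε 1 * x 1 + ω 1 = 0 ∧
      x 0 * x 1 + 2 * ε 2 * x 2 + ω 2 = 0) := by
    intro x
    rw [← not_forall_not, Fin.forall_fin_succ, Fin.forall_fin_succ, Fin.forall_fin_one]
    simp only [normalForm, Fin.sum_univ_three]
    simp [pderiv_X, Fin.ext_iff]
    ring_nf
  simp only [IsSmoothAffine, key, not_and, imp_false]

/-! ### The order of contact determines the type of a singularity -/

theorem isBigO_of_coords {m : ℕ} {L : ℂ → ((Fin m → ℂ) →L[ℂ] ℂ)} {s : ℂ → ℂ}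
    (h : ∀ j, (fun t => L t (Pi.single j 1)) =O[𝓝 0] s) : L =O[𝓝 0] s := by
  have e : L = fun t => ∑ j, L t (Pi.single j 1) •
      (ContinuousLinearMap.proj j : (Fin m → ℂ) →L[ℂ] ℂ) := by
    ext t v
    conv_lhs => rw [show v = ∑ j, v j • Pi.single j (1 : ℂ) from by ext; simp [Pi.single_apply]]
    simp [mul_comm]
  rw [e]
  refine Asymptotics.IsBigO.fun_sum fun j _ => ?_
  refine ((h j).smul (Asymptotics.isBigO_const_const
    (ContinuousLinearMap.proj j : (Fin m → ℂ) →L[ℂ] ℂ) (one_ne_zero (α := ℂ)) _)).congr_right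
    fun t => ?_
  simp

theorem eventually_fderiv_typeA {n : ℕ} {h : (Fin 3 → ℂ) → ℂ} {g : (Fin 3 → ℂ) → (Fin 3 → ℂ)}
    (hg : AnalyticAt ℂ g 0) (hh : ∀ᶠ u in 𝓝 0, h u = g u 1 * g u 2 + g u 0 ^ (n + 1)) :
    ∀ᶠ u in 𝓝 0, ∀ w, fderiv ℂ h u w = g u 1 * fderiv ℂ g u w 2 + fderiv ℂ g u w 1 * g u 2 +
      (n + 1) * g u 0 ^ n * fderiv ℂ g u w 0 := by
  filter_upwards [hg.eventually_analyticAt, hh.eventually_nhds] with u hu hhu w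
  have hd := hasFDerivAt_pi'.1 hu.differentiableAt.hasFDerivAt
  have := ((hd 1).fun_mul (hd 2)).fun_add ((hasDerivAt_pow (n + 1) (g u 0)).comp_hasFDerivAt u (hd 0))
  rw [(this.congr_of_eventuallyEq hhu).fderiv]
  simp
  ring

/-- The curve is the v₁-axis of the good coordinates. There v₂ = v₃ = 0, so only t^(n+1) and (n+1)
t^n dv₁ remain. -/
theorem exists_curve_of_typeA {n : ℕ} {h : (Fin 3 → ℂ) → ℂ} (hA : IsGermOfTypeA n h 0) :
    ∃ (u : ℂ → Fin 3 → ℂ) (u' : Fin 3 → ℂ), HasDerivAt u u' 0 ∧ u 0 = 0 ∧ u' ≠ 0 ∧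
      (fun t => h (u t)) =O[𝓝 0] (fun t => t ^ n) ∧
      ∀ w, (fun t => fderiv ℂ h (u t) w) =O[𝓝 0] (fun t => t ^ n) := by
  obtain ⟨g, hg, hg0, ⟨A, hA⟩, hh⟩ := hA
  have hs : HasStrictFDerivAt g (A : (Fin 3 → ℂ) →L[ℂ] (Fin 3 → ℂ)) 0 := by
    rw [hA]; exact hg.hasStrictFDerivAt
  set e : Fin 3 → ℂ := Pi.single 0 1
  let u : ℂ → Fin 3 → ℂ := fun t => hs.localInverse g A 0 (t • e)
  have hl : HasDerivAt (fun t : ℂ => t • e) e 0 := by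
    simpa using (hasDerivAt_id (0 : ℂ)).smul_const e
  have hu : HasDerivAt u (A.symm e) 0 := by
    have := hs.to_localInverse.hasFDerivAt
    rw [hg0] at this
    exact HasFDerivAt.comp_hasDerivAt_of_eq (0 : ℂ) this hl (by simp)
  have hu0 : u 0 = 0 := by
    have := hs.localInverse_apply_image
    rw [hg0] at this
    simpa [u] using this
  have htend : Filter.Tendsto u (𝓝 0) (𝓝 0) := by simpa [hu0] using hu.continuousAt.tendsto
  have hr : ∀ᶠ t in 𝓝 (0 : ℂ), g (u t) = t • e := by
    have h1 := hs.eventually_right_inverse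
    rw [hg0] at h1
    have h2 : Filter.Tendsto (fun t : ℂ => t • e) (𝓝 0) (𝓝 0) := by
      simpa using hl.continuousAt.tendsto
    exact h2.eventually h1
  refine ⟨u, A.symm e, hu, hu0, ?_, ?_, fun w => ?_⟩
  · rw [Ne, EmbeddingLike.map_eq_zero_iff]
    exact Pi.single_ne_zero_iff.2 one_ne_zero
  · have : (fun t => h (u t)) =ᶠ[𝓝 0] fun t => t * t ^ n := by
      filter_upwards [htend.eventually hh, hr] with t h1 h2
      rw [h1, h2]
      simp [e, pow_succ, mul_comm]
    refine this.trans_isBigO ?_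
    simpa using (continuous_id.continuousAt.norm.isBoundedUnder_le).isBigO_one ℂ
      |>.mul (Asymptotics.isBigO_refl (fun t : ℂ => t ^ n) (𝓝 0))
  · have : (fun t => fderiv ℂ h (u t) w) =ᶠ[𝓝 0]
        fun t => ((n + 1) * fderiv ℂ g (u t) w 0) * t ^ n := by
      filter_upwards [htend.eventually (eventually_fderiv_typeA hg hh), hr] with t h1 h2
      rw [h1, h2]
      simp [e]
      ring
    refine this.trans_isBigO ?_
    have hc : ContinuousAt (fun t => ((n : ℂ) + 1) * fderiv ℂ g (u t) w 0) 0 := by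
      have h1 : ContinuousAt (fun t => fderiv ℂ g (u t)) 0 := by
        refine ContinuousAt.comp (g := fderiv ℂ g) ?_ hu.continuousAt
        rw [hu0]; exact hg.fderiv.continuousAt
      have h2 : ContinuousAt (fun t => fderiv ℂ g (u t) w) 0 := h1.clm_apply continuousAt_const
      exact continuousAt_const.mul (continuousAt_pi.1 h2 0)
    simpa using (hc.norm.isBoundedUnder_le).isBigO_one ℂ
      |>.mul (Asymptotics.isBigO_refl (fun t : ℂ => t ^ n) (𝓝 0))

/-- If `v` has a nonzero derivative at `0`, then `v ^ n = O(t ^ m)` forces `m ≤ n`. -/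
theorem le_of_isBigO_pow {v : ℂ → ℂ} {v' : ℂ} {n m : ℕ} (hv : HasDerivAt v v' 0) (h0 : v 0 = 0)
    (hv' : v' ≠ 0) (h : (fun t => v t ^ n) =O[𝓝 0] (fun t => t ^ m)) : m ≤ n := by
  have h1 : (fun t : ℂ => t) =O[𝓝 0] v := by
    have := (HasDerivAtFilter.isTheta_sub hv hv').2.comp_tendsto
      (Filter.tendsto_id.prodMk (Filter.tendsto_pure.2 (Filter.Eventually.of_forall fun _ => rfl) :
        Filter.Tendsto (fun _ : ℂ => (0 : ℂ)) (𝓝 0) (pure 0)))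
    simpa [Function.comp_def, h0] using this
  have h2 : (fun t : ℂ => t ^ n) =O[𝓝 0] fun t => t ^ m := (h1.pow n).trans h
  by_contra hlt
  push Not at hlt
  have h3 : (fun t : ℂ => t ^ m) =o[𝓝 0] fun t => t ^ n := Asymptotics.isLittleO_pow_pow hlt
  have h4 := (h2.trans_isLittleO h3)
  have h5 := (Asymptotics.isLittleO_irrefl' (f' := fun t : ℂ => t ^ n) (l := 𝓝 0)) ?_
  · exact h5 h4
  · have : ∃ᶠ t : ℂ in 𝓝[≠] 0, ‖t ^ n‖ ≠ 0 := by
      refine Filter.Eventually.frequently ?_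
      filter_upwards [self_mem_nhdsWithin] with t ht
      exact norm_ne_zero_iff.2 (pow_ne_zero _ ht)
    exact this.filter_mono nhdsWithin_le_nhds

/-- The partial derivatives v₂, v₃ and (n+1) v₁^n of the model must all be O(t^m) along the curve.
As the velocity is nonzero, some v_i vanishes to order exactly one, which gives m ≤ n or m ≤ 1 ≤ n.
-/
theorem le_of_curve_typeA {n m : ℕ} (hn : 1 ≤ n) {h : (Fin 3 → ℂ) → ℂ}
    (hA : IsGermOfTypeA n h 0) {u : ℂ → Fin 3 → ℂ} {u' : Fin 3 → ℂ} (hu : HasDerivAt u u' 0)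
    (hu0 : u 0 = 0) (hu' : u' ≠ 0)
    (hO : ∀ w, (fun t => fderiv ℂ h (u t) w) =O[𝓝 0] (fun t => t ^ m)) : m ≤ n := by
  obtain ⟨g, hg, hg0, ⟨A, hA⟩, hh⟩ := hA
  have htend : Filter.Tendsto u (𝓝 0) (𝓝 0) := by simpa [hu0] using hu.continuousAt.tendsto
  have hO' : (fun t => fderiv ℂ h (u t)) =O[𝓝 0] (fun t => t ^ m) :=
    isBigO_of_coords fun j => hO _
  -- Near 0 this is the inverse of the differential of the coordinates, and it stays bounded.
  -- Applying dh to B(t)w therefore isolates the partial derivatives of the model.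
  let B : ℂ → ((Fin 3 → ℂ) →L[ℂ] (Fin 3 → ℂ)) := fun t => Ring.inverse (fderiv ℂ g (u t))
  let U : ((Fin 3 → ℂ) →L[ℂ] (Fin 3 → ℂ))ˣ := ContinuousLinearEquiv.toUnit A
  have hU : (U : (Fin 3 → ℂ) →L[ℂ] (Fin 3 → ℂ)) = fderiv ℂ g 0 := hA
  have h1 : ContinuousAt (fun t => fderiv ℂ g (u t)) 0 := by
    refine ContinuousAt.comp (g := fderiv ℂ g) ?_ hu.continuousAt
    rw [hu0]; exact hg.fderiv.continuousAt
  have hB : ContinuousAt B 0 := by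
    refine ContinuousAt.comp (g := Ring.inverse) ?_ h1
    rw [hu0, ← hU]
    exact NormedRing.inverse_continuousAt U
  have hinv : ∀ᶠ t in 𝓝 (0 : ℂ), ∀ w, fderiv ℂ g (u t) (B t w) = w := by
    have h2 : ∀ᶠ t in 𝓝 (0 : ℂ), IsUnit (fderiv ℂ g (u t)) := by
      refine h1.eventually (Units.isOpen.mem_nhds ?_)
      show IsUnit (fderiv ℂ g (u 0))
      rw [hu0, ← hU]
      exact U.isUnit
    filter_upwards [h2] with t ht w
    exact congrArg (fun L : (Fin 3 → ℂ) →L[ℂ] (Fin 3 → ℂ) => L w) (Ring.mul_inverse_cancel _ ht)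
  have key : ∀ w : Fin 3 → ℂ, (fun t => g (u t) 1 * w 2 + w 1 * g (u t) 2 +
      (n + 1) * g (u t) 0 ^ n * w 0) =O[𝓝 0] (fun t => t ^ m) := by
    intro w
    have h2 : (fun t => fderiv ℂ h (u t) (B t w)) =O[𝓝 0] (fun t => t ^ m) := by
      refine (Asymptotics.IsBigO.of_bound 1 (g := fun t => ‖fderiv ℂ h (u t)‖ * ‖B t w‖)
        (Filter.Eventually.of_forall fun t => ?_)).trans ?_
      · simpa using (fderiv ℂ h (u t)).le_opNorm (B t w)
      · have h3 : ContinuousAt (fun t => B t w) 0 := hB.clm_apply continuousAt_const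
        have h4 : (fun t => ‖B t w‖) =O[𝓝 0] (fun _ => (1 : ℂ)) :=
          (h3.norm.isBoundedUnder_le.isBigO_one ℂ).norm_left
        simpa using hO'.norm_left.mul h4
    refine Filter.EventuallyEq.trans_isBigO ?_ h2
    filter_upwards [htend.eventually (eventually_fderiv_typeA hg hh), hinv] with t h3 h4
    rw [h3, h4]
  have hv : HasDerivAt (fun t => g (u t)) (A u') 0 := by
    have h2 : HasFDerivAt g (A : (Fin 3 → ℂ) →L[ℂ] (Fin 3 → ℂ)) 0 := by
      rw [hA]; exact hg.differentiableAt.hasFDerivAt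
    exact HasFDerivAt.comp_hasDerivAt_of_eq (0 : ℂ) h2 hu hu0.symm
  have hvi := hasDerivAt_pi.1 hv
  have hv0 : ∀ i, g (u 0) i = 0 := fun i => by rw [hu0, hg0]; rfl
  have hne : A u' ≠ 0 := by rwa [Ne, EmbeddingLike.map_eq_zero_iff]
  obtain ⟨i, hi⟩ := Function.ne_iff.1 hne
  fin_cases i
  · refine le_of_isBigO_pow (hvi 0) (hv0 0) hi ?_
    have := (key (Pi.single 0 1)).const_mul_left ((n : ℂ) + 1)⁻¹
    refine this.congr_left fun t => ?_
    have : (n : ℂ) + 1 ≠ 0 := by exact_mod_cast n.succ_ne_zero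
    simp
    field_simp
  · refine (le_of_isBigO_pow (n := 1) (hvi 1) (hv0 1) hi ?_).trans hn
    simpa using key (Pi.single 2 1)
  · refine (le_of_isBigO_pow (n := 1) (hvi 2) (hv0 2) hi ?_).trans hn
    simpa using key (Pi.single 1 1)

/-! ### Contact in homogeneous coordinates, and uniqueness of the type -/

/-- Some curve through `[p]`, not tangent to the fibre of the cone over it, along which the
differential of `F` vanishes to order `m`. -/
def HasContact (m : ℕ) (F : ProjPoly) (p : Fin 4 → ℂ) : Prop :=
  ∃ (γ : ℂ → Fin 4 → ℂ) (q : Fin 4 → ℂ), HasDerivAt γ q 0 ∧ γ 0 = p ∧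
    q ∉ Submodule.span ℂ {p} ∧
    ∀ v, (fun t => fderiv ℂ (fun x : Fin 4 → ℂ => eval x F) (γ t) v) =O[𝓝 0] (fun t => t ^ m)

theorem fderiv_eval_smul {F : ProjPoly} (hF : F.IsHomogeneous 3) {c : ℂ} (hc : c ≠ 0)
    (x v : Fin 4 → ℂ) : fderiv ℂ (fun x : Fin 4 → ℂ => eval x F) (c • x) v =
      c ^ 2 * fderiv ℂ (fun x : Fin 4 → ℂ => eval x F) x v := by
  have h1 : HasFDerivAt (fun y : Fin 4 → ℂ => eval (c • y) F)
      ((fderiv ℂ (fun x : Fin 4 → ℂ => eval x F) (c • x)).comp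
        (c • ContinuousLinearMap.id ℂ (Fin 4 → ℂ) : (Fin 4 → ℂ) →L[ℂ] (Fin 4 → ℂ))) x := by
    have h0 := (hasFDerivAt_eval F (c • x)).differentiableAt.hasFDerivAt
    exact h0.comp x (c • ContinuousLinearMap.id ℂ (Fin 4 → ℂ) :
      (Fin 4 → ℂ) →L[ℂ] (Fin 4 → ℂ)).hasFDerivAt
  have h2 : HasFDerivAt (fun y : Fin 4 → ℂ => eval (c • y) F)
      (c ^ 3 • fderiv ℂ (fun x : Fin 4 → ℂ => eval x F) x) x := by
    simp only [eval_smul_of_isHomogeneous hF]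
    exact (hasFDerivAt_eval F _).differentiableAt.hasFDerivAt.const_mul (c ^ 3)
  have h3 := congrArg (fun L : (Fin 4 → ℂ) →L[ℂ] ℂ => L v) (h1.unique h2)
  simp at h3
  refine mul_left_cancel₀ hc ?_
  rw [h3]; ring

/-- Euler's identity: differentiate F(cx) = c³F(x) in c at c = 1. -/
theorem fderiv_eval_self {F : ProjPoly} (hF : F.IsHomogeneous 3) (x : Fin 4 → ℂ) :
    fderiv ℂ (fun x : Fin 4 → ℂ => eval x F) x x = 3 * eval x F := by
  have h1 : HasDerivAt (fun c : ℂ => eval (c • x) F)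
      (fderiv ℂ (fun x : Fin 4 → ℂ => eval x F) x x) 1 := by
    have h : HasDerivAt (fun c : ℂ => c • x) x 1 := by
      simpa using (hasDerivAt_id (1 : ℂ)).smul_const x
    have h0 := (hasFDerivAt_eval F x).differentiableAt.hasFDerivAt
    exact h0.comp_hasDerivAt_of_eq (1 : ℂ) h (by simp)
  have h2 : HasDerivAt (fun c : ℂ => eval (c • x) F) (3 * eval x F) 1 := by
    simp only [eval_smul_of_isHomogeneous hF]
    simpa using (hasDerivAt_pow 3 (1 : ℂ)).mul_const (eval x F)
  exact h1.unique h2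

theorem fderiv_chart (F : ProjPoly) (b : Module.Basis (Fin 4) ℂ (Fin 4 → ℂ)) (u w : Fin 3 → ℂ) :
    fderiv ℂ (fun u : Fin 3 → ℂ => eval (b 0 + ∑ j : Fin 3, u j • b j.succ) F) u w =
      fderiv ℂ (fun x : Fin 4 → ℂ => eval x F) (b 0 + ∑ j : Fin 3, u j • b j.succ)
        (∑ j : Fin 3, w j • b j.succ) := by
  have h1 : HasFDerivAt (fun u : Fin 3 → ℂ => b 0 + ∑ j : Fin 3, u j • b j.succ)
      (∑ j : Fin 3, (ContinuousLinearMap.proj j : (Fin 3 → ℂ) →L[ℂ] ℂ).smulRight (b j.succ)) u := by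
    refine HasFDerivAt.const_add _ (HasFDerivAt.fun_sum fun j _ => ?_)
    exact (ContinuousLinearMap.proj (R := ℂ) (φ := fun _ : Fin 3 => ℂ) j).hasFDerivAt.smul_const _
  have h2 := (hasFDerivAt_eval F (b 0 + ∑ j : Fin 3, u j • b j.succ)).differentiableAt.hasFDerivAt
  have h3 := HasFDerivAt.comp u h2 h1
  rw [show (fun u : Fin 3 → ℂ => eval (b 0 + ∑ j : Fin 3, u j • b j.succ) F) =
    (fun x : Fin 4 → ℂ => eval x F) ∘ (fun u : Fin 3 → ℂ => b 0 + ∑ j : Fin 3, u j • b j.succ)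
    from rfl, h3.fderiv]
  simp

/-- A chart sees only the derivatives along b₁, b₂, b₃. The derivative along b₀ is recovered from
Euler's identity, which is why the curve must also keep F itself of order t^n. -/
theorem HasSingularityA.hasContact {n : ℕ} {F : ProjPoly} {p : Fin 4 → ℂ}
    (hF : F.IsHomogeneous 3) (h : HasSingularityA n F p) : HasContact n F p := by
  obtain ⟨hn, b, rfl, hA⟩ := h
  obtain ⟨u, u', hu, hu0, hu', hO, hdO⟩ := exists_curve_of_typeA hA
  have huj := hasDerivAt_pi.1 hu
  refine ⟨fun t => b 0 + ∑ j : Fin 3, u t j • b j.succ, ∑ j : Fin 3, u' j • b j.succ, ?_, ?_, ?_,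
    ?_⟩
  · exact HasDerivAt.const_add _ (HasDerivAt.fun_sum fun j _ => (huj j).smul_const _)
  · simp [hu0]
  · intro hmem
    obtain ⟨c, hc⟩ := Submodule.mem_span_singleton.1 hmem
    refine hu' (funext fun j => ?_)
    have := congrArg (fun v => b.repr v j.succ) hc
    simp [Finsupp.single_apply, Fin.succ_ne_zero] at this
    simpa using this.symm
  · have hj : ∀ j : Fin 3, (fun t => fderiv ℂ (fun x : Fin 4 → ℂ => eval x F)
        (b 0 + ∑ j : Fin 3, u t j • b j.succ) (b j.succ)) =O[𝓝 0] (fun t => t ^ n) := by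
      intro j
      refine (hdO (Pi.single j 1)).congr_left fun t => ?_
      rw [fderiv_chart]
      simp [Pi.single_apply]
    have h0 : (fun t => fderiv ℂ (fun x : Fin 4 → ℂ => eval x F)
        (b 0 + ∑ j : Fin 3, u t j • b j.succ) (b 0)) =O[𝓝 0] (fun t => t ^ n) := by
      have h1 : (fun t => ∑ j : Fin 3, u t j * fderiv ℂ (fun x : Fin 4 → ℂ => eval x F)
          (b 0 + ∑ j : Fin 3, u t j • b j.succ) (b j.succ)) =O[𝓝 0] (fun t => t ^ n) := by
        refine Asymptotics.IsBigO.fun_sum fun j _ => ?_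
        simpa using ((huj j).continuousAt.norm.isBoundedUnder_le.isBigO_one ℂ).mul (hj j)
      refine ((hO.const_mul_left 3).sub h1).congr_left fun t => ?_
      have := fderiv_eval_self hF (b 0 + ∑ j : Fin 3, u t j • b j.succ)
      rw [← this, map_add, map_sum]
      simp
    intro v
    have : (fun t => fderiv ℂ (fun x : Fin 4 → ℂ => eval x F)
        (b 0 + ∑ j : Fin 3, u t j • b j.succ) v) = fun t => ∑ i, b.repr v i *
        fderiv ℂ (fun x : Fin 4 → ℂ => eval x F) (b 0 + ∑ j : Fin 3, u t j • b j.succ) (b i) := by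
      funext t
      conv_lhs => rw [← b.sum_repr v]
      simp only [map_sum, map_smul, smul_eq_mul]
    rw [this]
    refine Asymptotics.IsBigO.fun_sum fun i _ => ?_
    induction i using Fin.cases with
    | zero => exact h0.const_mul_left _
    | succ j => exact (hj j).const_mul_left _

/-- Dividing the curve by its b₀-coordinate moves it into the chart. By homogeneity this multiplies
the differential by a bounded factor, and the chart curve has nonzero velocity because q is not
proportional to p. -/
theorem HasSingularityA.le_of_hasContact {n m : ℕ} {F : ProjPoly} {p : Fin 4 → ℂ}
    (hF : F.IsHomogeneous 3) (h : HasSingularityA n F p) (hm : HasContact m F p) : m ≤ n := by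
  obtain ⟨hn, b, rfl, hA⟩ := h
  obtain ⟨γ, q, hγ, hγ0, hq, hO⟩ := hm
  let κ : Fin 4 → ((Fin 4 → ℂ) →L[ℂ] ℂ) := fun i => LinearMap.toContinuousLinearMap (b.coord i)
  have hκ : ∀ i, HasDerivAt (fun t => b.repr (γ t) i) (b.repr q i) 0 := fun i =>
    (κ i).hasFDerivAt.comp_hasDerivAt (0 : ℂ) hγ
  have hl0 : b.repr (γ 0) 0 = 1 := by simp [hγ0]
  let u : ℂ → Fin 3 → ℂ := fun t j => b.repr (γ t) j.succ / b.repr (γ t) 0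
  have hu : HasDerivAt u (fun j => b.repr q j.succ) 0 := by
    refine hasDerivAt_pi.2 fun j => ?_
    have h1 := (hκ j.succ).fun_div (hκ 0) (by rw [hl0]; exact one_ne_zero)
    have h2 : b.repr (γ 0) j.succ = 0 := by
      simp [hγ0]
    rw [hl0, h2] at h1
    simpa using h1
  have hu0 : u 0 = 0 := by
    funext j
    simp [u, hγ0]
  have hu' : (fun j : Fin 3 => b.repr q j.succ) ≠ 0 := by
    intro h0
    refine hq (Submodule.mem_span_singleton.2 ⟨b.repr q 0, ?_⟩)
    conv_rhs => rw [← b.sum_repr q, Fin.sum_univ_succ]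
    have : ∀ j : Fin 3, b.repr q j.succ = 0 := fun j => congrFun h0 j
    simp [this]
  refine le_of_curve_typeA hn hA hu hu0 hu' fun w => ?_
  have hev : ∀ᶠ t in 𝓝 (0 : ℂ), b.repr (γ t) 0 ≠ 0 :=
    (hκ 0).continuousAt.eventually_ne (by rw [hl0]; exact one_ne_zero)
  have hlim : ContinuousAt (fun t => ((b.repr (γ t) 0)⁻¹) ^ 2) 0 :=
    ((hκ 0).continuousAt.inv₀ (by rw [hl0]; exact one_ne_zero)).pow 2
  have h1 : (fun t => ((b.repr (γ t) 0)⁻¹) ^ 2 * fderiv ℂ (fun x : Fin 4 → ℂ => eval x F) (γ t)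
      (∑ j : Fin 3, w j • b j.succ)) =O[𝓝 0] (fun t => t ^ m) := by
    simpa using (hlim.norm.isBoundedUnder_le.isBigO_one ℂ).mul (hO (∑ j : Fin 3, w j • b j.succ))
  refine Filter.EventuallyEq.trans_isBigO ?_ h1
  filter_upwards [hev] with t ht
  rw [fderiv_chart, ← fderiv_eval_smul hF (inv_ne_zero ht)]
  congr 2
  have hs := b.sum_repr (γ t)
  rw [Fin.sum_univ_succ] at hs
  have hs' := congrArg (fun v => (b.repr (γ t) 0)⁻¹ • v) hs
  simp only [smul_add, smul_smul, inv_mul_cancel₀ ht, one_smul, Finset.smul_sum] at hs'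
  rw [← hs']
  congr 1
  refine Finset.sum_congr rfl fun j _ => ?_
  congr 1
  simp only [u]
  ring

theorem HasSingularityA.unique {n m : ℕ} {F : ProjPoly} {p : Fin 4 → ℂ}
    (hF : F.IsHomogeneous 3) (hn : HasSingularityA n F p) (hm : HasSingularityA m F p) : n = m :=
  le_antisymm (hm.le_of_hasContact hF (hn.hasContact hF)) (hn.le_of_hasContact hF (hm.hasContact hF))

theorem HasSingularityA.not_isRegularPt {n : ℕ} {F : ProjPoly} {p : Fin 4 → ℂ}
    (hF : F.IsHomogeneous 3) (hn : HasSingularityA n F p) : ¬ IsRegularPt F p := by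
  intro hr
  refine ((isRegularPt_iff F p).1 hr).2 ?_
  obtain ⟨γ, q, -, h0, -, hO⟩ := hn.hasContact hF
  ext v
  have h1 := (hO v).bound
  obtain ⟨C, hC⟩ := h1
  have h2 := hC.self_of_nhds
  rw [zero_pow (by have := hn.1; omega), norm_zero, mul_zero, h0] at h2
  simpa using h2

theorem HasPointType.unique {n m : ℕ} {F : ProjPoly} {p : Fin 4 → ℂ}
    (hF : F.IsHomogeneous 3) (hn : HasPointType F p n) (hm : HasPointType F p m) : n = m := by
  rcases hn with ⟨rfl, hn⟩ | hn <;> rcases hm with ⟨rfl, hm⟩ | hm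
  · rfl
  · exact absurd hn (hm.not_isRegularPt hF)
  · exact absurd hm (hn.not_isRegularPt hF)
  · exact hn.unique hF hm

/-! ### Local coordinates at the corners of a normal form -/

theorem exists_analytic_root {u : ℂ → ℂ} (hu : AnalyticAt ℂ u 0) (h0 : u 0 ≠ 0) {m : ℕ}
    (hm : m ≠ 0) : ∃ w : ℂ → ℂ, AnalyticAt ℂ w 0 ∧ w 0 ≠ 0 ∧ ∀ z, w z ^ m = u z := by
  obtain ⟨ζ, hζ⟩ := IsAlgClosed.exists_pow_nat_eq (u 0) (Nat.pos_of_ne_zero hm)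
  have hz : ζ ≠ 0 := by rintro rfl; exact h0 (by rw [← hζ, zero_pow hm])
  refine ⟨fun z => ζ * (u z / u 0) ^ ((m : ℂ)⁻¹), ?_, ?_, fun z => ?_⟩
  · refine analyticAt_const.mul ((hu.div analyticAt_const h0).cpow analyticAt_const ?_)
    simp [h0]
  · simp [h0, hz]
  · rw [mul_pow, Complex.cpow_nat_inv_pow _ hm, hζ, mul_div_cancel₀ _ h0]

/-- The root near 1 of κ² - κ + cz² = 0. With c = e_i e_j it factors the quadratic part: e_i z s² +
st + e_j z t² = (κs + e_j z t)(e_i z s/κ + t). -/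
theorem exists_analytic_half (c : ℂ) : ∃ κ : ℂ → ℂ, AnalyticAt ℂ κ 0 ∧ κ 0 = 1 ∧
    ∀ z, κ z * (1 - κ z) = c * z ^ 2 := by
  refine ⟨fun z => (1 + (1 - 4 * c * z ^ 2) ^ ((2 : ℕ) : ℂ)⁻¹) / 2, ?_, by simp,
    fun z => ?_⟩
  · refine AnalyticAt.div (analyticAt_const.add (AnalyticAt.cpow (by fun_prop) analyticAt_const ?_))
      analyticAt_const two_ne_zero
    simp
  · have := Complex.cpow_nat_inv_pow (1 - 4 * c * z ^ 2) (n := 2) two_ne_zero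
    linear_combination (-1 / 4 : ℂ) * this

theorem isInvertible_of_injective {m : ℕ} (L : (Fin m → ℂ) →L[ℂ] (Fin m → ℂ))
    (h : ∀ v, L v = 0 → v = 0) : L.IsInvertible := by
  have hinj : Function.Injective (L : (Fin m → ℂ) →ₗ[ℂ] (Fin m → ℂ)) :=
    (injective_iff_map_eq_zero _).2 h
  refine ⟨(LinearEquiv.ofInjectiveEndo _ hinj).toContinuousLinearEquiv, ?_⟩
  ext v : 1
  rfl

/-- The base u₀w of the power and the two factors are themselves the coordinates. Every term other
than u₀w, u₁κ and u₂ is u₀ times a function vanishing at 0, so their linear part is diagonal with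
entries w(0), κ(0), 1. -/
theorem isGermOfTypeA_of_factorization {n : ℕ} {h : (Fin 3 → ℂ) → ℂ} {w κ α ξ η : ℂ → ℂ} {β : ℂ}
    (hw : AnalyticAt ℂ w 0) (hκ : AnalyticAt ℂ κ 0) (hα : AnalyticAt ℂ α 0)
    (hξ : AnalyticAt ℂ ξ 0) (hη : AnalyticAt ℂ η 0) (hw0 : w 0 ≠ 0) (hκ0 : κ 0 ≠ 0)
    (hh : ∀ᶠ u in 𝓝 (0 : Fin 3 → ℂ), h u =
      (u 1 * κ (u 0) + u 0 * (β * u 2 + u 0 * ξ (u 0))) *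
        (u 2 + u 0 * (α (u 0) * u 1 + u 0 * η (u 0))) + (u 0 * w (u 0)) ^ (n + 1)) :
    IsGermOfTypeA n h 0 := by
  have hp : ∀ i : Fin 3, AnalyticAt ℂ (fun u : Fin 3 → ℂ => u i) 0 := fun i =>
    (ContinuousLinearMap.proj (R := ℂ) (φ := fun _ : Fin 3 => ℂ) i).analyticAt 0
  have hc : ∀ {s : ℂ → ℂ}, AnalyticAt ℂ s 0 → AnalyticAt ℂ (fun u : Fin 3 → ℂ => s (u 0)) 0 :=
    fun hs => AnalyticAt.comp_of_eq (g := _) hs (hp 0) rfl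
  have h0 := (hp 0).mul (hc hw)
  have h1 := ((hp 1).mul (hc hκ)).add
    ((hp 0).mul ((analyticAt_const (v := β)).mul (hp 2) |>.add ((hp 0).mul (hc hξ))))
  have h2 := (hp 2).add ((hp 0).mul (((hc hα).mul (hp 1)).add ((hp 0).mul (hc hη))))
  have hg : AnalyticAt ℂ (fun u : Fin 3 → ℂ => (![u 0 * w (u 0),
      u 1 * κ (u 0) + u 0 * (β * u 2 + u 0 * ξ (u 0)),
      u 2 + u 0 * (α (u 0) * u 1 + u 0 * η (u 0))] : Fin 3 → ℂ)) 0 := by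
    rw [analyticAt_pi_iff]
    intro i
    fin_cases i
    · exact h0
    · exact h1
    · exact h2
  refine ⟨_, hg, by ext i; fin_cases i <;> simp, ?_, ?_⟩
  · refine isInvertible_of_injective _ fun v hv => ?_
    have hd := hasFDerivAt_pi'.1 hg.differentiableAt.hasFDerivAt
    have dp : ∀ i : Fin 3, HasFDerivAt (fun u : Fin 3 → ℂ => u i)
        (ContinuousLinearMap.proj i : (Fin 3 → ℂ) →L[ℂ] ℂ) 0 := fun i =>
      (ContinuousLinearMap.proj (R := ℂ) (φ := fun _ : Fin 3 => ℂ) i).hasFDerivAt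
    have e0 := (hd 0).unique ((dp 0).fun_mul (hc hw).differentiableAt.hasFDerivAt)
    have e1 := (hd 1).unique (((dp 1).fun_mul (hc hκ).differentiableAt.hasFDerivAt).fun_add
      ((dp 0).fun_mul ((analyticAt_const (v := β)).mul (hp 2) |>.add
        ((hp 0).mul (hc hξ))).differentiableAt.hasFDerivAt))
    have e2 := (hd 2).unique ((dp 2).fun_add ((dp 0).fun_mul
      (((hc hα).mul (hp 1)).add ((hp 0).mul (hc hη))).differentiableAt.hasFDerivAt))
    have f0 := congrArg (fun L : (Fin 3 → ℂ) →L[ℂ] ℂ => L v) e0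
    have f1 := congrArg (fun L : (Fin 3 → ℂ) →L[ℂ] ℂ => L v) e1
    have f2 := congrArg (fun L : (Fin 3 → ℂ) →L[ℂ] ℂ => L v) e2
    simp only [ContinuousLinearMap.comp_apply, hv] at f0 f1 f2
    simp at f0 f1 f2
    ext i
    fin_cases i
    · simpa [hw0] using f0
    · simpa [hκ0] using f1
    · simpa using f2.symm
  · filter_upwards [hh] with u hu
    simpa using hu

/-- For fixed z = u₀ the function is quadratic in (u₁, u₂), and the left side of `hr` is its value
at the critical point (z²X, z²Y). After the square is completed, this value is the (n+1)-st power of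
z times an analytic root of ρ. -/
theorem isGermOfTypeA_of_remainder {n : ℕ} {ei ej wi wj wk w4 : ℂ} {ρ : ℂ → ℂ}
    (hρ : AnalyticAt ℂ ρ 0) (hρ0 : ρ 0 ≠ 0)
    (hr : ∀ z, 1 - 4 * ei * ej * z ^ 2 ≠ 0 → wk * z ^ 2 + w4 * z ^ 3 +
      z ^ 4 * (ej * z * wi ^ 2 + ei * z * wj ^ 2 - wi * wj) / (1 - 4 * ei * ej * z ^ 2) =
        z ^ (n + 1) * ρ z) :
    IsGermOfTypeA n (fun u => u 1 * u 2 + u 0 * (ei * u 1 ^ 2 + ej * u 2 ^ 2) +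
      u 0 ^ 2 * (wi * u 1 + wj * u 2 + wk) + w4 * u 0 ^ 3) 0 := by
  obtain ⟨w, hw, hw0, hwρ⟩ := exists_analytic_root hρ hρ0 n.succ_ne_zero
  obtain ⟨κ, hκ, hκ0, hκe⟩ := exists_analytic_half (ei * ej)
  have hΔ : AnalyticAt ℂ (fun z : ℂ => 1 - 4 * ei * ej * z ^ 2) 0 := by fun_prop
  have hX : AnalyticAt ℂ (fun z : ℂ => (2 * ej * wi * z - wj) / (1 - 4 * ei * ej * z ^ 2)) 0 :=
    AnalyticAt.div (by fun_prop) hΔ (by simp)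
  have hY : AnalyticAt ℂ (fun z : ℂ => (2 * ei * wj * z - wi) / (1 - 4 * ei * ej * z ^ 2)) 0 :=
    AnalyticAt.div (by fun_prop) hΔ (by simp)
  have hα : AnalyticAt ℂ (fun z : ℂ => ei / κ z) 0 :=
    analyticAt_const.div hκ (by simp [hκ0])
  -- These are the coefficients of the two factors κs + e_j z t and e_i z s/κ + t at s = u₁ - z²X, t
  -- = u₂ - z²Y.
  refine isGermOfTypeA_of_factorization (w := w) (κ := κ) (α := fun z => ei / κ z) (β := ej)
    (ξ := fun z => -(κ z * ((2 * ej * wi * z - wj) / (1 - 4 * ei * ej * z ^ 2)) +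
      ej * z * ((2 * ei * wj * z - wi) / (1 - 4 * ei * ej * z ^ 2))))
    (η := fun z => -(ei / κ z * z * ((2 * ej * wi * z - wj) / (1 - 4 * ei * ej * z ^ 2)) +
      (2 * ei * wj * z - wi) / (1 - 4 * ei * ej * z ^ 2)))
    hw hκ hα ?_ ?_ hw0 (by simp [hκ0]) ?_
  · exact ((hκ.mul hX).add ((analyticAt_const.mul analyticAt_id).mul hY)).neg
  · exact (((hα.mul analyticAt_id).mul hX).add hY).neg
  · have hev : ∀ᶠ z in 𝓝 (0 : ℂ), κ z ≠ 0 ∧ 1 - 4 * ei * ej * z ^ 2 ≠ 0 :=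
      (hκ.continuousAt.eventually_ne (by simp [hκ0])).and
        (hΔ.continuousAt.eventually_ne (by simp))
    have ht : Filter.Tendsto (fun u : Fin 3 → ℂ => u 0) (𝓝 0) (𝓝 0) :=
      (continuous_apply (0 : Fin 3)).tendsto 0
    filter_upwards [ht.eventually hev] with u ⟨h1, h2⟩
    have h3 := hκe (u 0)
    have h4 := hr (u 0) h2
    rw [mul_pow, hwρ, ← h4]
    generalize u 0 = z at *
    generalize κ z = k at *
    generalize u 1 = x
    generalize u 2 = y
    have h5 : k - k ^ 2 = ei * ej * z ^ 2 := by linear_combination h3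
    obtain ⟨Δ, hΔe⟩ : ∃ Δ, Δ = 1 - 4 * ei * ej * z ^ 2 := ⟨_, rfl⟩
    rw [← hΔe] at h2 ⊢
    set X := (2 * ej * wi * z - wj) / Δ with hXd
    set Y := (2 * ei * wj * z - wi) / Δ with hYd
    have hX' : X * Δ = 2 * ej * wi * z - wj := div_mul_cancel₀ _ h2
    have hY' : Y * Δ = 2 * ei * wj * z - wi := div_mul_cancel₀ _ h2
    have hR : z ^ 4 * (ej * z * wi ^ 2 + ei * z * wj ^ 2 - wi * wj) / Δ =
        z ^ 4 * (wi * X + wj * Y) / 2 := by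
      rw [hXd, hYd]; field_simp; ring
    have hfac : ∀ s t : ℂ, (k * s + ej * z * t) * (ei / k * z * s + t) =
        ei * z * s ^ 2 + s * t + ej * z * t ^ 2 := by
      intro s t
      field_simp
      linear_combination (-(s * t)) * h5
    -- The two equations of the critical point, divided by z².
    have e1 : 2 * (ei * z) * X + Y = -wi := by
      refine mul_right_cancel₀ h2 ?_
      linear_combination 2 * (ei * z) * hX' + hY' + (-wi) * (-hΔe)
    have e2 : X + 2 * (ej * z) * Y = -wj := by
      refine mul_right_cancel₀ h2 ?_
      linear_combination hX' + 2 * (ej * z) * hY' + (-wj) * (-hΔe)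
    rw [hR]
    have := hfac (x - z ^ 2 * X) (y - z ^ 2 * Y)
    clear_value X Y
    linear_combination (-this) + z ^ 2 * x * e1 + z ^ 2 * y * e2
      - z ^ 4 / 2 * X * e1 - z ^ 4 / 2 * Y * e2

/-- The list of conditions in which the corner of `N` on the axis `x_k` has type `A_n`. -/
def CornerCondition (ei ej wi wj wk w4 : ℂ) (n : ℕ) : Prop :=
  (n = 1 ∧ wk ≠ 0) ∨ (n = 2 ∧ wk = 0 ∧ w4 ≠ 0) ∨ (n = 3 ∧ wk = 0 ∧ w4 = 0 ∧ wi * wj ≠ 0) ∨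
    (n = 4 ∧ wk = 0 ∧ w4 = 0 ∧ wi * wj = 0 ∧ ej * wi ^ 2 + ei * wj ^ 2 ≠ 0)

/-- The four cases are the possible first nonzero coefficients of the critical value: w_k, w₄, -w_i
w_j, and e_j w_i² + e_i w_j². -/
theorem isGermOfTypeA_of_cornerCondition {n : ℕ} {ei ej wi wj wk w4 : ℂ}
    (h : CornerCondition ei ej wi wj wk w4 n) :
    IsGermOfTypeA n (fun u => u 1 * u 2 + u 0 * (ei * u 1 ^ 2 + ej * u 2 ^ 2) +
      u 0 ^ 2 * (wi * u 1 + wj * u 2 + wk) + w4 * u 0 ^ 3) 0 := by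
  have hΔ : AnalyticAt ℂ (fun z : ℂ => 1 - 4 * ei * ej * z ^ 2) 0 := by fun_prop
  have hq : AnalyticAt ℂ (fun z : ℂ => (ej * z * wi ^ 2 + ei * z * wj ^ 2 - wi * wj) /
      (1 - 4 * ei * ej * z ^ 2)) 0 := AnalyticAt.div (by fun_prop) hΔ (by simp)
  rcases h with ⟨rfl, hk⟩ | ⟨rfl, hk, h4⟩ | ⟨rfl, hk, h4, hij⟩ | ⟨rfl, hk, h4, hij, hd⟩
  · refine isGermOfTypeA_of_remainder (ρ := fun z => wk + w4 * z + z ^ 2 *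
      ((ej * z * wi ^ 2 + ei * z * wj ^ 2 - wi * wj) / (1 - 4 * ei * ej * z ^ 2))) ?_
      (by simpa using hk) fun z hz => by ring
    exact AnalyticAt.add (by fun_prop) (AnalyticAt.mul (by fun_prop) hq)
  · refine isGermOfTypeA_of_remainder (ρ := fun z => w4 + z *
      ((ej * z * wi ^ 2 + ei * z * wj ^ 2 - wi * wj) / (1 - 4 * ei * ej * z ^ 2))) ?_
      (by simpa using h4) fun z hz => by rw [hk]; ring
    exact AnalyticAt.add (by fun_prop) (AnalyticAt.mul (by fun_prop) hq)
  · refine isGermOfTypeA_of_remainder hq (by simpa using hij) fun z hz => by rw [hk, h4]; ring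
  · refine isGermOfTypeA_of_remainder (ρ := fun z => (ej * wi ^ 2 + ei * wj ^ 2) /
      (1 - 4 * ei * ej * z ^ 2)) (AnalyticAt.div analyticAt_const hΔ (by simp))
      (by simpa using hd) fun z hz => by rw [hk, h4, hij]; ring

theorem hasSingularityA_normalForm {ε : Fin 3 → ℂ} {ω : Fin 4 → ℂ} {i j k : Fin 3} (hij : i ≠ j)
    (hjk : j ≠ k) (hki : k ≠ i) (hk : ε k = 0) {n : ℕ}
    (h : CornerCondition (ε i) (ε j) (ω i.castSucc) (ω j.castSucc) (ω k.castSucc) (ω 3) n) :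
    HasSingularityA n (completion (normalForm ε ω)) (atInfinity (coordPt k)) := by
  refine ⟨by rcases h with h | h | h | h <;> omega, ?_⟩
  -- The chart is centred at p_k and has coordinates (X₀, X_i, X_j) in this order, so that u 0 plays
  -- the part of z.
  have hbij : Function.Bijective (![k.succ, 0, i.succ, j.succ] : Fin 4 → Fin 4) := by
    clear h hk; revert i j k; decide
  let e : Fin 4 ≃ Fin 4 := Equiv.ofBijective _ hbij
  let b := (Pi.basisFun ℂ (Fin 4)).reindex e.symm
  have hb : ∀ m, b m = Pi.single (e m) 1 := fun m => by simp [b]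
  refine ⟨b, ?_, ?_⟩
  · rw [hb]
    funext m
    refine Fin.cases ?_ (fun m => ?_) m
    · simp [e, atInfinity]
    · simp [e, atInfinity, coordPt, Pi.single_apply]
  · convert isGermOfTypeA_of_cornerCondition h using 1
    funext u
    rw [Fin.sum_univ_three]
    simp only [hb, eval_completion_normalForm]
    clear h b hb
    fin_cases i <;> fin_cases j <;> simp at hij <;> fin_cases k <;> simp at hjk hki hk <;>
      simp [e, Fin.ext_iff, hk, -mul_eq_mul_left_iff, -mul_eq_mul_right_iff] <;> ring

/-! ### Transport along affine equivalences -/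

/-- An affine automorphism carries `f` to a multiple of `g` and the points `P k` at infinity to the
points `Q k`, up to a relabelling. -/
def Equivalent (f : AffPoly) (P : Fin 3 → Fin 3 → ℂ) (g : AffPoly) (Q : Fin 3 → Fin 3 → ℂ) :
    Prop :=
  ∃ (φ : (Fin 3 → ℂ) ≃ᵃ[ℂ] (Fin 3 → ℂ)) (μ : ℂ) (σ : Equiv.Perm (Fin 3)), μ ≠ 0 ∧
    (∀ x, eval (φ x) g = μ * eval x f) ∧ ∀ k, ∃ c : ℂ, c ≠ 0 ∧ φ.linear (P (σ k)) = c • Q k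

theorem Equivalent.trans {f g h : AffPoly} {P Q S : Fin 3 → Fin 3 → ℂ} (h₁ : Equivalent f P g Q)
    (h₂ : Equivalent g Q h S) : Equivalent f P h S := by
  obtain ⟨φ, μ, σ, hμ, hφ, hc⟩ := h₁
  obtain ⟨φ', μ', σ', hμ', hφ', hc'⟩ := h₂
  refine ⟨φ.trans φ', μ' * μ, σ'.trans σ, mul_ne_zero hμ' hμ, fun x => ?_, fun k => ?_⟩
  · rw [AffineEquiv.trans_apply, hφ', hφ, mul_assoc]
  · obtain ⟨c', hc0', e'⟩ := hc' k
    obtain ⟨c, hc0, e⟩ := hc (σ' k)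
    refine ⟨c * c', mul_ne_zero hc0 hc0', ?_⟩
    change φ'.linear (φ.linear (P (σ (σ' k)))) = _
    rw [e, map_smul, e', smul_smul]

theorem affinelyEquivalent_of_eval {f g : AffPoly} {φ : (Fin 3 → ℂ) ≃ᵃ[ℂ] (Fin 3 → ℂ)} {μ : ℂ}
    (hμ : μ ≠ 0) (hφ : ∀ x, eval (φ x) g = μ * eval x f) : AffinelyEquivalent f g := by
  refine ⟨φ, Set.ext fun y => ⟨?_, fun hy => ⟨φ.symm y, ?_, φ.apply_symm_apply y⟩⟩⟩
  · rintro ⟨x, hx, rfl⟩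
    have hx' : eval x f = 0 := hx
    simp [zeroSet, hφ, hx']
  · have hy' : eval y g = 0 := hy
    have := hφ (φ.symm y)
    rw [φ.apply_symm_apply, hy'] at this
    simpa [zeroSet, hμ] using this.symm

theorem Equivalent.affinelyEquivalent {f g : AffPoly} {P Q : Fin 3 → Fin 3 → ℂ}
    (h : Equivalent f P g Q) : AffinelyEquivalent f g := by
  obtain ⟨φ, μ, σ, hμ, hφ, hc⟩ := h
  exact affinelyEquivalent_of_eval hμ hφ

theorem fderiv_eq_zero_iff_of_comp {m : ℕ} {F G : (Fin m → ℂ) → ℂ}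
    {Φ : (Fin m → ℂ) → (Fin m → ℂ)} {A : (Fin m → ℂ) ≃L[ℂ] (Fin m → ℂ)} {μ : ℂ} {x : Fin m → ℂ}
    (hF : DifferentiableAt ℂ F x) (hG : DifferentiableAt ℂ G (Φ x)) (hμ : μ ≠ 0)
    (hΦ : HasFDerivAt Φ (A : (Fin m → ℂ) →L[ℂ] (Fin m → ℂ)) x)
    (h : ∀ x, G (Φ x) = μ * F x) : fderiv ℂ F x = 0 ↔ fderiv ℂ G (Φ x) = 0 := by
  have h1 := hG.hasFDerivAt.comp x hΦ
  have h2 : HasFDerivAt (G ∘ Φ) (μ • fderiv ℂ F x) x := by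
    have : G ∘ Φ = fun x => μ * F x := funext h
    rw [this]
    exact hF.hasFDerivAt.const_mul μ
  have h3 := h1.unique h2
  constructor
  · intro h0
    ext v
    have := congrArg (fun L : (Fin m → ℂ) →L[ℂ] ℂ => L (A.symm v)) h3
    simpa [h0] using this
  · intro h0
    rw [h0, ContinuousLinearMap.zero_comp] at h3
    exact (smul_eq_zero.1 h3.symm).resolve_left hμ

theorem differentiableAt_eval {m : ℕ} (F : MvPolynomial (Fin m) ℂ) (p : Fin m → ℂ) :
    DifferentiableAt ℂ (fun x : Fin m → ℂ => eval x F) p :=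
  (hasFDerivAt_eval F p).differentiableAt

theorem affineEquiv_apply (φ : (Fin 3 → ℂ) ≃ᵃ[ℂ] (Fin 3 → ℂ)) (x : Fin 3 → ℂ) :
    φ x = φ.linear x + φ 0 := by
  have := φ.map_vadd 0 x
  simpa using this

theorem hasFDerivAt_affineEquiv (φ : (Fin 3 → ℂ) ≃ᵃ[ℂ] (Fin 3 → ℂ)) (x : Fin 3 → ℂ) :
    HasFDerivAt φ (φ.linear.toContinuousLinearEquiv : (Fin 3 → ℂ) →L[ℂ] (Fin 3 → ℂ)) x := by
  have : (φ : (Fin 3 → ℂ) → (Fin 3 → ℂ)) = fun x => φ.linear.toContinuousLinearEquiv x + φ 0 :=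
    funext fun x => affineEquiv_apply φ x
  rw [this]
  exact φ.linear.toContinuousLinearEquiv.hasFDerivAt.add_const _

theorem Equivalent.isSmoothAffine {f g : AffPoly} {P Q : Fin 3 → Fin 3 → ℂ}
    (h : Equivalent f P g Q) (hf : IsSmoothAffine f) : IsSmoothAffine g := by
  obtain ⟨φ, μ, σ, hμ, hφ, hc⟩ := h
  rw [isSmoothAffine_iff] at hf ⊢
  intro y hy
  have hx := hφ (φ.symm y)
  rw [φ.apply_symm_apply, hy] at hx
  have hx' := hf (φ.symm y) (by simpa [hμ] using hx.symm)
  contrapose! hx'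
  rw [fderiv_eq_zero_iff_of_comp (differentiableAt_eval f _) (differentiableAt_eval g _) hμ
    (hasFDerivAt_affineEquiv φ _) hφ, φ.apply_symm_apply]
  exact hx'

theorem map_mem_affineLines {f g : AffPoly} {φ : (Fin 3 → ℂ) ≃ᵃ[ℂ] (Fin 3 → ℂ)} {μ : ℂ}
    (hφ : ∀ x, eval (φ x) g = μ * eval x f) {l : AffineSubspace ℂ (Fin 3 → ℂ)}
    (hl : l ∈ affineLines f) : l.map (φ : (Fin 3 → ℂ) →ᵃ[ℂ] (Fin 3 → ℂ)) ∈ affineLines g := by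
  refine ⟨?_, ?_⟩
  · rw [AffineSubspace.map_direction]
    exact (LinearEquiv.finrank_map_eq φ.linear l.direction).trans hl.1
  · rintro _ ⟨x, hx, rfl⟩
    have h0 : eval x f = 0 := hl.2 hx
    simp [zeroSet, hφ, h0]

theorem affineEquiv_map_injective (φ : (Fin 3 → ℂ) ≃ᵃ[ℂ] (Fin 3 → ℂ)) :
    Function.Injective (AffineSubspace.map (φ : (Fin 3 → ℂ) →ᵃ[ℂ] (Fin 3 → ℂ))) := by
  intro l l' h
  refine SetLike.coe_injective (Set.image_injective.2 φ.injective ?_)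
  exact congrArg (fun s : AffineSubspace ℂ (Fin 3 → ℂ) => (s : Set (Fin 3 → ℂ))) h

theorem Equivalent.encard_affineLines {f g : AffPoly} {P Q : Fin 3 → Fin 3 → ℂ}
    (h : Equivalent f P g Q) : (affineLines f).encard = (affineLines g).encard := by
  obtain ⟨φ, μ, σ, hμ, hφ, hc⟩ := h
  have hψ : ∀ y, eval (φ.symm y) f = μ⁻¹ * eval y g := fun y => by
    rw [← φ.apply_symm_apply y, hφ, φ.symm_apply_apply, inv_mul_cancel_left₀ hμ]
  exact le_antisymm
    (Set.encard_le_encard_of_injOn (fun l hl => map_mem_affineLines hφ hl)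
      (affineEquiv_map_injective φ).injOn)
    (Set.encard_le_encard_of_injOn (fun l hl => map_mem_affineLines hψ hl)
      (affineEquiv_map_injective φ.symm).injOn)

/-- c(v₂v₃ + v₁^(n+1)) = (cv₂)v₃ + (ζv₁)^(n+1) with ζ^(n+1) = c. -/
theorem IsGermOfTypeA.const_mul {n : ℕ} {h : (Fin 3 → ℂ) → ℂ} {a : Fin 3 → ℂ}
    (hA : IsGermOfTypeA n h a) {c : ℂ} (hc : c ≠ 0) : IsGermOfTypeA n (fun u => c * h u) a := by
  obtain ⟨g, hg, hg0, hi, hh⟩ := hA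
  obtain ⟨ζ, hζ⟩ := IsAlgClosed.exists_pow_nat_eq c n.succ_pos
  have hz : ζ ≠ 0 := by rintro rfl; exact hc (by rw [← hζ, zero_pow n.succ_ne_zero])
  let d : Fin 3 → ℂ := ![ζ, c, 1]
  have hd : ∀ i, d i ≠ 0 := by
    intro i; fin_cases i
    · exact hz
    · exact hc
    · exact one_ne_zero
  let D : (Fin 3 → ℂ) →L[ℂ] (Fin 3 → ℂ) :=
    ContinuousLinearMap.pi fun i => d i • ContinuousLinearMap.proj i
  have hD : D.IsInvertible := isInvertible_of_injective D fun v hv => funext fun i => by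
    have := congrFun hv i
    simpa [D, hd i] using this
  refine ⟨fun u => D (g u), (D.analyticAt _).comp hg, by simp [hg0], ?_, ?_⟩
  · have h1 := D.hasFDerivAt.comp a hg.differentiableAt.hasFDerivAt
    have h2 : fderiv ℂ (fun u => D (g u)) a = D.comp (fderiv ℂ g a) := h1.fderiv
    rw [h2]
    exact hD.comp hi
  · filter_upwards [hh] with u hu
    rw [hu]
    simp only [D, d, ContinuousLinearMap.pi_apply, smul_apply,
      ContinuousLinearMap.proj_apply, smul_eq_mul]
    simp [mul_pow, hζ]
    ring

theorem HasSingularityA.of_linearEquiv {n : ℕ} {F G : ProjPoly}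
    {Φ : (Fin 4 → ℂ) ≃ₗ[ℂ] (Fin 4 → ℂ)} {μ : ℂ} (hμ : μ ≠ 0)
    (h : ∀ p, eval (Φ p) G = μ * eval p F) {p : Fin 4 → ℂ} (hA : HasSingularityA n G (Φ p)) :
    HasSingularityA n F p := by
  obtain ⟨hn, b, hb, hA⟩ := hA
  refine ⟨hn, b.map Φ.symm, by simp [hb], ?_⟩
  convert hA.const_mul (inv_ne_zero hμ) using 2 with u
  rw [eq_inv_mul_iff_mul_eq₀ hμ, ← h]
  simp

theorem isRegularPt_iff_of_linearEquiv {F G : ProjPoly}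
    {Φ : (Fin 4 → ℂ) ≃ₗ[ℂ] (Fin 4 → ℂ)} {μ : ℂ} (hμ : μ ≠ 0)
    (h : ∀ p, eval (Φ p) G = μ * eval p F) {p : Fin 4 → ℂ} :
    IsRegularPt F p ↔ IsRegularPt G (Φ p) := by
  rw [isRegularPt_iff, isRegularPt_iff, h, mul_eq_zero, or_iff_right hμ]
  refine and_congr_right fun _ => not_congr ?_
  exact fderiv_eq_zero_iff_of_comp (differentiableAt_eval F p) (differentiableAt_eval G _) hμ
    (Φ := Φ) Φ.toContinuousLinearEquiv.hasFDerivAt h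

theorem isSingularPt_iff_of_linearEquiv {F G : ProjPoly}
    {Φ : (Fin 4 → ℂ) ≃ₗ[ℂ] (Fin 4 → ℂ)} {μ : ℂ} (hμ : μ ≠ 0)
    (h : ∀ p, eval (Φ p) G = μ * eval p F) {p : Fin 4 → ℂ} :
    IsSingularPt F p ↔ IsSingularPt G (Φ p) := by
  rw [isSingularPt_iff, isSingularPt_iff, h, mul_eq_zero, or_iff_right hμ]
  refine and_congr_right fun _ => ?_
  exact fderiv_eq_zero_iff_of_comp (differentiableAt_eval F p) (differentiableAt_eval G _) hμ
    (Φ := Φ) Φ.toContinuousLinearEquiv.hasFDerivAt h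

theorem HasPointType.of_linearEquiv {n : ℕ} {F G : ProjPoly}
    {Φ : (Fin 4 → ℂ) ≃ₗ[ℂ] (Fin 4 → ℂ)} {μ : ℂ} (hμ : μ ≠ 0)
    (h : ∀ p, eval (Φ p) G = μ * eval p F) {p : Fin 4 → ℂ} (hp : HasPointType G (Φ p) n) :
    HasPointType F p n :=
  hp.imp (fun hr => ⟨hr.1, (isRegularPt_iff_of_linearEquiv hμ h).2 hr.2⟩)
    fun hA => hA.of_linearEquiv hμ h

theorem HasPointType.smul {n : ℕ} {F : ProjPoly} (hF : F.IsHomogeneous 3) {p : Fin 4 → ℂ}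
    (hp : HasPointType F p n) {c : ℂ} (hc : c ≠ 0) : HasPointType F (c • p) n := by
  refine HasPointType.of_linearEquiv (Φ := LinearEquiv.smulOfNeZero ℂ _ c⁻¹ (inv_ne_zero hc))
    (μ := c⁻¹ ^ 3) (pow_ne_zero _ (inv_ne_zero hc))
    (fun p => eval_smul_of_isHomogeneous hF c⁻¹ p) ?_
  simpa [smul_smul, hc] using hp

/-- The projective extension of an affine automorphism. -/
theorem exists_projective_extension {f g : AffPoly} (hf : f.totalDegree ≤ 3)
    (hg : g.totalDegree ≤ 3) {φ : (Fin 3 → ℂ) ≃ᵃ[ℂ] (Fin 3 → ℂ)} {μ : ℂ}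
    (hφ : ∀ x, eval (φ x) g = μ * eval x f) :
    ∃ Φ : (Fin 4 → ℂ) ≃ₗ[ℂ] (Fin 4 → ℂ), (∀ p, Φ p 0 = p 0) ∧
      (∀ y, Φ (atInfinity y) = atInfinity (φ.linear y)) ∧
      ∀ p, eval (Φ p) (completion g) = μ * eval p (completion f) := by
  let T : (Fin 4 → ℂ) →ₗ[ℂ] (Fin 4 → ℂ) :=
    { toFun := fun p => Fin.cons (p 0) (φ.linear (Fin.tail p) + p 0 • φ 0)
      map_add' := fun p q => by
        have : Fin.tail (p + q) = Fin.tail p + Fin.tail q := rfl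
        funext i
        refine Fin.cases ?_ (fun i => ?_) i
        · simp
        · simp [this, add_mul]; ring
      map_smul' := fun c p => by
        have : Fin.tail (c • p) = c • Fin.tail p := rfl
        funext i
        refine Fin.cases ?_ (fun i => ?_) i
        · simp
        · simp [this]; ring }
  have hT : ∀ p, T p = Fin.cons (p 0) (φ.linear (Fin.tail p) + p 0 • φ 0) := fun p => rfl
  have hinj : Function.Injective T := by
    rw [injective_iff_map_eq_zero]
    intro p hp
    have h0 : p 0 = 0 := by simpa [hT] using congrFun hp 0
    have h1 : φ.linear (Fin.tail p) = 0 := by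
      funext i
      simpa [hT, h0] using congrFun hp i.succ
    rw [EmbeddingLike.map_eq_zero_iff] at h1
    funext i
    exact Fin.cases h0 (fun i => congrFun h1 i) i
  refine ⟨LinearEquiv.ofInjectiveEndo T hinj, fun p => rfl, fun y => ?_, fun p => ?_⟩
  · change T _ = _
    rw [hT]
    simp [atInfinity]
  · change eval (T p) _ = _
    refine congrFun (eq_of_eq_off_infinity ((continuous_eval_point _).comp
      T.continuous_of_finiteDimensional) (continuous_const.mul (continuous_eval_point _))
      fun q hq => ?_) p
    have e : (q 0)⁻¹ • Fin.tail (T q) = φ ((q 0)⁻¹ • Fin.tail q) := by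
      rw [affineEquiv_apply, hT, Fin.tail_cons, map_smul, smul_add, smul_smul, inv_mul_cancel₀ hq,
        one_smul]
    have e0 : T q 0 = q 0 := rfl
    rw [Function.comp_apply, eval_completion_of_ne hg (by rwa [e0]),
      e0, e, hφ]
    change _ = μ * eval q (completion f)
    rw [eval_completion_of_ne hf hq]
    ring

theorem Equivalent.hasConfiguration {f g : AffPoly} {P Q : Fin 3 → Fin 3 → ℂ}
    (hf : f.totalDegree ≤ 3) (hg : g.totalDegree ≤ 3) (h : Equivalent f P g Q) {r : Fin 15}
    (hr : HasConfiguration g Q r) : HasConfiguration f P r := by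
  obtain ⟨φ, μ, σ, hμ, hφ, hc⟩ := h
  obtain ⟨τ, hτ⟩ := hr
  obtain ⟨Φ, -, hΦ, hΦe⟩ := exists_projective_extension hf hg hφ
  refine ⟨τ.trans σ, fun k => HasPointType.of_linearEquiv hμ hΦe ?_⟩
  obtain ⟨c, hc0, e⟩ := hc (τ k)
  have : Φ (atInfinity (P ((τ.trans σ) k))) = c • atInfinity (Q (τ k)) := by
    rw [hΦ, Equiv.trans_apply, e]
    funext i
    refine Fin.cases ?_ (fun i => ?_) i <;> simp [atInfinity]
  rw [this]
  exact (hτ k).smul (completion_isHomogeneous g) hc0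

theorem Equivalent.singularPt {f g : AffPoly} {P Q : Fin 3 → Fin 3 → ℂ}
    (hf : f.totalDegree ≤ 3) (hg : g.totalDegree ≤ 3) (h : Equivalent f P g Q)
    (hQ : ∀ p, p ≠ 0 → IsSingularPt (completion g) p → ∃ k, ∃ c : ℂ, p = c • atInfinity (Q k))
    (p : Fin 4 → ℂ) (hp : p ≠ 0) (hs : IsSingularPt (completion f) p) :
    ∃ k, ∃ c : ℂ, p = c • atInfinity (P k) := by
  obtain ⟨φ, μ, σ, hμ, hφ, hc⟩ := h
  obtain ⟨Φ, -, hΦ, hΦe⟩ := exists_projective_extension hf hg hφ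
  obtain ⟨k, c, hk⟩ := hQ (Φ p) (by rwa [Ne, EmbeddingLike.map_eq_zero_iff])
    ((isSingularPt_iff_of_linearEquiv hμ hΦe).1 hs)
  obtain ⟨d, hd0, e⟩ := hc k
  refine ⟨σ k, c * d⁻¹, Φ.injective ?_⟩
  rw [hk, map_smul, hΦ, e]
  funext i
  refine Fin.cases ?_ (fun i => ?_) i
  · simp [atInfinity]
  · simp [atInfinity, hd0, mul_assoc]

/-- Substituting x_{σ i} = s_i y_i and dividing by s₀s₁s₂ preserves the term x₁x₂x₃; the hypotheses
compare the other coefficients. The reduction of normal forms to table rows uses only such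
substitutions. -/
theorem equivalent_of_scaling {ε ε' : Fin 3 → ℂ} {ω ω' : Fin 4 → ℂ} (σ : Equiv.Perm (Fin 3))
    (s : Fin 3 → ℂ) (hs : ∀ i, s i ≠ 0)
    (hε : ∀ i, ε' i * (s 0 * s 1 * s 2) = ε (σ i) * s i ^ 2)
    (hω : ∀ i : Fin 3, ω' i.castSucc * (s 0 * s 1 * s 2) = ω (σ i).castSucc * s i)
    (hω4 : ω' 3 * (s 0 * s 1 * s 2) = ω 3) :
    Equivalent (normalForm ε ω) coordPt (normalForm ε' ω') coordPt := by
  let A : (Fin 3 → ℂ) ≃ₗ[ℂ] (Fin 3 → ℂ) :=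
    (LinearEquiv.funCongrLeft ℂ ℂ σ).trans
      (LinearEquiv.piCongrRight fun i => LinearEquiv.smulOfNeZero ℂ ℂ (s i)⁻¹ (inv_ne_zero (hs i)))
  have hA : ∀ x i, A x i = (s i)⁻¹ * x (σ i) := fun x i => rfl
  refine ⟨A.toAffineEquiv, (s 0 * s 1 * s 2)⁻¹, σ, ?_, fun x => ?_, fun k => ⟨(s k)⁻¹,
    inv_ne_zero (hs k), ?_⟩⟩
  · exact inv_ne_zero (mul_ne_zero (mul_ne_zero (hs 0) (hs 1)) (hs 2))
  · have hx : ∀ i, x (σ i) = s i * A x i := fun i => by rw [hA, mul_inv_cancel_left₀ (hs i)]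
    have hsum : ∀ t : Fin 3 → ℂ, t 0 + t 1 + t 2 = t (σ 0) + t (σ 1) + t (σ 2) := fun t => by
      have := Equiv.sum_comp σ t
      simpa [Fin.sum_univ_three] using this.symm
    have hprod : x 0 * x 1 * x 2 = x (σ 0) * x (σ 1) * x (σ 2) := by
      have := Equiv.prod_comp σ x
      simpa [Fin.prod_univ_three] using this.symm
    have h1 := hsum fun i => ε i * x i ^ 2
    have h2 := hsum fun i => ω i.castSucc * x i
    have c0 : (0 : Fin 3).castSucc = (0 : Fin 4) := rfl
    have c1 : (1 : Fin 3).castSucc = (1 : Fin 4) := rfl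
    have c2 : (2 : Fin 3).castSucc = (2 : Fin 4) := rfl
    have e0 := hε 0
    have e1 := hε 1
    have e2 := hε 2
    have w0 := hω 0
    have w1 := hω 1
    have w2 := hω 2
    simp only [c0, c1, c2] at h2 w0 w1 w2
    change eval (A x) _ = _
    have hne := mul_ne_zero (mul_ne_zero (hs 0) (hs 1)) (hs 2)
    rw [eq_inv_mul_iff_mul_eq₀ hne, eval_normalForm, eval_normalForm, hprod, h1, h2]
    simp only [hx]
    linear_combination (A x 0) ^ 2 * e0 + (A x 1) ^ 2 * e1 + (A x 2) ^ 2 * e2 + A x 0 * w0 +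
      A x 1 * w1 + A x 2 * w2 + hω4
  · change A _ = _
    funext i
    rw [hA]
    simp only [coordPt, Pi.smul_apply, smul_eq_mul, Pi.single_apply, EmbeddingLike.apply_eq_iff_eq]
    split_ifs with h
    · rw [h]
    · simp

/-! ### Reduction to a normal form -/

theorem exists_eval_eq_quadratic {p : AffPoly} (hp : p.IsHomogeneous 2) :
    ∃ c : Fin 3 → Fin 3 → ℂ, ∀ x, eval x p = ∑ i, ∑ j, c i j * (x i * x j) := by
  have key : ∀ s : Finset (Fin 3 →₀ ℕ), (∀ d ∈ s, d 0 + d 1 + d 2 = 2) →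
      ∃ c : Fin 3 → Fin 3 → ℂ, ∀ x : Fin 3 → ℂ,
        ∑ d ∈ s, coeff d p * ∏ i, x i ^ d i = ∑ i, ∑ j, c i j * (x i * x j) := by
    classical
    intro s
    induction s using Finset.induction_on with
    | empty => exact fun _ => ⟨0, fun x => by simp⟩
    | insert d s hd ih =>
      intro hs
      obtain ⟨c, hc⟩ := ih fun e he => hs e (Finset.mem_insert_of_mem he)
      have h2 := hs d (Finset.mem_insert_self _ _)
      have hm : ∃ a b : Fin 3, ∀ x : Fin 3 → ℂ, ∏ i, x i ^ d i = x a * x b := by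
        simp only [Fin.prod_univ_three]
        have h0 : d 0 ≤ 2 := by omega
        have h1 : d 1 ≤ 2 := by omega
        have e2 : d 2 = 2 - d 0 - d 1 := by omega
        rw [e2]
        generalize d 0 = m at *
        generalize d 1 = n at *
        interval_cases m <;> interval_cases n <;> first
          | omega
          | exact ⟨0, 0, fun x => by ring1⟩
          | exact ⟨0, 1, fun x => by ring1⟩
          | exact ⟨0, 2, fun x => by ring1⟩
          | exact ⟨1, 1, fun x => by ring1⟩
          | exact ⟨1, 2, fun x => by ring1⟩
          | exact ⟨2, 2, fun x => by ring1⟩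
      obtain ⟨a, b, hab⟩ := hm
      refine ⟨fun i j => (if i = a ∧ j = b then coeff d p else 0) + c i j, fun x => ?_⟩
      rw [Finset.sum_insert hd, hab, hc]
      simp [add_mul, Finset.sum_add_distrib, ite_and]
  obtain ⟨c, hc⟩ := key p.support fun d hd => by
    have := hp (mem_support_iff.1 hd)
    rw [Finsupp.weight_apply, Finsupp.sum_fintype] at this <;> simp_all [Fin.sum_univ_three]
  exact ⟨c, fun x => by rw [eval_eq', hc]⟩

theorem exists_eval_eq_linear {p : AffPoly} (hp : p.IsHomogeneous 1) :
    ∃ c : Fin 3 → ℂ, ∀ x, eval x p = ∑ i, c i * x i := by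
  have key : ∀ s : Finset (Fin 3 →₀ ℕ), (∀ d ∈ s, d 0 + d 1 + d 2 = 1) →
      ∃ c : Fin 3 → ℂ, ∀ x : Fin 3 → ℂ,
        ∑ d ∈ s, coeff d p * ∏ i, x i ^ d i = ∑ i, c i * x i := by
    classical
    intro s
    induction s using Finset.induction_on with
    | empty => exact fun _ => ⟨0, fun x => by simp⟩
    | insert d s hd ih =>
      intro hs
      obtain ⟨c, hc⟩ := ih fun e he => hs e (Finset.mem_insert_of_mem he)
      have h2 := hs d (Finset.mem_insert_self _ _)
      have hm : ∃ a : Fin 3, ∀ x : Fin 3 → ℂ, ∏ i, x i ^ d i = x a := by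
        simp only [Fin.prod_univ_three]
        have h0 : d 0 ≤ 1 := by omega
        have h1 : d 1 ≤ 1 := by omega
        have e2 : d 2 = 1 - d 0 - d 1 := by omega
        rw [e2]
        generalize d 0 = m at *
        generalize d 1 = n at *
        interval_cases m <;> interval_cases n <;> first
          | omega
          | exact ⟨0, fun x => by ring1⟩
          | exact ⟨1, fun x => by ring1⟩
          | exact ⟨2, fun x => by ring1⟩
      obtain ⟨a, ha⟩ := hm
      refine ⟨fun i => (if i = a then coeff d p else 0) + c i, fun x => ?_⟩
      rw [Finset.sum_insert hd, ha, hc]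
      simp [add_mul, Finset.sum_add_distrib]
  obtain ⟨c, hc⟩ := key p.support fun d hd => by
    have := hp (mem_support_iff.1 hd)
    rw [Finsupp.weight_apply, Finsupp.sum_fintype] at this <;> simp_all [Fin.sum_univ_three]
  exact ⟨c, fun x => by rw [eval_eq', hc]⟩

theorem HasTriangleAtInfinity.eval_corner_of_ne {f : AffPoly}
    {L : Fin 3 → Module.Dual ℂ (Fin 3 → ℂ)} {P : Fin 3 → Fin 3 → ℂ}
    (h : HasTriangleAtInfinity f L P) {i k : Fin 3} (hik : i ≠ k) : L i (P k) = 0 := by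
  obtain ⟨j, hj1, hj2⟩ : ∃ j : Fin 3, i ≠ j ∧ j ≠ k := by revert i k; decide
  have h1 : P k ∈ LinearMap.ker (L i) ⊓ LinearMap.ker (L j) := by
    rw [h.inter_eq_corner i j k hj1 hj2 hik.symm]
    exact Submodule.mem_span_singleton_self _
  exact h1.1

/-- Otherwise all three lines pass through this corner, which then coincides with another one. -/
theorem HasTriangleAtInfinity.eval_corner_ne_zero {f : AffPoly}
    {L : Fin 3 → Module.Dual ℂ (Fin 3 → ℂ)} {P : Fin 3 → Fin 3 → ℂ}
    (h : HasTriangleAtInfinity f L P) (k : Fin 3) : L k (P k) ≠ 0 := by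
  intro h0
  obtain ⟨i, j, hik, hij, hjk⟩ : ∃ i j : Fin 3, i ≠ k ∧ i ≠ j ∧ j ≠ k := by
    clear h0; revert k; decide
  have h1 : P k ∈ LinearMap.ker (L k) ⊓ LinearMap.ker (L i) := ⟨h0, h.eval_corner_of_ne hik⟩
  rw [h.inter_eq_corner k i j hik.symm hij hjk] at h1
  obtain ⟨c, hc⟩ := Submodule.mem_span_singleton.1 h1
  have hc0 : c ≠ 0 := by
    rintro rfl
    exact h.corner_ne_zero k (by rw [← hc, zero_smul])
  refine h.corners_distinct k j hjk.symm ?_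
  rw [← hc]
  exact Submodule.span_singleton_smul_eq (IsUnit.mk0 c hc0) _

theorem HasTriangleAtInfinity.eval_homogeneousComponent_three {f : AffPoly}
    {L : Fin 3 → Module.Dual ℂ (Fin 3 → ℂ)} {P : Fin 3 → Fin 3 → ℂ}
    (h : HasTriangleAtInfinity f L P) (y : Fin 3 → ℂ) :
    eval y (homogeneousComponent 3 f) = L 0 y * L 1 y * L 2 y := by
  have := h.curve_at_infinity y
  rw [eval_completion, Fin.prod_univ_three] at this
  simpa [Finset.sum_range_succ, atInfinity] using this

/-- The forms L_k have no common zero other than 0, hence are coordinates in which the cubic part is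
the product of the coordinates. Translation then removes the mixed quadratic terms. -/
theorem HasTriangleAtInfinity.exists_equivalent {f : AffPoly}
    {L : Fin 3 → Module.Dual ℂ (Fin 3 → ℂ)} {P : Fin 3 → Fin 3 → ℂ}
    (h : HasTriangleAtInfinity f L P) :
    ∃ (ε : Fin 3 → ℂ) (ω : Fin 4 → ℂ), Equivalent f P (normalForm ε ω) coordPt := by
  have hinj : Function.Injective (LinearMap.pi L : (Fin 3 → ℂ) →ₗ[ℂ] (Fin 3 → ℂ)) := by
    rw [injective_iff_map_eq_zero]
    intro x hx
    have hxi : ∀ i, L i x = 0 := fun i => congrFun hx i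
    have h1 : x ∈ LinearMap.ker (L 1) ⊓ LinearMap.ker (L 2) := ⟨hxi 1, hxi 2⟩
    rw [h.inter_eq_corner 1 2 0 (by decide) (by decide) (by decide)] at h1
    obtain ⟨c, rfl⟩ := Submodule.mem_span_singleton.1 h1
    have h2 := hxi 0
    rw [map_smul, smul_eq_mul, mul_eq_zero] at h2
    rw [h2.resolve_right (h.eval_corner_ne_zero 0), zero_smul]
  let ψ : (Fin 3 → ℂ) ≃ₗ[ℂ] (Fin 3 → ℂ) := LinearEquiv.ofInjectiveEndo _ hinj
  have hψ : ∀ x i, ψ x i = L i x := fun x i => rfl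
  obtain ⟨c, hc⟩ := exists_eval_eq_quadratic (homogeneousComponent_isHomogeneous 2 f)
  obtain ⟨d, hd⟩ := exists_eval_eq_linear (homogeneousComponent_isHomogeneous 1 f)
  let B : Fin 3 → Fin 3 → ℂ := fun i a => ψ.symm (Pi.single a 1) i
  have hB : ∀ x i, x i = B i 0 * ψ x 0 + B i 1 * ψ x 1 + B i 2 * ψ x 2 := by
    intro x i
    have e : ψ x = ∑ a, ψ x a • (Pi.single a 1 : Fin 3 → ℂ) := by
      ext i; simp [Pi.single_apply]
    have e' := congrArg (fun y => ψ.symm y i) e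
    simp only [map_add, map_smul, ψ.symm_apply_apply, Fin.sum_univ_three, Pi.add_apply,
      Pi.smul_apply, smul_eq_mul] at e'
    rw [e']
    ring
  let c' : Fin 3 → Fin 3 → ℂ := fun a b => ∑ i, ∑ j, c i j * (B i a * B j b)
  let d' : Fin 3 → ℂ := fun a => ∑ i, d i * B i a
  let e : ℂ := coeff 0 f
  have hf : ∀ x, eval x f = ψ x 0 * ψ x 1 * ψ x 2 +
      ∑ a, ∑ b, c' a b * (ψ x a * ψ x b) + ∑ a, d' a * ψ x a + e := by
    intro x
    rw [eval_eq_sum_homogeneousComponent h.totalDegree_eq.le]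
    have h2 : eval x (homogeneousComponent 2 f) = ∑ a, ∑ b, c' a b * (ψ x a * ψ x b) := by
      rw [hc]
      simp only [c', Fin.sum_univ_three]
      rw [hB x 0, hB x 1, hB x 2]
      ring
    have h1 : eval x (homogeneousComponent 1 f) = ∑ a, d' a * ψ x a := by
      rw [hd]
      simp only [d', Fin.sum_univ_three]
      rw [hB x 0, hB x 1, hB x 2]
      ring
    simp only [Finset.sum_range_succ, Finset.sum_range_zero]
    rw [h2, h1, h.eval_homogeneousComponent_three, homogeneousComponent_zero, hψ, hψ, hψ]
    simp only [eval_C, e]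
    ring
  -- Expanding (y₀+v₀)(y₁+v₁)(y₂+v₂) produces v₀y₁y₂ + v₁y₀y₂ + v₂y₀y₁, so v has to be the vector of
  -- mixed coefficients. The coefficients ω below come from expanding f at y - v.
  let v : Fin 3 → ℂ := ![c' 1 2 + c' 2 1, c' 0 2 + c' 2 0, c' 0 1 + c' 1 0]
  refine ⟨fun i => c' i i, ![d' 0 - v 1 * v 2 - 2 * c' 0 0 * v 0, d' 1 - v 0 * v 2 -
    2 * c' 1 1 * v 1, d' 2 - v 0 * v 1 - 2 * c' 2 2 * v 2, 2 * v 0 * v 1 * v 2 +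
    (c' 0 0 * v 0 ^ 2 + c' 1 1 * v 1 ^ 2 + c' 2 2 * v 2 ^ 2) -
    (d' 0 * v 0 + d' 1 * v 1 + d' 2 * v 2) + e],
    ψ.toAffineEquiv.trans (AffineEquiv.constVAdd ℂ (Fin 3 → ℂ) v), 1, 1, one_ne_zero,
    fun x => ?_, fun k => ⟨L k (P k), h.eval_corner_ne_zero k, ?_⟩⟩
  · have hx : (ψ.toAffineEquiv.trans (AffineEquiv.constVAdd ℂ (Fin 3 → ℂ) v)) x = v + ψ x := rfl
    rw [hx, eval_normalForm, hf, one_mul]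
    simp only [Fin.sum_univ_three, Pi.add_apply]
    have v0 : v 0 = c' 1 2 + c' 2 1 := rfl
    have v1 : v 1 = c' 0 2 + c' 2 0 := rfl
    have v2 : v 2 = c' 0 1 + c' 1 0 := rfl
    generalize hv0 : v 0 = a0 at *
    generalize hv1 : v 1 = a1 at *
    generalize hv2 : v 2 = a2 at *
    simp only [Matrix.cons_val_zero, Matrix.cons_val_one, Matrix.cons_val]
    clear_value c' d' e
    linear_combination (ψ x 1 * ψ x 2) * v0 + (ψ x 0 * ψ x 2) * v1 + (ψ x 0 * ψ x 1) * v2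
  · change ψ (P k) = _
    funext i
    rw [hψ]
    by_cases hik : i = k
    · simp [hik, coordPt]
    · simp [hik, coordPt, h.eval_corner_of_ne hik]

theorem exists_equivalent_normalForm (ε : Fin 3 → ℂ) (ω : Fin 4 → ℂ) :
    ∃ (ε' : Fin 3 → ℂ) (ω' : Fin 4 → ℂ), (∀ i, ε' i = 0 ∨ ε' i = 1) ∧
      Equivalent (normalForm ε ω) coordPt (normalForm ε' ω') coordPt := by
  -- Replacing a zero ε_i by 1 allows all three equations e_i s_i² = s₀s₁s₂ to be solved at once:
  -- take s_i² to be the product of the other two e's, with signs chosen so that s₀s₁s₂ = e₀e₁e₂.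
  let e : Fin 3 → ℂ := fun i => if ε i = 0 then 1 else ε i
  have he : ∀ i, e i ≠ 0 := fun i => by simp only [e]; split_ifs with h <;> simp [h]
  have h01 := mul_ne_zero (he 0) (he 1)
  have hE := mul_ne_zero h01 (he 2)
  obtain ⟨s0, hs0⟩ := IsAlgClosed.exists_pow_nat_eq (e 1 * e 2) two_pos
  obtain ⟨s1, hs1⟩ := IsAlgClosed.exists_pow_nat_eq (e 0 * e 2) two_pos
  have n0 : s0 ≠ 0 := by
    rintro rfl; exact mul_ne_zero (he 1) (he 2) (by rw [← hs0]; ring)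
  have n1 : s1 ≠ 0 := by
    rintro rfl; exact mul_ne_zero (he 0) (he 2) (by rw [← hs1]; ring)
  let s : Fin 3 → ℂ := ![s0, s1, e 0 * e 1 * e 2 / (s0 * s1)]
  have hS : s 0 * s 1 * s 2 = e 0 * e 1 * e 2 := by simp [s]; field_simp
  have hs2 : ∀ i, e 0 * e 1 * e 2 = e i * s i ^ 2 := by
    intro i
    fin_cases i
    · simp [s, hs0]; ring
    · simp [s, hs1]; ring
    · simp [s]
      field_simp
      rw [hs0, hs1]
      ring
  have hsn : ∀ i, s i ≠ 0 := by
    intro i h0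
    have := hs2 i
    rw [h0] at this
    exact hE (by simpa using this)
  refine ⟨fun i => if ε i = 0 then 0 else 1,
    ![ω 0 * s 0 / (e 0 * e 1 * e 2), ω 1 * s 1 / (e 0 * e 1 * e 2),
      ω 2 * s 2 / (e 0 * e 1 * e 2), ω 3 / (e 0 * e 1 * e 2)], fun i => ?_,
    equivalent_of_scaling 1 s hsn (fun i => ?_) (fun i => ?_) ?_⟩
  · dsimp only; split_ifs <;> simp
  · rw [hS, hs2 i]
    by_cases h : ε i = 0 <;> simp [h, e]
  · rw [hS]
    fin_cases i
    · exact div_mul_cancel₀ _ hE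
    · exact div_mul_cancel₀ _ hE
    · exact div_mul_cancel₀ _ hE
  · rw [hS]
    exact div_mul_cancel₀ _ hE

theorem HasTriangleAtInfinity.exists_equivalent_normalForm {f : AffPoly}
    {L : Fin 3 → Module.Dual ℂ (Fin 3 → ℂ)} {P : Fin 3 → Fin 3 → ℂ}
    (h : HasTriangleAtInfinity f L P) :
    ∃ (ε : Fin 3 → ℂ) (ω : Fin 4 → ℂ), (∀ i, ε i = 0 ∨ ε i = 1) ∧
      Equivalent f P (normalForm ε ω) coordPt := by
  obtain ⟨ε, ω, h1⟩ := h.exists_equivalent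
  obtain ⟨ε', ω', hε, h2⟩ := AffineCubic.exists_equivalent_normalForm ε ω
  exact ⟨ε', ω', hε, h1.trans h2⟩

/-! ### The corners of a normal form -/

theorem atInfinity_zero (y : Fin 3 → ℂ) : atInfinity y 0 = 0 := rfl

theorem atInfinity_one (y : Fin 3 → ℂ) : atInfinity y 1 = y 0 := rfl

theorem atInfinity_two (y : Fin 3 → ℂ) : atInfinity y 2 = y 1 := rfl

theorem atInfinity_three (y : Fin 3 → ℂ) : atInfinity y 3 = y 2 := rfl

theorem hasTriangleAtInfinity_normalForm (ε : Fin 3 → ℂ) (ω : Fin 4 → ℂ) :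
    HasTriangleAtInfinity (normalForm ε ω) coordForm coordPt where
  totalDegree_eq := by
    refine le_antisymm (totalDegree_normalForm_le ε ω) ?_
    by_contra hlt
    have h3 : homogeneousComponent 3 (normalForm ε ω) = 0 :=
      homogeneousComponent_eq_zero _ _ (not_le.1 hlt)
    -- At [0:1:1:1] the completion takes the value 1, but only the cubic component contributes at
    -- infinity.
    have h1 := eval_completion (normalForm ε ω) (atInfinity 1)
    rw [eval_completion_normalForm] at h1
    simp [Finset.sum_range_succ, atInfinity_zero, atInfinity_one, atInfinity_two,
      atInfinity_three, h3] at h1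
  curve_at_infinity y := by
    rw [eval_completion_normalForm, Fin.prod_univ_three]
    simp [atInfinity_zero, atInfinity_one, atInfinity_two, atInfinity_three, coordForm]
  corner_ne_zero k := Pi.single_ne_zero_iff.2 one_ne_zero
  inter_eq_corner i j k hij hjk hki := by
    ext x
    simp only [Submodule.mem_inf, LinearMap.mem_ker, coordForm, LinearMap.proj_apply,
      Submodule.mem_span_singleton]
    constructor
    · rintro ⟨hi, hj⟩
      refine ⟨x k, funext fun l => ?_⟩
      have : l = i ∨ l = j ∨ l = k := by clear hi hj; revert i j k l; decide
      rcases this with rfl | rfl | rfl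
      · simp [coordPt, hki, hi]
      · simp [coordPt, hjk, hj]
      · simp [coordPt]
    · rintro ⟨c, rfl⟩
      simp [coordPt, hki.symm, hjk]
  corners_distinct k l hkl h := by
    have : coordPt k ∈ Submodule.span ℂ {coordPt l} := h ▸ Submodule.mem_span_singleton_self _
    obtain ⟨c, hc⟩ := Submodule.mem_span_singleton.1 this
    have := congrFun hc k
    simp [coordPt, hkl] at this

/-- On X₀ = 0 the partials in X₁, X₂, X₃ are the pairwise products of the coordinates, so only one
coordinate y_k survives. The partial in X₀ then reads ε_k y_k² = 0. -/
theorem isSingularPt_atInfinity_iff (ε : Fin 3 → ℂ) (ω : Fin 4 → ℂ) {y : Fin 3 → ℂ} (hy : y ≠ 0) :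
    IsSingularPt (completion (normalForm ε ω)) (atInfinity y) ↔
      ∃ k, ε k = 0 ∧ ∃ c : ℂ, y = c • coordPt k := by
  rw [isSingularPt_normalForm_iff, eval_completion_normalForm]
  simp only [atInfinity_zero, atInfinity_one, atInfinity_two, atInfinity_three]
  constructor
  · rintro ⟨-, h0, h1, h2, h3⟩
    obtain ⟨k, hk⟩ := Function.ne_iff.1 hy
    have hk' : y k ≠ 0 := hk
    have hall : ∀ l, l ≠ k → y l = 0 := by
      intro l hl
      fin_cases k <;> fin_cases l <;> simp_all
    refine ⟨k, ?_, y k, funext fun l => ?_⟩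
    · have : ε k * y k ^ 2 = 0 := by
        fin_cases k
        · simpa [hall 1 (by decide), hall 2 (by decide)] using h0
        · simpa [hall 0 (by decide), hall 2 (by decide)] using h0
        · simpa [hall 0 (by decide), hall 1 (by decide)] using h0
      simpa [hk'] using this
    · by_cases hl : l = k
      · simp [hl, coordPt]
      · simp [hl, coordPt, hall l hl]
  · rintro ⟨k, hk, c, rfl⟩
    fin_cases k <;> simp_all [coordPt]

theorem isRegularPt_corner_iff {ε : Fin 3 → ℂ} (ω : Fin 4 → ℂ) (k : Fin 3) :
    IsRegularPt (completion (normalForm ε ω)) (atInfinity (coordPt k)) ↔ ε k ≠ 0 := by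
  have h0 : eval (atInfinity (coordPt k)) (completion (normalForm ε ω)) = 0 := by
    rw [eval_completion_normalForm]
    fin_cases k <;>
      simp [atInfinity_zero, atInfinity_one, atInfinity_two, atInfinity_three, coordPt]
  have hs : IsRegularPt (completion (normalForm ε ω)) (atInfinity (coordPt k)) ↔
      ¬ IsSingularPt (completion (normalForm ε ω)) (atInfinity (coordPt k)) := by
    rw [isRegularPt_iff, isSingularPt_iff]
    simp [h0]
  have hk : coordPt k ≠ 0 := Pi.single_ne_zero_iff.2 one_ne_zero
  rw [hs, isSingularPt_atInfinity_iff ε ω hk, not_iff_not]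
  constructor
  · rintro ⟨l, hl, c, hc⟩
    have : k = l := by
      by_contra hkl
      have := congrFun hc k
      simp [coordPt, hkl] at this
    rwa [this]
  · exact fun h => ⟨k, h, 1, by simp⟩

theorem singularPt_of_isSmoothAffine {ε : Fin 3 → ℂ} {ω : Fin 4 → ℂ}
    (h : IsSmoothAffine (normalForm ε ω)) {p : Fin 4 → ℂ} (hp : p ≠ 0)
    (hs : IsSingularPt (completion (normalForm ε ω)) p) :
    ∃ k, ∃ c : ℂ, p = c • atInfinity (coordPt k) := by
  by_cases h0 : p 0 = 0
  · have hp' : p = atInfinity (Fin.tail p) := by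
      rw [atInfinity, ← h0, Fin.cons_self_tail]
    have ht : Fin.tail p ≠ 0 := by
      intro h1
      rw [h1] at hp'
      refine hp (hp'.trans (funext fun i => ?_))
      refine Fin.cases ?_ (fun i => ?_) i <;> simp [atInfinity]
    rw [hp', isSingularPt_atInfinity_iff ε ω ht] at hs
    obtain ⟨k, -, c, hc⟩ := hs
    refine ⟨k, c, hp'.trans ?_⟩
    rw [hc]
    funext i
    refine Fin.cases ?_ (fun i => ?_) i <;> simp [atInfinity]
  · exfalso
    obtain ⟨e0, -, e1, e2, e3⟩ := (isSingularPt_normalForm_iff ε ω p).1 hs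
    rw [eval_completion_normalForm] at e0
    refine (isSmoothAffine_normalForm_iff ε ω).1 h ![p 1 / p 0, p 2 / p 0, p 3 / p 0] ?_ ?_ ?_ ?_
    · rw [eval_normalForm]
      simp
      field_simp
      linear_combination e0
    · simp
      field_simp
      linear_combination e1
    · simp
      field_simp
      linear_combination e2
    · simp
      field_simp
      linear_combination e3

/-! ### Smooth normal forms and the rows of the table -/

/-- The equations of a singular affine point of a normal form have no solution. -/
def NoSingularPoint (e₁ e₂ e₃ w₁ w₂ w₃ w₄ : ℂ) : Prop :=
  ∀ x y z : ℂ, x * y * z + (e₁ * x ^ 2 + e₂ * y ^ 2 + e₃ * z ^ 2) + (w₁ * x + w₂ * y + w₃ * z) +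
    w₄ = 0 → y * z + 2 * e₁ * x + w₁ = 0 → x * z + 2 * e₂ * y + w₂ = 0 →
    x * y + 2 * e₃ * z + w₃ = 0 → False

theorem isSmoothAffine_iff_noSingularPoint (ε : Fin 3 → ℂ) (ω : Fin 4 → ℂ) :
    IsSmoothAffine (normalForm ε ω) ↔
      NoSingularPoint (ε 0) (ε 1) (ε 2) (ω 0) (ω 1) (ω 2) (ω 3) := by
  rw [isSmoothAffine_normalForm_iff]
  constructor
  · intro h x y z h0 h1 h2 h3
    exact h ![x, y, z] (by rw [eval_normalForm]; simpa using h0) (by simpa using h1)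
      (by simpa using h2) (by simpa using h3)
  · intro h x h0 h1 h2 h3
    rw [eval_normalForm] at h0
    exact h _ _ _ h0 h1 h2 h3

theorem isSmoothAffine_vec_iff (e₁ e₂ e₃ w₁ w₂ w₃ w₄ : ℂ) :
    IsSmoothAffine (normalForm ![e₁, e₂, e₃] ![w₁, w₂, w₃, w₄]) ↔
      NoSingularPoint e₁ e₂ e₃ w₁ w₂ w₃ w₄ :=
  isSmoothAffine_iff_noSingularPoint _ _

/-- Nondegeneracy conditions on the parameters of the rows of the table, which ensure that the
corners have the listed types. -/
def goodParams : Fin 15 → (Fin 4 → ℂ) → Prop := ![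
  fun _ => True, fun w => w 2 ≠ 0 ∧ w 2 ^ 2 ≠ 1, fun w => w 0 - 1 ≠ 0, fun w => w 0 ≠ 0,
  fun _ => True, fun w => w 1 ≠ 0, fun w => w 1 ≠ 0, fun _ => True, fun _ => True, fun _ => True,
  fun _ => True, fun _ => True, fun _ => True, fun _ => True, fun _ => True]

theorem domain_of_goodParams {r : Fin 15} {w : Fin 4 → ℂ} (h : goodParams r w) :
    (table r).domain w := by
  fin_cases r <;> first | trivial | exact h.2

theorem hasPointType_normalForm {ε : Fin 3 → ℂ} {ω : Fin 4 → ℂ} {i j k : Fin 3} (hij : i ≠ j)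
    (hjk : j ≠ k) (hki : k ≠ i) {n : ℕ} (h : (n = 0 ∧ ε k ≠ 0) ∨ (ε k = 0 ∧
      CornerCondition (ε i) (ε j) (ω i.castSucc) (ω j.castSucc) (ω k.castSucc) (ω 3) n)) :
    HasPointType (completion (normalForm ε ω)) (atInfinity (coordPt k)) n :=
  h.imp (fun h => ⟨h.1, (isRegularPt_corner_iff ω k).2 h.2⟩)
    fun h => hasSingularityA_normalForm hij hjk hki h.1 h.2

theorem hasPointType_tableCubic {r : Fin 15} {w : Fin 4 → ℂ} (h : goodParams r w) (k : Fin 3) :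
    HasPointType (completion (tableCubic r w)) (atInfinity (coordPt k)) ((table r).types k) := by
  fin_cases k
  · refine hasPointType_normalForm (i := 1) (j := 2) (by decide) (by decide) (by decide) ?_
    fin_cases r <;> simp_all [table, CornerCondition, goodParams]
  · refine hasPointType_normalForm (i := 0) (j := 2) (by decide) (by decide) (by decide) ?_
    fin_cases r <;> simp_all [table, CornerCondition, goodParams]
  · refine hasPointType_normalForm (i := 0) (j := 1) (by decide) (by decide) (by decide) ?_
    fin_cases r <;> simp_all [table, CornerCondition, goodParams]

/-- The normal form is equivalent to the cubic of some row of the table. -/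
def HasRow (ε : Fin 3 → ℂ) (ω : Fin 4 → ℂ) : Prop :=
  ∃ (r : Fin 15) (w : Fin 4 → ℂ), goodParams r w ∧
    Equivalent (normalForm ε ω) coordPt (tableCubic r w) coordPt

theorem hasRow_of_perm (σ : Equiv.Perm (Fin 3)) {ε : Fin 3 → ℂ} {ω : Fin 4 → ℂ}
    (hs : IsSmoothAffine (normalForm ε ω))
    (h : IsSmoothAffine (normalForm ![ε (σ 0), ε (σ 1), ε (σ 2)]
        ![ω (σ 0).castSucc, ω (σ 1).castSucc, ω (σ 2).castSucc, ω 3]) →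
      HasRow ![ε (σ 0), ε (σ 1), ε (σ 2)]
        ![ω (σ 0).castSucc, ω (σ 1).castSucc, ω (σ 2).castSucc, ω 3]) : HasRow ε ω := by
  have e : Equivalent (normalForm ε ω) coordPt (normalForm ![ε (σ 0), ε (σ 1), ε (σ 2)]
      ![ω (σ 0).castSucc, ω (σ 1).castSucc, ω (σ 2).castSucc, ω 3]) coordPt := by
    refine equivalent_of_scaling σ (fun _ => 1) (fun _ => one_ne_zero) (fun i => ?_) (fun i => ?_)
      (by simp)
    · fin_cases i <;> simp
    · fin_cases i <;> simp
  obtain ⟨r, w, hr, hw⟩ := h (e.isSmoothAffine hs)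
  exact ⟨r, w, hr, e.trans hw⟩

theorem hasRow_of_scaling {e₁ e₂ e₃ w₁ w₂ w₃ w₄ : ℂ} (r : Fin 15) (w : Fin 4 → ℂ)
    (hr : goodParams r w) {p q s : ℂ} (hp : p ≠ 0) (hq : q ≠ 0) (hs : s ≠ 0)
    (h₁ : (table r).eps 0 * (p * q * s) = e₁ * p ^ 2)
    (h₂ : (table r).eps 1 * (p * q * s) = e₂ * q ^ 2)
    (h₃ : (table r).eps 2 * (p * q * s) = e₃ * s ^ 2)
    (k₁ : (table r).coeff w 0 * (p * q * s) = w₁ * p)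
    (k₂ : (table r).coeff w 1 * (p * q * s) = w₂ * q)
    (k₃ : (table r).coeff w 2 * (p * q * s) = w₃ * s)
    (k₄ : (table r).coeff w 3 * (p * q * s) = w₄) :
    HasRow ![e₁, e₂, e₃] ![w₁, w₂, w₃, w₄] := by
  refine ⟨r, w, hr, equivalent_of_scaling 1 ![p, q, s] (fun i => ?_) (fun i => ?_) (fun i => ?_) k₄⟩
  · fin_cases i
    · exact hp
    · exact hq
    · exact hs
  · fin_cases i
    · exact h₁
    · exact h₂
    · exact h₃
  · fin_cases i
    · exact k₁
    · exact k₂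
    · exact k₃

/-! ### Finding the row and the scaling for each pattern of ε -/

theorem exists_quadratic_root (b c : ℂ) : ∃ x : ℂ, x ^ 2 + b * x + c = 0 := by
  obtain ⟨s, hs⟩ := IsAlgClosed.exists_pow_nat_eq (b ^ 2 - 4 * c) two_pos
  exact ⟨(-b + s) / 2, by linear_combination (1 / 4 : ℂ) * hs⟩

theorem exists_cubic_root {a : ℂ} (ha : a ≠ 0) (b c d : ℂ) :
    ∃ x : ℂ, a * x ^ 3 + b * x ^ 2 + c * x + d = 0 := by
  have hdeg : (Polynomial.C a * Polynomial.X ^ 3 + Polynomial.C b * Polynomial.X ^ 2 +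
    Polynomial.C c * Polynomial.X + Polynomial.C d : Polynomial ℂ).degree = 3 :=
    Polynomial.degree_cubic ha
  obtain ⟨x, hx⟩ := IsAlgClosed.exists_root _ (by rw [hdeg]; decide)
  exact ⟨x, by simpa [Polynomial.IsRoot] using hx⟩

/-- Under these conditions the plane x₃ = 2τ cuts out the double line (x₁ + τx₂ + τb/2)² = 0. Along
it only ∂/∂x₃ can be nonzero; it restricts to a quadratic polynomial, whose root is a singular
point. -/
theorem noSingularPoint_double_line {a b c d τ : ℂ} (hs : NoSingularPoint 1 1 0 a b c d)
    (hτ : τ ^ 2 = 1) (ha : a = τ * b) (hb : b ^ 2 = 4 * (2 * τ * c + d)) : False := by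
  obtain ⟨x, hx⟩ := exists_quadratic_root (τ * b / 2) (-τ * c)
  refine hs x (-τ * x - b / 2) (2 * τ) ?_ ?_ ?_ ?_
  · rw [ha]
    linear_combination (-1 / 4 : ℂ) * hb - (x ^ 2) * hτ
  · rw [ha]
    linear_combination (-2 * x) * hτ
  · ring
  · linear_combination (-τ) * hx + (b * x / 2 - c) * hτ

/-- The equation says that the conic in the plane x₃ = u is degenerate. If all roots of this cubic
in u were ±2, one of ±2 would be a multiple root, and the section there a double line, contradicting
smoothness. -/
theorem exists_discriminant_root {a b c d : ℂ} (hs : NoSingularPoint 1 1 0 a b c d) (hc : c ≠ 0) :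
    ∃ u : ℂ, u ^ 2 ≠ 4 ∧ (4 - u ^ 2) * (c * u + d) + u * a * b - a ^ 2 - b ^ 2 = 0 := by
  by_contra hno
  push Not at hno
  obtain ⟨u, hu⟩ := exists_cubic_root (neg_ne_zero.2 hc) (-d) (4 * c + a * b)
    (4 * d - a ^ 2 - b ^ 2)
  have hu' : (4 - u ^ 2) * (c * u + d) + u * a * b - a ^ 2 - b ^ 2 = 0 := by
    linear_combination hu
  have hu4 : u ^ 2 = 4 := by
    by_contra h
    exact hno u h hu'
  obtain ⟨σ, rfl⟩ : ∃ σ, u = 2 * σ := ⟨u / 2, by ring⟩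
  have hσ : σ ^ 2 = 1 := by linear_combination (1 / 4 : ℂ) * hu4
  have ha : a = σ * b := by
    have : (a - σ * b) ^ 2 = 0 := by
      linear_combination (-1 : ℂ) * hu' + (b ^ 2 - 4 * (c * (2 * σ) + d)) * hσ
    exact sub_eq_zero.1 (pow_eq_zero_iff two_ne_zero |>.1 this)
  subst ha
  -- With a = σb the cubic is divisible by u - 2σ; this is the remaining quadratic factor, made
  -- monic.
  obtain ⟨v, hv⟩ := exists_quadratic_root ((d + 2 * σ * c) / c) ((2 * σ * d - σ * b ^ 2) / c)
  have hv' : -(v + 2 * σ) * (c * v + d) + σ * b ^ 2 = 0 := by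
    field_simp at hv
    linear_combination (-1 : ℂ) * hv
  have hv4 : v ^ 2 = 4 := by
    by_contra h
    refine hno v h ?_
    linear_combination (v - 2 * σ) * hv' + (4 * (c * v + d) - b ^ 2) * (-hσ)
  have hvσ : (v - 2 * σ) * (v + 2 * σ) = 0 := by linear_combination hv4 - 4 * hσ
  have hσ0 : σ ≠ 0 := by rintro rfl; norm_num at hσ
  rcases mul_eq_zero.1 hvσ with h | h
  · have hv2 : v = 2 * σ := sub_eq_zero.1 h
    subst hv2
    refine noSingularPoint_double_line hs hσ rfl ?_
    refine mul_left_cancel₀ hσ0 ?_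
    linear_combination hv'
  · have hb : b = 0 := by
      rw [show v = -(2 * σ) by linear_combination h] at hv'
      have : σ * b ^ 2 = 0 := by linear_combination hv'
      simpa [hσ0] using this
    subst hb
    -- With a = b = 0 the cubic is (4 - u²)(cu + d), so -d/c is its third root.
    have hd4 : (-d / c) ^ 2 = 4 := by
      by_contra h
      refine hno _ h ?_
      field_simp
      ring
    have hd : d ^ 2 = 4 * c ^ 2 := by
      field_simp at hd4
      linear_combination hd4
    have hdσ : (2 * σ * c + d) * (2 * (-σ) * c + d) = 0 := by
      linear_combination hd - 4 * c ^ 2 * hσ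
    rcases mul_eq_zero.1 hdσ with h | h
    · exact noSingularPoint_double_line hs hσ (by ring) (by rw [h]; ring)
    · exact noSingularPoint_double_line (τ := -σ) hs (by rw [neg_sq, hσ]) (by ring)
        (by rw [h]; ring)

/-- R is the value of ω₄ for which the section x₃ = -(ω₃ + 1/ω₃) is degenerate. So write the root as
u = -(t + 1/t) and choose the scale l with l² = tc, which makes ω₃ equal to 1/t. The condition u² ≠
4 becomes ω₃² ≠ 1. -/
theorem hasRow_110_of_ne {a b c d : ℂ} (hs : NoSingularPoint 1 1 0 a b c d) (hc : c ≠ 0) :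
    HasRow ![1, 1, 0] ![a, b, c, d] := by
  obtain ⟨u, hu4, hu⟩ := exists_discriminant_root hs hc
  obtain ⟨t, ht⟩ := exists_quadratic_root u 1
  have ht0 : t ≠ 0 := by rintro rfl; norm_num at ht
  have hu' : u = -(t ^ 2 + 1) / t := by
    field_simp
    linear_combination ht
  have ht1 : t ^ 2 - 1 ≠ 0 := by
    intro h
    apply hu4
    rw [hu']
    field_simp
    linear_combination (t ^ 2 - 1) * h
  have ht1' : 1 - t ^ 2 ≠ 0 := fun h => ht1 (by linear_combination -h)
  obtain ⟨l, hl⟩ := IsAlgClosed.exists_pow_nat_eq (t * c) two_pos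
  have hl0 : l ≠ 0 := by
    rintro rfl
    exact mul_ne_zero ht0 hc (by rw [← hl]; ring)
  have hd : d * (1 - t ^ 2) ^ 2 * t = c * (t ^ 2 + 1) * (1 - t ^ 2) ^ 2 -
      t ^ 2 * (b * t + a) * (a * t + b) := by
    rw [hu'] at hu
    field_simp at hu
    linear_combination (-1 : ℂ) * hu
  refine hasRow_of_scaling 1 ![a / l, b / l, 1 / t, 0] ?_ hl0 hl0 one_ne_zero ?_ ?_ ?_ ?_ ?_ ?_ ?_
  · refine ⟨by simp [ht0], ?_⟩
    simp only [Matrix.cons_val]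
    intro h
    field_simp at h
    exact ht1' (by linear_combination h)
  · simp [table]; ring
  · simp [table]; ring
  · simp [table]
  · simp [table]; field_simp
  · simp [table]; field_simp
  · simp [table]; field_simp; linear_combination hl
  · simp [table, R]
    have hR : (t ^ 2)⁻¹ - 1 ≠ 0 := by
      intro h
      field_simp at h
      exact ht1' (by linear_combination h)
    have hR' : (t ^ 2)⁻¹ - 1 = (1 - t ^ 2) / t ^ 2 := by field_simp
    rw [hR']
    field_simp
    rw [hl]
    linear_combination (-t) * hd

/-- The hypothesis `hab` only fixes the order of the first two coordinates; `hasRow_vec_110`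
arranges it by a transposition. -/
theorem hasRow_110 {a b c d : ℂ} (hs : NoSingularPoint 1 1 0 a b c d) (hab : a ≠ 0 → b ≠ 0) :
    HasRow ![1, 1, 0] ![a, b, c, d] := by
  by_cases hc : c = 0
  swap
  · exact hasRow_110_of_ne hs hc
  subst hc
  by_cases hd : d = 0
  swap
  -- After scaling by l, l² - al + d = 0 is the relation ω₄ = ω₁ - 1.
  · obtain ⟨l, hl⟩ := exists_quadratic_root (-a) d
    have hl0 : l ≠ 0 := by
      rintro rfl
      exact hd (by linear_combination hl)
    refine hasRow_of_scaling 2 ![a / l, b / l, 0, 0] ?_ hl0 hl0 one_ne_zero ?_ ?_ ?_ ?_ ?_ ?_ ?_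
    · change a / l - 1 ≠ 0
      intro h
      field_simp at h
      exact hd (by linear_combination hl + l * h)
    · simp [table]; ring
    · simp [table]; ring
    · simp [table]
    · simp [table]; field_simp
    · simp [table]; field_simp
    · simp [table]
    · simp [table]; field_simp; linear_combination (-1 : ℂ) * hl
  subst hd
  have hb : b ≠ 0 := by
    intro hb
    have ha : a = 0 := by
      by_contra ha
      exact hab ha hb
    exact hs 0 0 0 (by ring) (by rw [ha]; ring) (by rw [hb]; ring) (by ring)
  by_cases ha : a = 0
  · refine hasRow_of_scaling 4 0 trivial (neg_ne_zero.2 hb) (neg_ne_zero.2 hb) one_ne_zero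
      ?_ ?_ ?_ ?_ ?_ ?_ ?_ <;> simp [table, ha] <;> ring
  · refine hasRow_of_scaling 3 ![-a / b, 0, 0, 0] ?_ (neg_ne_zero.2 hb) (neg_ne_zero.2 hb)
      one_ne_zero ?_ ?_ ?_ ?_ ?_ ?_ ?_
    · change -a / b ≠ 0
      exact div_ne_zero (neg_ne_zero.2 ha) hb
    all_goals simp [table]
    all_goals first | ring1 | field_simp

theorem hasRow_100 {a b c d : ℂ} (hs : NoSingularPoint 1 0 0 a b c d) (hbc : c ≠ 0 → b ≠ 0) :
    HasRow ![1, 0, 0] ![a, b, c, d] := by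
  by_cases hb : b = 0
  · have hc : c = 0 := by
      by_contra h
      exact hbc h hb
    subst hb hc
    have hd : d ≠ 0 := by
      rintro rfl
      -- The cubic is x(yz + x + a), singular where both factors vanish.
      exact hs 0 1 (-a) (by ring) (by ring) (by ring) (by ring)
    obtain ⟨l, hl⟩ := IsAlgClosed.exists_pow_nat_eq d two_pos
    have hl0 : l ≠ 0 := by
      rintro rfl
      exact hd (by rw [← hl]; ring)
    refine hasRow_of_scaling 9 ![a / l, 0, 0, 0] trivial hl0 hl0 one_ne_zero
      ?_ ?_ ?_ ?_ ?_ ?_ ?_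
    all_goals simp [table]
    · ring
    · field_simp
    · linear_combination hl
  by_cases hc : c = 0
  · subst hc
    by_cases hd : d = 0
    · subst hd
      by_cases ha : a = 0
      · subst ha
        refine hasRow_of_scaling 13 0 trivial one_ne_zero
          (neg_ne_zero.2 (inv_ne_zero hb)) (neg_ne_zero.2 hb) ?_ ?_ ?_ ?_ ?_ ?_ ?_
        all_goals simp [table, hb]
      · refine hasRow_of_scaling 10 0 trivial (p := -a) (q := -a ^ 2 / b) (s := b / a) ?_ ?_ ?_
          ?_ ?_ ?_ ?_ ?_ ?_ ?_
        all_goals simp [table, hb, ha]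
        all_goals field_simp
    · obtain ⟨l, hl⟩ := IsAlgClosed.exists_pow_nat_eq d two_pos
      have hl0 : l ≠ 0 := by
        rintro rfl
        exact hd (by rw [← hl]; ring)
      refine hasRow_of_scaling 7 ![a / l, 0, 0, 0] trivial (p := l) (q := -l ^ 2 / b) (s := -b / l)
        ?_ ?_ ?_ ?_ ?_ ?_ ?_ ?_ ?_ ?_
      all_goals simp [table, hb, hl0]
      all_goals field_simp
      exact hl
  · obtain ⟨m, hm⟩ := IsAlgClosed.exists_pow_nat_eq (b * c) two_pos
    have hm0 : m ≠ 0 := by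
      rintro rfl
      exact mul_ne_zero hb hc (by rw [← hm]; ring)
    -- The scaling (k², mk/b, kb/m) with m² = bc keeps ε and gives ω₂ = ω₃ = m/k³. This cubic is the
    -- remaining relation ω₄ = ω₂(1 + ω₁ - ω₂).
    obtain ⟨k, hk⟩ := exists_cubic_root hm0 (-d) (m * a) (-m ^ 2)
    have hk0 : k ≠ 0 := by
      rintro rfl
      exact hm0 (by simpa using hk)
    refine hasRow_of_scaling 5 ![a / k ^ 2, m / k ^ 3, 0, 0] ?_ (p := k ^ 2) (q := m * k / b)
      (s := k * b / m) ?_ ?_ ?_ ?_ ?_ ?_ ?_ ?_ ?_ ?_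
    · change m / k ^ 3 ≠ 0
      exact div_ne_zero hm0 (pow_ne_zero _ hk0)
    all_goals simp [table, hb, hk0, hm0]
    all_goals field_simp
    · linear_combination hm
    · linear_combination hk

theorem hasRow_000 {a b c d : ℂ} (hs : NoSingularPoint 0 0 0 a b c d) (hab : b ≠ 0 → a ≠ 0)
    (hbc : c ≠ 0 → b ≠ 0) : HasRow ![0, 0, 0] ![a, b, c, d] := by
  by_cases ha : a = 0
  · have hb : b = 0 := by
      by_contra h
      exact hab h ha
    have hc : c = 0 := by
      by_contra h
      exact hbc h hb
    subst ha hb hc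
    have hd : d ≠ 0 := by
      rintro rfl
      exact hs 0 0 0 (by ring) (by ring) (by ring) (by ring)
    refine hasRow_of_scaling 14 0 trivial hd one_ne_zero one_ne_zero ?_ ?_ ?_ ?_ ?_ ?_ ?_
    all_goals simp [table]
  by_cases hb : b = 0
  · have hc : c = 0 := by
      by_contra h
      exact hbc h hb
    subst hb hc
    have hd : d ≠ 0 := by
      rintro rfl
      exact hs 0 1 (-a) (by ring) (by ring) (by ring) (by ring)
    refine hasRow_of_scaling 12 0 trivial (p := -d / a) (q := 1) (s := -a) ?_ ?_ ?_
      ?_ ?_ ?_ ?_ ?_ ?_ ?_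
    all_goals simp [table, ha, hd]
    field_simp
  by_cases hc : c = 0
  · subst hc
    by_cases hd : d = 0
    · subst hd
      refine hasRow_of_scaling 11 0 trivial (p := -1 / a) (q := -1 / b) (s := a * b) ?_ ?_ ?_
        ?_ ?_ ?_ ?_ ?_ ?_ ?_
      all_goals simp [table, ha, hb]
      all_goals field_simp
    · refine hasRow_of_scaling 8 0 trivial (p := -d / a) (q := -d / b) (s := a * b / d) ?_ ?_ ?_
        ?_ ?_ ?_ ?_ ?_ ?_ ?_
      all_goals simp [table, ha, hb, hd]
      all_goals field_simp
  -- With pqs = m and ω₁ = ω₃ = -1 one gets ω₂ = abc/m², and this quadratic is the relation ω₄ = 1 -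
  -- ω₂.
  · obtain ⟨m, hm⟩ := exists_quadratic_root (-d) (-(a * b * c))
    have hm0 : m ≠ 0 := by
      rintro rfl
      exact mul_ne_zero (mul_ne_zero ha hb) hc (by linear_combination -hm)
    refine hasRow_of_scaling 6 ![0, a * b * c / m ^ 2, 0, 0] ?_ (p := -m / a) (q := a * c / m)
      (s := -m / c) ?_ ?_ ?_ ?_ ?_ ?_ ?_ ?_ ?_ ?_
    · change a * b * c / m ^ 2 ≠ 0
      exact div_ne_zero (mul_ne_zero (mul_ne_zero ha hb) hc) (pow_ne_zero _ hm0)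
    all_goals simp [table, ha, hc, hm0]
    all_goals field_simp
    linear_combination hm

theorem hasRow_vec_110 {a b c d : ℂ} (hs : IsSmoothAffine (normalForm ![1, 1, 0] ![a, b, c, d])) :
    HasRow ![1, 1, 0] ![a, b, c, d] := by
  by_cases hab : a ≠ 0 → b ≠ 0
  · exact hasRow_110 ((isSmoothAffine_vec_iff _ _ _ _ _ _ _).1 hs) hab
  · push Not at hab
    refine hasRow_of_perm (Equiv.swap 0 1) hs fun h => ?_
    have e0 : Equiv.swap (0 : Fin 3) 1 0 = 1 := by decide
    have e1 : Equiv.swap (0 : Fin 3) 1 1 = 0 := by decide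
    have e2 : Equiv.swap (0 : Fin 3) 1 2 = 2 := by decide
    rw [e0, e1, e2] at h ⊢
    exact hasRow_110 ((isSmoothAffine_vec_iff _ _ _ _ _ _ _).1 h) fun _ => hab.1

theorem hasRow_vec_100 {a b c d : ℂ} (hs : IsSmoothAffine (normalForm ![1, 0, 0] ![a, b, c, d])) :
    HasRow ![1, 0, 0] ![a, b, c, d] := by
  by_cases hbc : c ≠ 0 → b ≠ 0
  · exact hasRow_100 ((isSmoothAffine_vec_iff _ _ _ _ _ _ _).1 hs) hbc
  · push Not at hbc
    refine hasRow_of_perm (Equiv.swap 1 2) hs fun h => ?_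
    have e0 : Equiv.swap (1 : Fin 3) 2 0 = 0 := by decide
    have e1 : Equiv.swap (1 : Fin 3) 2 1 = 2 := by decide
    have e2 : Equiv.swap (1 : Fin 3) 2 2 = 1 := by decide
    rw [e0, e1, e2] at h ⊢
    exact hasRow_100 ((isSmoothAffine_vec_iff _ _ _ _ _ _ _).1 h) fun _ => hbc.1

theorem hasRow_vec_000 {a b c d : ℂ} (hs : IsSmoothAffine (normalForm ![0, 0, 0] ![a, b, c, d])) :
    HasRow ![0, 0, 0] ![a, b, c, d] := by
  have key : ∃ σ : Equiv.Perm (Fin 3),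
      (![a, b, c] (σ 1) ≠ 0 → ![a, b, c] (σ 0) ≠ 0) ∧
      (![a, b, c] (σ 2) ≠ 0 → ![a, b, c] (σ 1) ≠ 0) := by
    have e0 : ∀ i j : Fin 3, Equiv.swap i j i = j := fun i j => Equiv.swap_apply_left i j
    have e1 : ∀ i j : Fin 3, Equiv.swap i j j = i := fun i j => Equiv.swap_apply_right i j
    have e2 : Equiv.swap (0 : Fin 3) 1 2 = 2 := by decide
    have e3 : Equiv.swap (0 : Fin 3) 2 1 = 1 := by decide
    have e4 : Equiv.swap (1 : Fin 3) 2 0 = 0 := by decide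
    by_cases ha : a = 0 <;> by_cases hb : b = 0 <;> by_cases hc : c = 0
    · exact ⟨1, by simp [ha, hb, hc]⟩
    · exact ⟨Equiv.swap 0 2, by simp [ha, hb, hc, e0, e1, e3]⟩
    · exact ⟨Equiv.swap 0 1, by simp [ha, hb, hc, e0, e1, e2]⟩
    · exact ⟨Equiv.swap 0 2, by simp [ha, hb, hc, e0, e1, e3]⟩
    · exact ⟨1, by simp [ha, hb, hc]⟩
    · exact ⟨Equiv.swap 1 2, by simp [ha, hb, hc, e0, e1, e4]⟩
    · exact ⟨1, by simp [ha, hb, hc]⟩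
    · exact ⟨1, by simp [ha, hb, hc]⟩
  obtain ⟨σ, h1, h2⟩ := key
  have hε : ∀ i : Fin 3, (![0, 0, 0] : Fin 3 → ℂ) i = 0 := by
    intro i; fin_cases i <;> rfl
  have hω : ∀ i : Fin 3, (![a, b, c, d] : Fin 4 → ℂ) i.castSucc = ![a, b, c] i := by
    intro i; fin_cases i <;> rfl
  refine hasRow_of_perm σ hs fun h => ?_
  simp only [hε, hω] at h ⊢
  exact hasRow_000 ((isSmoothAffine_vec_iff _ _ _ _ _ _ _).1 h) h1 h2

theorem hasRow_of_isSmoothAffine {ε : Fin 3 → ℂ} {ω : Fin 4 → ℂ} (hε : ∀ i, ε i = 0 ∨ ε i = 1)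
    (hs : IsSmoothAffine (normalForm ε ω)) : HasRow ε ω := by
  have e0 : ∀ i j : Fin 3, Equiv.swap i j i = j := fun i j => Equiv.swap_apply_left i j
  have e1 : ∀ i j : Fin 3, Equiv.swap i j j = i := fun i j => Equiv.swap_apply_right i j
  have e2 : Equiv.swap (0 : Fin 3) 1 2 = 2 := by decide
  have e3 : Equiv.swap (0 : Fin 3) 2 1 = 1 := by decide
  have e4 : Equiv.swap (1 : Fin 3) 2 0 = 0 := by decide
  rcases hε 0 with h0 | h0 <;> rcases hε 1 with h1 | h1 <;> rcases hε 2 with h2 | h2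
  · refine hasRow_of_perm 1 hs fun h => ?_
    simp only [Equiv.Perm.coe_one, id_eq, h0, h1, h2] at h ⊢
    exact hasRow_vec_000 h
  · refine hasRow_of_perm (Equiv.swap 0 2) hs fun h => ?_
    simp only [e0, e1, e3, h0, h1, h2] at h ⊢
    exact hasRow_vec_100 h
  · refine hasRow_of_perm (Equiv.swap 0 1) hs fun h => ?_
    simp only [e0, e1, e2, h0, h1, h2] at h ⊢
    exact hasRow_vec_100 h
  · refine hasRow_of_perm (Equiv.swap 0 2) hs fun h => ?_
    simp only [e0, e1, e3, h0, h1, h2] at h ⊢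
    exact hasRow_vec_110 h
  · refine hasRow_of_perm 1 hs fun h => ?_
    simp only [Equiv.Perm.coe_one, id_eq, h0, h1, h2] at h ⊢
    exact hasRow_vec_100 h
  · refine hasRow_of_perm (Equiv.swap 1 2) hs fun h => ?_
    simp only [e0, e1, e4, h0, h1, h2] at h ⊢
    exact hasRow_vec_110 h
  · refine hasRow_of_perm 1 hs fun h => ?_
    simp only [Equiv.Perm.coe_one, id_eq, h0, h1, h2] at h ⊢
    exact hasRow_vec_110 h
  · refine hasRow_of_perm 1 hs fun h => ?_
    simp only [Equiv.Perm.coe_one, id_eq, h0, h1, h2]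
    refine hasRow_of_scaling 0 ![ω 0, ω 1, ω 2, ω 3] trivial one_ne_zero one_ne_zero one_ne_zero
      ?_ ?_ ?_ ?_ ?_ ?_ ?_ <;> simp [table]

/-! ### The lines on a normal form -/

theorem encard_eq_sum_fibers {α β : Type*} [DecidableEq β] (F : α → β) (T : Finset β) (s : Set α)
    (h : ∀ a ∈ s, F a ∈ T) : s.encard = ∑ b ∈ T, (s ∩ F ⁻¹' {b}).encard := by
  induction T using Finset.induction_on generalizing s with
  | empty =>
    have : s = ∅ := Set.eq_empty_of_forall_notMem fun a ha => by simpa using h a ha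
    simp [this]
  | insert b T hb ih =>
    rw [Finset.sum_insert hb, ← Set.encard_sdiff_add_encard_inter s (F ⁻¹' {b}), add_comm]
    congr 1
    rw [ih (s \ F ⁻¹' {b}) fun a ha => (Finset.mem_insert.1 (h a ha.1)).resolve_left ha.2]
    refine Finset.sum_congr rfl fun c hc => ?_
    congr 1
    ext a
    simp only [Set.mem_inter_iff, Set.mem_sdiff, Set.mem_preimage, Set.mem_singleton_iff]
    constructor
    · rintro ⟨⟨h1, -⟩, h2⟩
      exact ⟨h1, h2⟩
    · rintro ⟨h1, h2⟩
      exact ⟨⟨h1, fun h3 => hb (by rw [← h3, h2]; exact hc)⟩, h2⟩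

/-- The line through `p` with direction `v`. -/
def lineThrough (p v : Fin 3 → ℂ) : AffineSubspace ℂ (Fin 3 → ℂ) :=
  AffineSubspace.mk' p (Submodule.span ℂ {v})

theorem mem_lineThrough {p v x : Fin 3 → ℂ} : x ∈ lineThrough p v ↔ ∃ t : ℂ, x = p + t • v := by
  rw [lineThrough, AffineSubspace.mem_mk', Submodule.mem_span_singleton]
  refine exists_congr fun t => ?_
  rw [vsub_eq_sub, eq_sub_iff_add_eq, add_comm, eq_comm]

theorem mem_affineLines_iff {f : AffPoly} {l : AffineSubspace ℂ (Fin 3 → ℂ)} :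
    l ∈ affineLines f ↔ ∃ p v, v ≠ 0 ∧ l = lineThrough p v ∧ ∀ t : ℂ, eval (p + t • v) f = 0 := by
  constructor
  · rintro ⟨h1, h2⟩
    have hne : (l : Set (Fin 3 → ℂ)).Nonempty := by
      rw [AffineSubspace.nonempty_iff_ne_bot]
      rintro rfl
      rw [AffineSubspace.direction_bot, finrank_bot] at h1
      exact zero_ne_one h1
    obtain ⟨p, hp⟩ := hne
    obtain ⟨v, hv0, hv⟩ := finrank_eq_one_iff'.1 h1
    have hspan : l.direction = Submodule.span ℂ {(v : Fin 3 → ℂ)} := by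
      ext x
      rw [Submodule.mem_span_singleton]
      constructor
      · intro hx
        obtain ⟨c, hc⟩ := hv ⟨x, hx⟩
        exact ⟨c, congrArg Subtype.val hc⟩
      · rintro ⟨c, rfl⟩
        exact l.direction.smul_mem c v.2
    have hl : l = lineThrough p v := by
      rw [lineThrough, ← hspan]
      exact (AffineSubspace.mk'_eq hp).symm
    refine ⟨p, v, by simpa using hv0, hl, fun t => ?_⟩
    have hm : p + t • (v : Fin 3 → ℂ) ∈ lineThrough p v := mem_lineThrough.2 ⟨t, rfl⟩
    exact h2 (le_of_eq hl.symm hm)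
  · rintro ⟨p, v, hv, rfl, h⟩
    refine ⟨?_, fun x hx => ?_⟩
    · rw [lineThrough, AffineSubspace.direction_mk']
      exact finrank_span_singleton hv
    · obtain ⟨t, rfl⟩ := mem_lineThrough.1 hx
      exact h t

open Classical in
/-- The coordinates that vanish on the direction of `l`. -/
def zeroPattern (l : AffineSubspace ℂ (Fin 3 → ℂ)) : Finset (Fin 3) :=
  Finset.univ.filter fun i => ∀ v ∈ l.direction, v i = 0

theorem mem_zeroPattern_lineThrough {p v : Fin 3 → ℂ} {i : Fin 3} :
    i ∈ zeroPattern (lineThrough p v) ↔ v i = 0 := by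
  classical
  rw [zeroPattern, Finset.mem_filter, lineThrough, AffineSubspace.direction_mk',
    and_iff_right (Finset.mem_univ _)]
  constructor
  · exact fun h => h v (Submodule.mem_span_singleton_self v)
  · intro h w hw
    obtain ⟨c, rfl⟩ := Submodule.mem_span_singleton.1 hw
    simp [h]

/-- The vector with coordinates `a`, `b` in the places `i`, `j`, and `c` in the third place. -/
def vec (i j : Fin 3) (a b c : ℂ) : Fin 3 → ℂ := fun l => if l = i then a else if l = j then b else c

theorem vec_snd {i j : Fin 3} (hij : i ≠ j) (a b c : ℂ) : vec i j a b c j = b := by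
  simp [vec, hij.symm]

theorem vec_trd {i j k : Fin 3} (hjk : j ≠ k) (hki : k ≠ i) (a b c : ℂ) :
    vec i j a b c k = c := by
  simp [vec, hki, hjk.symm]

theorem vec_fst (i j : Fin 3) (a b c : ℂ) : vec i j a b c i = a := by simp [vec]

theorem eq_or_eq_or_eq {i j k : Fin 3} (hij : i ≠ j) (hjk : j ≠ k) (hki : k ≠ i) (l : Fin 3) :
    l = i ∨ l = j ∨ l = k := by
  revert i j k l; decide

theorem eval_normalForm_of_ne {i j k : Fin 3} (hij : i ≠ j) (hjk : j ≠ k) (hki : k ≠ i)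
    (ε : Fin 3 → ℂ) (ω : Fin 4 → ℂ) (x : Fin 3 → ℂ) :
    eval x (normalForm ε ω) = x i * x j * x k + (ε i * x i ^ 2 + ε j * x j ^ 2 + ε k * x k ^ 2) +
      (ω i.castSucc * x i + ω j.castSucc * x j + ω k.castSucc * x k) + ω 3 := by
  have c0 : (0 : Fin 3).castSucc = (0 : Fin 4) := rfl
  have c1 : (1 : Fin 3).castSucc = (1 : Fin 4) := rfl
  have c2 : (2 : Fin 3).castSucc = (2 : Fin 4) := rfl
  rw [eval_normalForm]
  fin_cases i <;> fin_cases j <;> simp at hij <;> fin_cases k <;> simp at hjk hki <;>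
    simp only [Fin.zero_eta, Fin.mk_one, Fin.reduceFinMk, c0, c1, c2] <;> ring

theorem lineThrough_eq_of_mem {p v q w : Fin 3 → ℂ} {s c : ℂ} (hc : c ≠ 0) (hp : p = q + s • w)
    (hv : v = c • w) : lineThrough p v = lineThrough q w := by
  ext x
  rw [mem_lineThrough, mem_lineThrough]
  constructor
  · rintro ⟨t, rfl⟩
    refine ⟨s + t * c, ?_⟩
    rw [hp, hv, add_smul, mul_smul, add_assoc]
  · rintro ⟨t, rfl⟩
    refine ⟨(t - s) / c, ?_⟩
    rw [hp, hv, smul_smul, div_mul_cancel₀ _ hc, sub_smul]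
    abel

theorem coeffs_eq_zero_of_quadratic {A B C : ℂ} (h : ∀ s : ℂ, A * s ^ 2 + B * s + C = 0) :
    A = 0 ∧ B = 0 ∧ C = 0 := by
  have h0 := h 0
  have h1 := h 1
  have h2 := h (-1)
  refine ⟨?_, ?_, ?_⟩
  · linear_combination (1 / 2 : ℂ) * h1 + (1 / 2 : ℂ) * h2 - h0
  · linear_combination (1 / 2 : ℂ) * h1 - (1 / 2 : ℂ) * h2
  · linear_combination h0

/-- The third difference over -1, 0, 1, 2 is 6A. -/
theorem leading_eq_zero_of_cubic {A B C D : ℂ}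
    (h : ∀ s : ℂ, A * s ^ 3 + B * s ^ 2 + C * s + D = 0) : A = 0 := by
  have h0 := h 0
  have h1 := h 1
  have h2 := h (-1)
  have h3 := h 2
  linear_combination (1 / 6 : ℂ) * h3 - (1 / 2 : ℂ) * h1 - (1 / 6 : ℂ) * h2 + (1 / 2 : ℂ) * h0

/-- Parameters of the lines through a corner at infinity: `(a, b)` stands for the line
`x = a, y = b`. -/
def cornerLines (ei ej ek wi wj wk w4 : ℂ) : Set (ℂ × ℂ) :=
  {q | ek = 0 ∧ q.1 * q.2 + wk = 0 ∧
    ei * q.1 ^ 2 + ej * q.2 ^ 2 + wi * q.1 + wj * q.2 + w4 = 0}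

/-- Parameters of the lines through the other points of a line at infinity: `(c, m, n)` stands for
the line `z = c, y = m x + n`. -/
def sideLines (ei ej ek wi wj wk w4 : ℂ) : Set (ℂ × ℂ × ℂ) :=
  {q | q.2.1 ≠ 0 ∧ q.1 * q.2.1 + ei + ej * q.2.1 ^ 2 = 0 ∧
    q.1 * q.2.2 + 2 * ej * q.2.1 * q.2.2 + wi + wj * q.2.1 = 0 ∧
    ej * q.2.2 ^ 2 + wj * q.2.2 + ek * q.1 ^ 2 + wk * q.1 + w4 = 0}

theorem encard_zeroPattern_pair {i j k : Fin 3} (hij : i ≠ j) (hjk : j ≠ k) (hki : k ≠ i)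
    (ε : Fin 3 → ℂ) (ω : Fin 4 → ℂ) :
    (affineLines (normalForm ε ω) ∩ zeroPattern ⁻¹' {{i, j}}).encard =
      (cornerLines (ε i) (ε j) (ε k) (ω i.castSucc) (ω j.castSucc) (ω k.castSucc) (ω 3)).encard := by
  have himg : affineLines (normalForm ε ω) ∩ zeroPattern ⁻¹' {{i, j}} =
      (fun q : ℂ × ℂ => lineThrough (vec i j q.1 q.2 0) (vec i j 0 0 1)) ''
        cornerLines (ε i) (ε j) (ε k) (ω i.castSucc) (ω j.castSucc) (ω k.castSucc) (ω 3) := by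
    ext l
    constructor
    · rintro ⟨hl, hz⟩
      obtain ⟨p, v, hv, rfl, h⟩ := mem_affineLines_iff.1 hl
      have hz' : zeroPattern (lineThrough p v) = {i, j} := hz
      have vi : v i = 0 := mem_zeroPattern_lineThrough.1 (by rw [hz']; simp)
      have vj : v j = 0 := mem_zeroPattern_lineThrough.1 (by rw [hz']; simp)
      have vk : v k ≠ 0 := fun h0 => by
        have := mem_zeroPattern_lineThrough (p := p).2 h0
        rw [hz'] at this
        simp [hki, hjk.symm] at this
      -- With s = x_k as parameter on the line, the restriction of the cubic has these three
      -- coefficients; their vanishing is the definition of `cornerLines`.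
      have hq := coeffs_eq_zero_of_quadratic (A := ε k)
        (B := p i * p j + ω k.castSucc) (C := ε i * p i ^ 2 + ε j * p j ^ 2 + ω i.castSucc * p i +
          ω j.castSucc * p j + ω 3) fun s => by
        have := h ((s - p k) / v k)
        rw [eval_normalForm_of_ne hij hjk hki] at this
        simp only [Pi.add_apply, Pi.smul_apply, smul_eq_mul, vi, vj, div_mul_cancel₀ _ vk] at this
        linear_combination this
      refine ⟨(p i, p j), ⟨hq.1, hq.2.1, hq.2.2⟩, ?_⟩
      refine (lineThrough_eq_of_mem (s := p k) vk ?_ ?_).symm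
      · funext l
        rcases eq_or_eq_or_eq hij hjk hki l with rfl | rfl | rfl <;>
          simp [vec_fst, vec_snd hij, vec_trd hjk hki]
      · funext l
        rcases eq_or_eq_or_eq hij hjk hki l with rfl | rfl | rfl <;>
          simp [vec_fst, vec_snd hij, vec_trd hjk hki, vi, vj]
    · rintro ⟨⟨a, b⟩, ⟨h1, h2, h3⟩, rfl⟩
      refine ⟨mem_affineLines_iff.2 ⟨_, _, ?_, rfl, fun t => ?_⟩, ?_⟩
      · intro h0
        have := congrFun h0 k
        simp [vec_trd hjk hki] at this
      · rw [eval_normalForm_of_ne hij hjk hki]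
        simp only [Pi.add_apply, Pi.smul_apply, smul_eq_mul, vec_fst, vec_snd hij, vec_trd hjk hki]
        linear_combination t ^ 2 * h1 + t * h2 + h3
      · change zeroPattern _ = _
        ext l
        rw [mem_zeroPattern_lineThrough]
        rcases eq_or_eq_or_eq hij hjk hki l with rfl | rfl | rfl <;>
          simp [vec_fst, vec_snd hij, vec_trd hjk hki, hki, hjk.symm]
  rw [himg]
  refine Function.Injective.encard_image ?_ _
  rintro ⟨a, b⟩ ⟨a', b'⟩ h
  have h1 : vec i j a b 0 ∈ lineThrough (vec i j a b 0) (vec i j 0 0 1) :=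
    mem_lineThrough.2 ⟨0, by simp⟩
  have h' : lineThrough (vec i j a b 0) (vec i j 0 0 1) =
    lineThrough (vec i j a' b' 0) (vec i j 0 0 1) := h
  rw [h'] at h1
  obtain ⟨t, ht⟩ := mem_lineThrough.1 h1
  have e1 := congrFun ht i
  have e2 := congrFun ht j
  simp only [Pi.add_apply, Pi.smul_apply, smul_eq_mul, vec_fst, vec_snd hij, mul_zero,
    add_zero] at e1 e2
  rw [e1, e2]

theorem encard_zeroPattern_singleton {i j k : Fin 3} (hij : i ≠ j) (hjk : j ≠ k) (hki : k ≠ i)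
    (ε : Fin 3 → ℂ) (ω : Fin 4 → ℂ) :
    (affineLines (normalForm ε ω) ∩ zeroPattern ⁻¹' {{k}}).encard =
      (sideLines (ε i) (ε j) (ε k) (ω i.castSucc) (ω j.castSucc) (ω k.castSucc) (ω 3)).encard := by
  have himg : affineLines (normalForm ε ω) ∩ zeroPattern ⁻¹' {{k}} =
      (fun q : ℂ × ℂ × ℂ => lineThrough (vec i j 0 q.2.2 q.1) (vec i j 1 q.2.1 0)) ''
        sideLines (ε i) (ε j) (ε k) (ω i.castSucc) (ω j.castSucc) (ω k.castSucc) (ω 3) := by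
    ext l
    constructor
    · rintro ⟨hl, hz⟩
      obtain ⟨p, v, hv, rfl, h⟩ := mem_affineLines_iff.1 hl
      have hz' : zeroPattern (lineThrough p v) = {k} := hz
      have vk : v k = 0 := mem_zeroPattern_lineThrough.1 (by rw [hz']; simp)
      have vi : v i ≠ 0 := fun h0 => by
        have := mem_zeroPattern_lineThrough (p := p).2 h0
        rw [hz'] at this
        simp [hki.symm] at this
      have vj : v j ≠ 0 := fun h0 => by
        have := mem_zeroPattern_lineThrough (p := p).2 h0
        rw [hz'] at this
        simp [hjk] at this
      set m := v j / v i with hm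
      have hvj : v j = m * v i := by rw [hm, div_mul_cancel₀ _ vi]
      set n := p j - m * p i with hn
      -- With s = x_i as parameter the line is x_j = ms + n, x_k = p_k.
      have hq := coeffs_eq_zero_of_quadratic (A := p k * m + ε i + ε j * m ^ 2)
        (B := p k * n + 2 * ε j * m * n + ω i.castSucc + ω j.castSucc * m)
        (C := ε j * n ^ 2 + ω j.castSucc * n + ε k * p k ^ 2 + ω k.castSucc * p k + ω 3)
        fun s => by
        have := h ((s - p i) / v i)
        rw [eval_normalForm_of_ne hij hjk hki] at this
        have e : p j + (s - p i) / v i * v j = m * s + n := by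
          rw [hvj, hn]
          field_simp
          ring
        simp only [Pi.add_apply, Pi.smul_apply, smul_eq_mul, vk, div_mul_cancel₀ _ vi, e] at this
        linear_combination this
      refine ⟨(p k, m, n), ⟨div_ne_zero vj vi, hq.1, hq.2.1, hq.2.2⟩, ?_⟩
      refine (lineThrough_eq_of_mem (s := p i) vi ?_ ?_).symm
      · funext l
        rcases eq_or_eq_or_eq hij hjk hki l with rfl | rfl | rfl <;>
          simp [vec_fst, vec_snd hij, vec_trd hjk hki]
        rw [hn]
        ring
      · funext l
        rcases eq_or_eq_or_eq hij hjk hki l with rfl | rfl | rfl <;>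
          simp [vec_fst, vec_snd hij, vec_trd hjk hki, vk]
        rw [hvj, mul_comm]
    · rintro ⟨⟨c, m, n⟩, ⟨h0, h1, h2, h3⟩, rfl⟩
      refine ⟨mem_affineLines_iff.2 ⟨_, _, ?_, rfl, fun t => ?_⟩, ?_⟩
      · intro h0
        have := congrFun h0 i
        simp [vec_fst] at this
      · rw [eval_normalForm_of_ne hij hjk hki]
        simp only [Pi.add_apply, Pi.smul_apply, smul_eq_mul, vec_fst, vec_snd hij, vec_trd hjk hki]
        simp only at h1 h2 h3
        linear_combination t ^ 2 * h1 + t * h2 + h3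
      · change zeroPattern _ = _
        simp only at h0
        ext l
        rw [mem_zeroPattern_lineThrough]
        rcases eq_or_eq_or_eq hij hjk hki l with rfl | rfl | rfl <;>
          simp [vec_fst, vec_snd hij, vec_trd hjk hki, hki.symm, hjk, h0]
  rw [himg]
  refine Function.Injective.encard_image ?_ _
  rintro ⟨c, m, n⟩ ⟨c', m', n'⟩ h
  have h' : lineThrough (vec i j 0 n c) (vec i j 1 m 0) =
    lineThrough (vec i j 0 n' c') (vec i j 1 m' 0) := h
  have key : ∀ s : ℂ, m * s + n = m' * s + n' ∧ c = c' := fun s => by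
    have h1 : vec i j 0 n c + s • vec i j 1 m 0 ∈ lineThrough (vec i j 0 n c) (vec i j 1 m 0) :=
      mem_lineThrough.2 ⟨s, rfl⟩
    rw [h'] at h1
    obtain ⟨t, ht⟩ := mem_lineThrough.1 h1
    have e1 := congrFun ht i
    have e2 := congrFun ht j
    have e3 := congrFun ht k
    simp only [Pi.add_apply, Pi.smul_apply, smul_eq_mul, vec_fst, vec_snd hij, vec_trd hjk hki,
      mul_zero, add_zero, mul_one, zero_add] at e1 e2 e3
    subst e1
    exact ⟨by linear_combination e2, e3⟩
  have k0 := key 0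
  have k1 := (key 1).1
  have hn : n = n' := by simpa using k0.1
  have hm : m = m' := by linear_combination k1 - hn
  rw [k0.2, hn, hm]

/-- The lines on a normal form, sorted by the point in which they meet the triangle at infinity. -/
theorem encard_affineLines_normalForm (ε : Fin 3 → ℂ) (ω : Fin 4 → ℂ) :
    (affineLines (normalForm ε ω)).encard =
      (cornerLines (ε 1) (ε 2) (ε 0) (ω 1) (ω 2) (ω 0) (ω 3)).encard +
      (cornerLines (ε 0) (ε 2) (ε 1) (ω 0) (ω 2) (ω 1) (ω 3)).encard +
      (cornerLines (ε 0) (ε 1) (ε 2) (ω 0) (ω 1) (ω 2) (ω 3)).encard +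
      (sideLines (ε 1) (ε 2) (ε 0) (ω 1) (ω 2) (ω 0) (ω 3)).encard +
      (sideLines (ε 0) (ε 2) (ε 1) (ω 0) (ω 2) (ω 1) (ω 3)).encard +
      (sideLines (ε 0) (ε 1) (ε 2) (ω 0) (ω 1) (ω 2) (ω 3)).encard := by
  have hT : ∀ l ∈ affineLines (normalForm ε ω), zeroPattern l ∈
      ({{1, 2}, {0, 2}, {0, 1}, {0}, {1}, {2}} : Finset (Finset (Fin 3))) := by
    intro l hl
    obtain ⟨p, v, hv, rfl, h⟩ := mem_affineLines_iff.1 hl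
    -- The coefficient of t³ in the restriction to the line is v₀v₁v₂, so some coordinate of the
    -- direction vanishes.
    have hne : zeroPattern (lineThrough p v) ≠ ∅ := by
      intro h0
      have hvi : ∀ i, v i ≠ 0 := fun i hi => by
        have := mem_zeroPattern_lineThrough (p := p).2 hi
        rw [h0] at this
        simp at this
      have : v 0 * v 1 * v 2 = 0 := leading_eq_zero_of_cubic
        (B := p 0 * v 1 * v 2 + p 1 * v 0 * v 2 + p 2 * v 0 * v 1 + ε 0 * v 0 ^ 2 + ε 1 * v 1 ^ 2 +
          ε 2 * v 2 ^ 2)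
        (C := v 0 * p 1 * p 2 + v 1 * p 0 * p 2 + v 2 * p 0 * p 1 + 2 * ε 0 * p 0 * v 0 +
          2 * ε 1 * p 1 * v 1 + 2 * ε 2 * p 2 * v 2 + ω 0 * v 0 + ω 1 * v 1 + ω 2 * v 2)
        (D := eval p (normalForm ε ω)) fun s => by
        have := h s
        rw [eval_normalForm] at this ⊢
        simp only [Pi.add_apply, Pi.smul_apply, smul_eq_mul] at this
        linear_combination this
      simp [hvi] at this
    have huniv : zeroPattern (lineThrough p v) ≠ Finset.univ := by
      intro h0
      refine hv (funext fun i => ?_)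
      exact mem_zeroPattern_lineThrough.1 (by rw [h0]; exact Finset.mem_univ i)
    generalize zeroPattern (lineThrough p v) = S at *
    clear hl h
    revert S
    decide
  have h0 := encard_zeroPattern_pair (i := 1) (j := 2) (k := 0) (by decide) (by decide)
    (by decide) ε ω
  have h1 := encard_zeroPattern_pair (i := 0) (j := 2) (k := 1) (by decide) (by decide)
    (by decide) ε ω
  have h2 := encard_zeroPattern_pair (i := 0) (j := 1) (k := 2) (by decide) (by decide)
    (by decide) ε ω
  have g0 := encard_zeroPattern_singleton (i := 1) (j := 2) (k := 0) (by decide) (by decide)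
    (by decide) ε ω
  have g1 := encard_zeroPattern_singleton (i := 0) (j := 2) (k := 1) (by decide) (by decide)
    (by decide) ε ω
  have g2 := encard_zeroPattern_singleton (i := 0) (j := 1) (k := 2) (by decide) (by decide)
    (by decide) ε ω
  have hsum : ∀ φ : Finset (Fin 3) → ℕ∞, ∑ S ∈ ({{1, 2}, {0, 2}, {0, 1}, {0}, {1}, {2}} :
      Finset (Finset (Fin 3))), φ S =
      φ {1, 2} + φ {0, 2} + φ {0, 1} + φ {0} + φ {1} + φ {2} := by
    intro φ
    rw [Finset.sum_insert (by decide), Finset.sum_insert (by decide), Finset.sum_insert (by decide),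
      Finset.sum_insert (by decide), Finset.sum_insert (by decide), Finset.sum_singleton]
    simp only [add_assoc]
  rw [encard_eq_sum_fibers zeroPattern _ _ hT, hsum, h0, h1, h2, g0, g1, g2]
  rfl

/-! ### Counting lines -/

theorem encard_roots {p : Polynomial ℂ} (hp : p ≠ 0)
    (hs : ∀ x, p.eval x = 0 → p.derivative.eval x ≠ 0) :
    {x | p.eval x = 0}.encard = p.natDegree := by
  have hnd : p.roots.Nodup := by
    rw [Multiset.nodup_iff_count_le_one]
    intro x
    rw [Polynomial.count_roots]
    by_contra h
    push Not at h
    have h1 := (Polynomial.one_lt_rootMultiplicity_iff_isRoot hp).1 h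
    exact hs x h1.1 h1.2
  have hset : {x | p.eval x = 0} = (p.roots.toFinset : Set ℂ) := by
    ext x
    simp [hp]
  rw [hset, Set.encard_coe_eq_coe_finsetCard, Multiset.toFinset_card_of_nodup hnd,
    IsAlgClosed.card_roots_eq_natDegree]

theorem encard_quartic_roots {a b c d e : ℂ} (ha : a ≠ 0)
    (hs : ∀ x, a * x ^ 4 + b * x ^ 3 + c * x ^ 2 + d * x + e = 0 →
      4 * a * x ^ 3 + 3 * b * x ^ 2 + 2 * c * x + d ≠ 0) :
    {x : ℂ | a * x ^ 4 + b * x ^ 3 + c * x ^ 2 + d * x + e = 0}.encard = 4 := by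
  set p : Polynomial ℂ := Polynomial.C a * Polynomial.X ^ 4 + Polynomial.C b * Polynomial.X ^ 3 +
    Polynomial.C c * Polynomial.X ^ 2 + Polynomial.C d * Polynomial.X + Polynomial.C e with hp
  have hdeg : p.natDegree = 4 := by rw [hp]; compute_degree!
  have h := encard_roots (p := p) (by rintro h0; rw [h0] at hdeg; simp at hdeg) fun x hx => by
    have := hs x (by simpa [hp] using hx)
    rw [hp]
    simp
    intro h0
    exact this (by linear_combination h0)
  rw [hdeg] at h
  simpa [hp] using h

theorem encard_cubic_roots {a b c d : ℂ} (ha : a ≠ 0)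
    (hs : ∀ x, a * x ^ 3 + b * x ^ 2 + c * x + d = 0 → 3 * a * x ^ 2 + 2 * b * x + c ≠ 0) :
    {x : ℂ | a * x ^ 3 + b * x ^ 2 + c * x + d = 0}.encard = 3 := by
  set p : Polynomial ℂ := Polynomial.C a * Polynomial.X ^ 3 + Polynomial.C b * Polynomial.X ^ 2 +
    Polynomial.C c * Polynomial.X + Polynomial.C d with hp
  have hdeg : p.natDegree = 3 := by rw [hp]; compute_degree!
  have h := encard_roots (p := p) (by rintro h0; rw [h0] at hdeg; simp at hdeg) fun x hx => by
    have := hs x (by simpa [hp] using hx)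
    rw [hp]
    simp
    intro h0
    exact this (by linear_combination h0)
  rw [hdeg] at h
  simpa [hp] using h

theorem encard_quadratic_roots {a b c : ℂ} (ha : a ≠ 0)
    (hs : ∀ x, a * x ^ 2 + b * x + c = 0 → 2 * a * x + b ≠ 0) :
    {x : ℂ | a * x ^ 2 + b * x + c = 0}.encard = 2 := by
  set p : Polynomial ℂ := Polynomial.C a * Polynomial.X ^ 2 + Polynomial.C b * Polynomial.X +
    Polynomial.C c with hp
  have hdeg : p.natDegree = 2 := by rw [hp]; compute_degree!
  have h := encard_roots (p := p) (by rintro h0; rw [h0] at hdeg; simp at hdeg) fun x hx => by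
    have := hs x (by simpa [hp] using hx)
    rw [hp]
    simp
    intro h0
    exact this (by linear_combination h0)
  rw [hdeg] at h
  simpa [hp] using h

theorem encard_linear_roots {a b : ℂ} (ha : a ≠ 0) : {x : ℂ | a * x + b = 0}.encard = 1 := by
  have : {x : ℂ | a * x + b = 0} = {-b / a} := by
    ext x
    simp only [Set.mem_ofPred_eq, Set.mem_singleton_iff]
    rw [eq_div_iff ha]
    constructor <;> intro h <;> linear_combination h
  rw [this, Set.encard_singleton]

theorem NoSingularPoint.swap {e₁ e₂ e₃ w₁ w₂ w₃ w₄ : ℂ}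
    (h : NoSingularPoint e₁ e₂ e₃ w₁ w₂ w₃ w₄) : NoSingularPoint e₁ e₃ e₂ w₁ w₃ w₂ w₄ :=
  fun x y z h0 h1 h2 h3 => h x z y (by linear_combination h0) (by linear_combination h1)
    (by linear_combination h3) (by linear_combination h2)

theorem NoSingularPoint.rotate {e₁ e₂ e₃ w₁ w₂ w₃ w₄ : ℂ}
    (h : NoSingularPoint e₁ e₂ e₃ w₁ w₂ w₃ w₄) : NoSingularPoint e₂ e₃ e₁ w₂ w₃ w₁ w₄ :=
  fun x y z h0 h1 h2 h3 => h z x y (by linear_combination h0) (by linear_combination h3)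
    (by linear_combination h1) (by linear_combination h2)

/-! ### Lines through a corner -/

theorem encard_cornerLines_of_ne {ei ej ek wi wj wk w4 : ℂ} (hk : ek ≠ 0) :
    (cornerLines ei ej ek wi wj wk w4).encard = 0 := by
  rw [Set.encard_eq_zero]
  exact Set.eq_empty_of_forall_notMem fun q hq => hk hq.1

/-- The nonzero roots of a polynomial of degree at most four. -/
def nonzeroRoots (a b c d e : ℂ) : Set ℂ :=
  {x | x ≠ 0 ∧ a * x ^ 4 + b * x ^ 3 + c * x ^ 2 + d * x + e = 0}

/-- The nonzero roots of a polynomial of degree at most four are simple. -/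
def SimpleRoots (a b c d e : ℂ) : Prop :=
  ∀ x, x ≠ 0 → a * x ^ 4 + b * x ^ 3 + c * x ^ 2 + d * x + e = 0 →
    4 * a * x ^ 3 + 3 * b * x ^ 2 + 2 * c * x + d ≠ 0

/-- Here ab = -w_k ≠ 0, so b can be eliminated; the quartic is the second equation times a². -/
theorem encard_cornerLines_A1 {ei ej wi wj wk w4 : ℂ} (hk : wk ≠ 0) :
    (cornerLines ei ej 0 wi wj wk w4).encard =
      (nonzeroRoots ei wi w4 (-(wj * wk)) (ej * wk ^ 2)).encard := by
  have himg : cornerLines ei ej 0 wi wj wk w4 = (fun a : ℂ => (a, -wk / a)) ''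
      {a : ℂ | a ≠ 0 ∧ ei * a ^ 4 + wi * a ^ 3 + w4 * a ^ 2 + -(wj * wk) * a + ej * wk ^ 2 = 0} := by
    ext ⟨a, b⟩
    constructor
    · rintro ⟨-, h1, h2⟩
      simp only at h1 h2
      have ha : a ≠ 0 := by
        rintro rfl
        exact hk (by simpa using h1)
      have hb : b = -wk / a := by
        field_simp
        linear_combination h1
      refine ⟨a, ⟨ha, ?_⟩, by rw [hb]⟩
      rw [hb] at h2
      field_simp at h2
      linear_combination h2
    · rintro ⟨a', ⟨ha, h⟩, he⟩
      obtain ⟨rfl, rfl⟩ := Prod.mk.inj he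
      refine ⟨rfl, ?_, ?_⟩
      · field_simp
        ring
      · field_simp
        linear_combination h
  rw [himg]
  exact Function.Injective.encard_image (fun a b h => (Prod.mk.inj h).1) _

/-- Along the line x = a, y = -w_k/a the derivative ∂/∂z vanishes. The point of it where ∂/∂y
vanishes too is singular as soon as a is a multiple root, since ∂/∂x there is governed by the
derivative of the quartic. -/
theorem NoSingularPoint.simple_cornerLines_A1 {ei ej wi wj wk w4 : ℂ}
    (hs : NoSingularPoint ei ej 0 wi wj wk w4) :
    SimpleRoots ei wi w4 (-(wj * wk)) (ej * wk ^ 2) := by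
  intro a ha h h'
  refine hs a (-wk / a) (-(2 * ej * (-wk / a) + wj) / a) ?_ ?_ ?_ ?_
  · field_simp
    linear_combination a ^ 2 * h
  · field_simp
    linear_combination a * h' - 2 * h
  · field_simp
    ring
  · field_simp
    ring

/-- Now ab = 0, so there is one family with b = 0 and one with a = 0. They are disjoint because (0,
0) is excluded by w₄ ≠ 0. -/
theorem encard_cornerLines_A2 {ei ej wi wj w4 : ℂ} (h4 : w4 ≠ 0) :
    (cornerLines ei ej 0 wi wj 0 w4).encard =
      (nonzeroRoots 0 0 ei wi w4).encard + (nonzeroRoots 0 0 ej wj w4).encard := by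
  have hroots : ∀ b c : ℂ, nonzeroRoots 0 0 b c w4 = {x : ℂ | b * x ^ 2 + c * x + w4 = 0} := by
    intro b c
    ext x
    refine ⟨fun h => ?_, fun h => ⟨?_, ?_⟩⟩
    · have := h.2
      simpa using this
    · rintro rfl
      exact h4 (by simpa using h)
    · simpa using h
  rw [hroots, hroots]
  have hun : cornerLines ei ej 0 wi wj 0 w4 =
      (fun a : ℂ => (a, (0 : ℂ))) '' {a : ℂ | ei * a ^ 2 + wi * a + w4 = 0} ∪
      (fun b : ℂ => ((0 : ℂ), b)) '' {b : ℂ | ej * b ^ 2 + wj * b + w4 = 0} := by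
    ext ⟨a, b⟩
    constructor
    · rintro ⟨-, h1, h2⟩
      simp only [add_zero, mul_eq_zero] at h1
      simp only at h2
      rcases h1 with rfl | rfl
      · exact Or.inr ⟨b, by simpa using h2, rfl⟩
      · exact Or.inl ⟨a, by simpa using h2, rfl⟩
    · rintro (⟨a', h, he⟩ | ⟨b', h, he⟩)
      · obtain ⟨rfl, rfl⟩ := Prod.mk.inj he
        exact ⟨rfl, by simp, by simpa using h⟩
      · obtain ⟨rfl, rfl⟩ := Prod.mk.inj he
        exact ⟨rfl, by simp, by simpa using h⟩
  rw [hun, Set.encard_union_eq, Function.Injective.encard_image fun a b h => (Prod.mk.inj h).1,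
    Function.Injective.encard_image fun a b h => (Prod.mk.inj h).2]
  rw [Set.disjoint_left]
  rintro _ ⟨a, ha, rfl⟩ ⟨b, hb, he⟩
  obtain ⟨rfl, rfl⟩ := Prod.mk.inj he
  exact h4 (by simpa using ha)

theorem NoSingularPoint.simple_cornerLines_A2 {ei ej wi wj w4 : ℂ}
    (hs : NoSingularPoint ei ej 0 wi wj 0 w4) : SimpleRoots 0 0 ei wi w4 := by
  intro a ha h h'
  refine hs a 0 (-wj / a) ?_ ?_ ?_ ?_
  · linear_combination h
  · linear_combination h'
  · field_simp
    ring
  · ring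

/-! ### Lines meeting a side of the triangle away from the corners, when one of its ends is singular
-/

theorem encard_sideLines_zero {ek wk w4 wi wj : ℂ} (h : wi * wj ≠ 0) :
    (sideLines 0 0 ek wi wj wk w4).encard = 1 := by
  have hi : wi ≠ 0 := left_ne_zero_of_mul h
  have hj : wj ≠ 0 := right_ne_zero_of_mul h
  have : sideLines 0 0 ek wi wj wk w4 = {(0, -wi / wj, -w4 / wj)} := by
    ext ⟨c, m, n⟩
    constructor
    · rintro ⟨h0, h1, h2, h3⟩
      simp only at h0 h1 h2 h3
      have hc : c = 0 := by simpa [h0] using h1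
      subst hc
      have hm : m = -wi / wj := by
        field_simp
        linear_combination h2
      have hn : n = -w4 / wj := by
        field_simp
        linear_combination h3
      rw [hm, hn]
      rfl
    · intro he
      obtain ⟨rfl, he'⟩ := Prod.mk.inj he
      obtain ⟨rfl, rfl⟩ := Prod.mk.inj he'
      refine ⟨div_ne_zero (neg_ne_zero.2 hi) hj, by simp, ?_, ?_⟩
      · simp
        field_simp
        ring
      · simp
        field_simp
        ring
  rw [this, Set.encard_singleton]

theorem encard_sideLines_zero_of_mul_eq_zero {ek wk w4 wi wj : ℂ} (h : wi * wj = 0)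
    (hne : wi + wj ≠ 0 ∨ w4 ≠ 0) : (sideLines 0 0 ek wi wj wk w4).encard = 0 := by
  rw [Set.encard_eq_zero]
  refine Set.eq_empty_of_forall_notMem ?_
  rintro ⟨c, m, n⟩ ⟨h0, h1, h2, h3⟩
  simp only at h0 h1 h2 h3
  have hc : c = 0 := by simpa [h0] using h1
  subst hc
  have h2' : wi + wj * m = 0 := by linear_combination h2
  have hwj : wj = 0 := by
    have : wj ^ 2 * m = 0 := by linear_combination wj * h2' - h
    simpa [h0] using this
  subst hwj
  have hwi : wi = 0 := by simpa using h2'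
  subst hwi
  rcases hne with h | h
  · simp at h
  · exact h (by simpa using h3)

/-- With e_j = 0 the first two equations force c = -1/m and n = m(w_i + w_j m). The quartic is the
third equation times m². -/
theorem encard_sideLines_one_zero {ek wi wj wk w4 : ℂ} :
    (sideLines 1 0 ek wi wj wk w4).encard =
      (nonzeroRoots (wj ^ 2) (wi * wj) w4 (-wk) ek).encard := by
  have himg : sideLines 1 0 ek wi wj wk w4 =
      (fun m : ℂ => (-1 / m, m, m * (wi + wj * m))) '' {m : ℂ | m ≠ 0 ∧ wj ^ 2 * m ^ 4 +
        wi * wj * m ^ 3 + w4 * m ^ 2 + -wk * m + ek = 0} := by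
    ext ⟨c, m, n⟩
    constructor
    · rintro ⟨h0, h1, h2, h3⟩
      simp only at h0 h1 h2 h3
      have hc : c = -1 / m := by
        field_simp
        linear_combination h1
      have hn : n = m * (wi + wj * m) := by
        rw [hc] at h2
        field_simp at h2
        linear_combination (-1 : ℂ) * h2
      refine ⟨m, ⟨h0, ?_⟩, by rw [hc, hn]⟩
      rw [hc, hn] at h3
      field_simp at h3
      linear_combination h3
    · rintro ⟨m', ⟨hm, h⟩, he⟩
      obtain ⟨rfl, he'⟩ := Prod.mk.inj he
      obtain ⟨rfl, rfl⟩ := Prod.mk.inj he'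
      refine ⟨hm, ?_, ?_, ?_⟩
      · simp
        field_simp
        ring
      · simp
        field_simp
        ring
      · simp
        field_simp
        linear_combination h
  rw [himg]
  exact Function.Injective.encard_image
    (fun a b h => (Prod.mk.inj (Prod.mk.inj h).2).1) _

/-- The exhibited point is the one on the line with x = w_j m, where ∂/∂x and ∂/∂y vanish. At a
multiple root ∂/∂z vanishes as well. -/
theorem NoSingularPoint.simple_sideLines_one_zero {ek wi wj wk w4 : ℂ}
    (hs : NoSingularPoint 1 0 ek wi wj wk w4) :
    SimpleRoots (wj ^ 2) (wi * wj) w4 (-wk) ek := by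
  intro m hm h h'
  refine hs (wj * m) (m * (2 * wj * m + wi)) (-1 / m) ?_ ?_ ?_ ?_
  · field_simp
    linear_combination h
  · field_simp
    ring
  · field_simp
    ring
  · field_simp
    linear_combination m * h' - 2 * h

/-! ### Degenerate conics in the planes z = c -/

/-- The discriminant of the conics that the planes `z = c` cut out. -/
def planeDisc (ek wi wj wk w4 c : ℂ) : ℂ :=
  (4 - c ^ 2) * (ek * c ^ 2 + wk * c + w4) + c * wi * wj - wi ^ 2 - wj ^ 2

/-- The expression is the derivative of the discriminant in c. If it vanishes at a root, then for c²
≠ 4 the node of the conic is a singular point of the surface. For c² = 4 the section is a double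
line and contains a singular point. -/
theorem NoSingularPoint.simple_planeDisc {ek wi wj wk w4 : ℂ}
    (hs : NoSingularPoint 1 1 ek wi wj wk w4) {c : ℂ} (h : planeDisc ek wi wj wk w4 c = 0) :
    -2 * c * (ek * c ^ 2 + wk * c + w4) + (4 - c ^ 2) * (2 * ek * c + wk) + wi * wj ≠ 0 := by
  intro h'
  rw [planeDisc] at h
  by_cases hc : c ^ 2 = 4
  · obtain ⟨σ, rfl⟩ : ∃ σ, c = 2 * σ := ⟨c / 2, by ring⟩
    have hσ : σ ^ 2 = 1 := by linear_combination (1 / 4 : ℂ) * hc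
    have ha : wi = σ * wj := by
      have : (wi - σ * wj) ^ 2 = 0 := by
        linear_combination (-1 : ℂ) * h + (wj ^ 2 - 4 * (ek * (2 * σ) ^ 2 + wk * (2 * σ) + w4)) * hσ
      exact sub_eq_zero.1 (pow_eq_zero_iff two_ne_zero |>.1 this)
    subst ha
    have hσ0 : σ ≠ 0 := by rintro rfl; norm_num at hσ
    have hb : wj ^ 2 = 4 * (ek * (2 * σ) ^ 2 + wk * (2 * σ) + w4) := by
      refine mul_left_cancel₀ hσ0 ?_
      linear_combination h' + (4 * (2 * ek * (2 * σ) + wk)) * hσ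
    obtain ⟨x, hx⟩ := exists_quadratic_root (σ * wj / 2) (-σ * (4 * ek * σ + wk))
    refine hs x (-σ * x - wj / 2) (2 * σ) ?_ ?_ ?_ ?_
    · linear_combination (-1 / 4 : ℂ) * hb - (x ^ 2) * hσ
    · linear_combination (-2 * x) * hσ
    · ring
    · linear_combination (-σ) * hx + (wj * x / 2 - (4 * ek * σ + wk)) * hσ
  · have hc' : 4 - c ^ 2 ≠ 0 := fun h0 => hc (by linear_combination -h0)
    refine hs ((c * wj - 2 * wi) / (4 - c ^ 2)) ((c * wi - 2 * wj) / (4 - c ^ 2)) c ?_ ?_ ?_ ?_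
    · field_simp
      linear_combination (4 - c ^ 2) * h
    · field_simp
      ring
    · field_simp
      ring
    · field_simp
      linear_combination (4 - c ^ 2) * h' + 2 * c * h

/-- A degenerate conic x² + cxy + y² + ... is a pair of lines. For c² ≠ 4 they have different
slopes. For c² = 4 they are parallel, and distinct because the root c is simple. -/
theorem encard_sideLines_fiber {ek wi wj wk w4 : ℂ} {c : ℂ}
    (h : planeDisc ek wi wj wk w4 c = 0)
    (h' : -2 * c * (ek * c ^ 2 + wk * c + w4) + (4 - c ^ 2) * (2 * ek * c + wk) + wi * wj ≠ 0) :
    (sideLines 1 1 ek wi wj wk w4 ∩ Prod.fst ⁻¹' {c}).encard = 2 := by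
  rw [planeDisc] at h
  by_cases hc : c ^ 2 = 4
  · obtain ⟨σ, rfl⟩ : ∃ σ, c = 2 * σ := ⟨c / 2, by ring⟩
    have hσ : σ ^ 2 = 1 := by linear_combination (1 / 4 : ℂ) * hc
    have ha : wi = σ * wj := by
      have : (wi - σ * wj) ^ 2 = 0 := by
        linear_combination (-1 : ℂ) * h + (wj ^ 2 - 4 * (ek * (2 * σ) ^ 2 + wk * (2 * σ) + w4)) * hσ
      exact sub_eq_zero.1 (pow_eq_zero_iff two_ne_zero |>.1 this)
    subst ha
    have hσ0 : σ ≠ 0 := by rintro rfl; norm_num at hσ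
    -- Discriminant of the quadratic equation for n; the two parallel lines have n = (-w_j ± s)/2.
    obtain ⟨s, hs⟩ := IsAlgClosed.exists_pow_nat_eq
      (wj ^ 2 - 4 * (ek * (2 * σ) ^ 2 + wk * (2 * σ) + w4)) two_pos
    have hs0 : s ≠ 0 := by
      rintro rfl
      apply h'
      linear_combination (-σ) * hs - (4 * (2 * ek * (2 * σ) + wk)) * hσ
    have : sideLines 1 1 ek (σ * wj) wj wk w4 ∩ Prod.fst ⁻¹' {2 * σ} =
        {(2 * σ, -σ, (-wj + s) / 2), (2 * σ, -σ, (-wj - s) / 2)} := by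
      ext ⟨c, m, n⟩
      constructor
      · rintro ⟨⟨h0, h1, h2, h3⟩, rfl⟩
        simp only at h0 h1 h2 h3
        have hm : m = -σ := by
          have : (m + σ) ^ 2 = 0 := by linear_combination h1 + hσ
          linear_combination pow_eq_zero_iff two_ne_zero |>.1 this
        subst hm
        have : (2 * n + wj - s) * (2 * n + wj + s) = 0 := by linear_combination 4 * h3 - hs
        rcases mul_eq_zero.1 this with h4 | h4
        · left
          rw [show n = (-wj + s) / 2 by linear_combination (1 / 2 : ℂ) * h4]
        · right
          rw [show n = (-wj - s) / 2 by linear_combination (1 / 2 : ℂ) * h4]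
          rfl
      · rintro (he | he)
        all_goals
          obtain ⟨rfl, he'⟩ := Prod.mk.inj he
          obtain ⟨rfl, rfl⟩ := Prod.mk.inj he'
          refine ⟨⟨neg_ne_zero.2 hσ0, ?_, ?_, ?_⟩, rfl⟩
          · simp only
            linear_combination (-1 : ℂ) * hσ
          · simp only
            ring
          · simp only
            linear_combination (1 / 4 : ℂ) * hs
    rw [this]
    refine Set.encard_pair fun he => ?_
    have := (Prod.mk.inj (Prod.mk.inj he).2).2
    exact hs0 (by linear_combination this)
  -- The slopes are the roots (-c ± s)/2 of m² + cm + 1 = 0, and each slope determines n.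
  · obtain ⟨s, hs⟩ := IsAlgClosed.exists_pow_nat_eq (c ^ 2 - 4) two_pos
    have hs0 : s ≠ 0 := by
      rintro rfl
      exact hc (by linear_combination -hs)
    have hq : (ek * c ^ 2 + wk * c + w4) * s ^ 2 = c * wi * wj - wi ^ 2 - wj ^ 2 := by
      rw [hs]
      linear_combination (-1 : ℂ) * h
    have key : ∀ t : ℂ, t ^ 2 = c ^ 2 - 4 → t ≠ 0 → ∀ m n : ℂ, m = (-c + t) / 2 →
        ((m ≠ 0 ∧ c * m + 1 + 1 * m ^ 2 = 0 ∧ c * n + 2 * 1 * m * n + wi + wj * m = 0 ∧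
          1 * n ^ 2 + wj * n + ek * c ^ 2 + wk * c + w4 = 0) ↔ n = -(wi + wj * m) / t) := by
      intro t ht ht0 m n hm
      have hct : c = t - 2 * m := by linear_combination (2 : ℂ) * hm
      have hm1 : c * m + 1 + 1 * m ^ 2 = 0 := by
        rw [hm]
        linear_combination (1 / 4 : ℂ) * ht
      constructor
      · rintro ⟨-, -, h2, -⟩
        field_simp
        rw [hct] at h2
        linear_combination h2
      · intro hn
        have hn' : n * t = -(wi + wj * m) := by rw [hn, div_mul_cancel₀ _ ht0]
        refine ⟨?_, hm1, ?_, ?_⟩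
        · rintro rfl
          norm_num at hm1
        · linear_combination hn' + n * hct
        · have hq' : (ek * c ^ 2 + wk * c + w4) * t ^ 2 = c * wi * wj - wi ^ 2 - wj ^ 2 := by
            rw [ht, ← hs]
            exact hq
          refine mul_left_cancel₀ (pow_ne_zero 2 ht0) ?_
          linear_combination (n * t - (wi + wj * m) + wj * t) * hn' + hq' - wj ^ 2 * hm1 +
            (wi * wj + wj ^ 2 * m) * hct
    have hset : sideLines 1 1 ek wi wj wk w4 ∩ Prod.fst ⁻¹' {c} =
        {(c, (-c + s) / 2, -(wi + wj * ((-c + s) / 2)) / s),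
          (c, (-c + -s) / 2, -(wi + wj * ((-c + -s) / 2)) / -s)} := by
      have hs' : (-s) ^ 2 = c ^ 2 - 4 := by rw [neg_sq, hs]
      ext ⟨c', m, n⟩
      constructor
      · rintro ⟨hmem, rfl⟩
        have h1 : c' * m + 1 + 1 * m ^ 2 = 0 := hmem.2.1
        have : (2 * m + c' - s) * (2 * m + c' + s) = 0 := by
          linear_combination 4 * h1 - hs
        rcases mul_eq_zero.1 this with h4 | h4
        · left
          have hm : m = (-c' + s) / 2 := by linear_combination (1 / 2 : ℂ) * h4
          rw [(key s hs hs0 m n hm).1 hmem, hm]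
        · right
          have hm : m = (-c' + -s) / 2 := by linear_combination (1 / 2 : ℂ) * h4
          rw [(key (-s) hs' (neg_ne_zero.2 hs0) m n hm).1 hmem, hm]
          rfl
      · rintro (he | he)
        · obtain ⟨rfl, he'⟩ := Prod.mk.inj he
          obtain ⟨rfl, rfl⟩ := Prod.mk.inj he'
          exact ⟨(key s hs hs0 _ _ rfl).2 rfl, rfl⟩
        · obtain ⟨rfl, he'⟩ := Prod.mk.inj he
          obtain ⟨rfl, rfl⟩ := Prod.mk.inj he'
          exact ⟨(key (-s) hs' (neg_ne_zero.2 hs0) _ _ rfl).2 rfl, rfl⟩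
    rw [hset]
    refine Set.encard_pair fun he => ?_
    have := (Prod.mk.inj (Prod.mk.inj he).2).1
    exact hs0 (by linear_combination this)

theorem planeDisc_eq_zero_of_mem {ek wi wj wk w4 : ℂ} {q : ℂ × ℂ × ℂ}
    (hq : q ∈ sideLines 1 1 ek wi wj wk w4) : planeDisc ek wi wj wk w4 q.1 = 0 := by
  obtain ⟨c, m, n⟩ := q
  obtain ⟨h0, h1, h2, h3⟩ := hq
  simp only at h0 h1 h2 h3
  rw [planeDisc]
  have hq : ek * c ^ 2 + wk * c + w4 = -(n ^ 2 + wj * n) := by linear_combination h3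
  have hw : wi = -(c * n + 2 * m * n + wj * m) := by linear_combination h2
  rw [hq, hw]
  linear_combination (-(4 * n ^ 2 + 4 * n * wj + wj ^ 2)) * h1

theorem encard_sideLines_one_one {ek wi wj wk w4 : ℂ} (hs : NoSingularPoint 1 1 ek wi wj wk w4)
    (hfin : {c | planeDisc ek wi wj wk w4 c = 0}.Finite) :
    (sideLines 1 1 ek wi wj wk w4).encard =
      2 * {c | planeDisc ek wi wj wk w4 c = 0}.encard := by
  rw [encard_eq_sum_fibers Prod.fst hfin.toFinset _ fun q hq =>
    hfin.mem_toFinset.2 (planeDisc_eq_zero_of_mem hq)]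
  rw [Finset.sum_congr rfl fun c hc => encard_sideLines_fiber (hfin.mem_toFinset.1 hc)
    (hs.simple_planeDisc (hfin.mem_toFinset.1 hc)), Finset.sum_const, hfin.encard_eq_coe_toFinset_card,
    nsmul_eq_mul, mul_comm]

/-! ### Root counts from degrees -/

theorem nonzeroRoots_shift (a b c d : ℂ) : nonzeroRoots a b c d 0 = nonzeroRoots 0 a b c d := by
  ext x
  refine and_congr_right fun hx => ⟨fun h => ?_, fun h => ?_⟩
  · refine mul_left_cancel₀ hx ?_
    linear_combination h
  · linear_combination x * h

theorem SimpleRoots.shift {a b c d : ℂ} (h : SimpleRoots a b c d 0) : SimpleRoots 0 a b c d := by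
  intro x hx h0 h1
  exact h x hx (by linear_combination x * h0) (by linear_combination x * h1 + h0)

theorem nonzeroRoots_of_ne {a b c d e : ℂ} (he : e ≠ 0) :
    nonzeroRoots a b c d e = {x | a * x ^ 4 + b * x ^ 3 + c * x ^ 2 + d * x + e = 0} := by
  ext x
  refine ⟨fun h => h.2, fun h => ⟨?_, h⟩⟩
  rintro rfl
  exact he (by simpa using h)

theorem SimpleRoots.of_ne {a b c d e : ℂ} (h : SimpleRoots a b c d e) (he : e ≠ 0) (x : ℂ)
    (hx : a * x ^ 4 + b * x ^ 3 + c * x ^ 2 + d * x + e = 0) :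
    4 * a * x ^ 3 + 3 * b * x ^ 2 + 2 * c * x + d ≠ 0 := by
  refine h x ?_ hx
  rintro rfl
  exact he (by simpa using hx)

theorem encard_nonzeroRoots_four {a b c d e : ℂ} (h : SimpleRoots a b c d e) (ha : a ≠ 0)
    (he : e ≠ 0) : (nonzeroRoots a b c d e).encard = 4 := by
  rw [nonzeroRoots_of_ne he]
  exact encard_quartic_roots ha (h.of_ne he)

theorem encard_nonzeroRoots_three {b c d e : ℂ} (h : SimpleRoots 0 b c d e) (hb : b ≠ 0)
    (he : e ≠ 0) : (nonzeroRoots 0 b c d e).encard = 3 := by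
  rw [nonzeroRoots_of_ne he]
  simpa using encard_cubic_roots hb fun x hx => by
    simpa using h.of_ne he x (by simpa using hx)

theorem encard_nonzeroRoots_two {c d e : ℂ} (h : SimpleRoots 0 0 c d e) (hc : c ≠ 0)
    (he : e ≠ 0) : (nonzeroRoots 0 0 c d e).encard = 2 := by
  rw [nonzeroRoots_of_ne he]
  simpa using encard_quadratic_roots hc fun x hx => by
    simpa using h.of_ne he x (by simpa using hx)

theorem encard_nonzeroRoots_one {d e : ℂ} (hd : d ≠ 0) (he : e ≠ 0) :
    (nonzeroRoots 0 0 0 d e).encard = 1 := by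
  rw [nonzeroRoots_of_ne he]
  simpa using encard_linear_roots (b := e) hd

theorem encard_nonzeroRoots_zero {e : ℂ} (he : e ≠ 0) : (nonzeroRoots 0 0 0 0 e).encard = 0 := by
  rw [nonzeroRoots_of_ne he, Set.encard_eq_zero, Set.eq_empty_iff_forall_notMem]
  intro x hx
  exact he (by simpa using hx.out)

/-- As ab = 0 and there is no constant term, (0, 0) is always a solution. It is shared by both axes
and counted once; the other solutions on each axis satisfy a linear equation. -/
theorem encard_cornerLines_A3 {ei ej wi wj : ℂ} :
    (cornerLines ei ej 0 wi wj 0 0).encard =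
      1 + (nonzeroRoots 0 0 0 ei wi).encard + (nonzeroRoots 0 0 0 ej wj).encard := by
  have hun : cornerLines ei ej 0 wi wj 0 0 = ({(0, 0)} ∪
      (fun a : ℂ => (a, (0 : ℂ))) '' nonzeroRoots 0 0 0 ei wi) ∪
      (fun b : ℂ => ((0 : ℂ), b)) '' nonzeroRoots 0 0 0 ej wj := by
    ext ⟨a, b⟩
    constructor
    · rintro ⟨-, h1, h2⟩
      simp only [add_zero, mul_eq_zero] at h1
      simp only at h2
      by_cases ha : a = 0
      · by_cases hb : b = 0
        · exact Or.inl (Or.inl (by simp [ha, hb]))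
        · refine Or.inr ⟨b, ⟨hb, mul_left_cancel₀ hb ?_⟩, by simp [ha]⟩
          rw [ha] at h2
          linear_combination h2
      · obtain rfl := h1.resolve_left ha
        refine Or.inl (Or.inr ⟨a, ⟨ha, mul_left_cancel₀ ha ?_⟩, rfl⟩)
        linear_combination h2
    · rintro ((he | ⟨a', h, he⟩) | ⟨b', h, he⟩)
      · obtain ⟨rfl, rfl⟩ := Prod.mk.inj he
        exact ⟨rfl, by simp, by simp⟩
      · obtain ⟨rfl, rfl⟩ := Prod.mk.inj he
        refine ⟨rfl, by simp, ?_⟩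
        simp only
        linear_combination a' * h.2
      · obtain ⟨rfl, rfl⟩ := Prod.mk.inj he
        refine ⟨rfl, by simp, ?_⟩
        simp only
        linear_combination b' * h.2
  rw [hun, Set.encard_union_eq, Set.encard_union_eq, Set.encard_singleton,
    Function.Injective.encard_image fun a b h => (Prod.mk.inj h).1,
    Function.Injective.encard_image fun a b h => (Prod.mk.inj h).2]
  · rw [Set.disjoint_singleton_left]
    rintro ⟨a, ha, he⟩
    exact ha.1 (Prod.mk.inj he).1
  · rw [Set.disjoint_left]
    rintro q h ⟨b, hb, rfl⟩
    rcases h with h | ⟨a, ha, he⟩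
    · exact hb.1 (Prod.mk.inj h).2
    · exact ha.1 (Prod.mk.inj he).1

/-- The quartic is the expanded discriminant. Its degree drops to 3, 2, 1, 0 as e_k, w_k, w₄ and w_i
w_j vanish one after another, provided the constant term left at the end is nonzero. -/
theorem encard_sideLines_one_one_of_quartic {ek wi wj wk w4 : ℂ}
    (hs : NoSingularPoint 1 1 ek wi wj wk w4) {N : ℕ}
    (h : {c : ℂ | -ek * c ^ 4 + -wk * c ^ 3 + (4 * ek - w4) * c ^ 2 + (4 * wk + wi * wj) * c +
      (4 * w4 - wi ^ 2 - wj ^ 2) = 0}.encard = N) :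
    (sideLines 1 1 ek wi wj wk w4).encard = 2 * N := by
  have hset : {c | planeDisc ek wi wj wk w4 c = 0} = {c : ℂ | -ek * c ^ 4 + -wk * c ^ 3 +
      (4 * ek - w4) * c ^ 2 + (4 * wk + wi * wj) * c + (4 * w4 - wi ^ 2 - wj ^ 2) = 0} := by
    ext c
    simp only [Set.mem_ofPred_eq, planeDisc]
    rw [← sub_eq_zero (a := _ + _), sub_zero]
    constructor <;> intro h <;> linear_combination h
  rw [encard_sideLines_one_one hs, hset, h]
  rw [hset]
  exact Set.finite_of_encard_eq_coe h

theorem NoSingularPoint.simple_planeDisc_quartic {ek wi wj wk w4 : ℂ}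
    (hs : NoSingularPoint 1 1 ek wi wj wk w4) (c : ℂ)
    (h : -ek * c ^ 4 + -wk * c ^ 3 + (4 * ek - w4) * c ^ 2 + (4 * wk + wi * wj) * c +
      (4 * w4 - wi ^ 2 - wj ^ 2) = 0) :
    4 * -ek * c ^ 3 + 3 * -wk * c ^ 2 + 2 * (4 * ek - w4) * c + (4 * wk + wi * wj) ≠ 0 := by
  intro h'
  refine hs.simple_planeDisc (c := c) ?_ ?_
  · rw [planeDisc]
    linear_combination h
  · linear_combination h'

theorem encard_sideLines_one_one_eight {ek wi wj wk w4 : ℂ}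
    (hs : NoSingularPoint 1 1 ek wi wj wk w4) (hk : ek ≠ 0) :
    (sideLines 1 1 ek wi wj wk w4).encard = 8 := by
  have := encard_sideLines_one_one_of_quartic hs (N := 4)
    (encard_quartic_roots (neg_ne_zero.2 hk) hs.simple_planeDisc_quartic)
  rw [this]
  norm_num

theorem encard_sideLines_one_one_six {wi wj wk w4 : ℂ}
    (hs : NoSingularPoint 1 1 0 wi wj wk w4) (hk : wk ≠ 0) :
    (sideLines 1 1 0 wi wj wk w4).encard = 6 := by
  have := encard_sideLines_one_one_of_quartic hs (N := 3) (by
    have := encard_cubic_roots (b := -w4) (c := 4 * wk + wi * wj)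
      (d := 4 * w4 - wi ^ 2 - wj ^ 2) (neg_ne_zero.2 hk) fun c hc => by
      simpa using hs.simple_planeDisc_quartic c (by simpa using hc)
    simpa using this)
  rw [this]
  norm_num

theorem encard_sideLines_one_one_four {wi wj w4 : ℂ}
    (hs : NoSingularPoint 1 1 0 wi wj 0 w4) (h4 : w4 ≠ 0) :
    (sideLines 1 1 0 wi wj 0 w4).encard = 4 := by
  have := encard_sideLines_one_one_of_quartic hs (N := 2) (by
    have := encard_quadratic_roots (b := wi * wj) (c := 4 * w4 - wi ^ 2 - wj ^ 2)
      (neg_ne_zero.2 h4) fun c hc => by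
      simpa using hs.simple_planeDisc_quartic c (by simpa using hc)
    simpa using this)
  rw [this]
  norm_num

theorem encard_sideLines_one_one_two {wi wj : ℂ}
    (hs : NoSingularPoint 1 1 0 wi wj 0 0) (h : wi * wj ≠ 0) :
    (sideLines 1 1 0 wi wj 0 0).encard = 2 := by
  have := encard_sideLines_one_one_of_quartic hs (N := 1) (by
    have := encard_linear_roots (b := -wi ^ 2 - wj ^ 2) h
    simpa using this)
  rw [this]
  norm_num

theorem encard_sideLines_one_one_zero {wi wj : ℂ}
    (hs : NoSingularPoint 1 1 0 wi wj 0 0) (h : wi * wj = 0) (h' : wi ^ 2 + wj ^ 2 ≠ 0) :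
    (sideLines 1 1 0 wi wj 0 0).encard = 0 := by
  have := encard_sideLines_one_one_of_quartic hs (N := 0) (by
    rw [Nat.cast_zero, Set.encard_eq_zero, Set.eq_empty_iff_forall_notMem]
    intro c hc
    apply h'
    have hc' := hc.out
    linear_combination -hc' + c * h)
  rw [this]
  norm_num

/-! ### The number of lines, row by row -/

theorem encard_affineLines_vec (e₁ e₂ e₃ w₁ w₂ w₃ w₄ : ℂ) :
    (affineLines (normalForm ![e₁, e₂, e₃] ![w₁, w₂, w₃, w₄])).encard =
      (cornerLines e₂ e₃ e₁ w₂ w₃ w₁ w₄).encard + (cornerLines e₁ e₃ e₂ w₁ w₃ w₂ w₄).encard +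
      (cornerLines e₁ e₂ e₃ w₁ w₂ w₃ w₄).encard + (sideLines e₂ e₃ e₁ w₂ w₃ w₁ w₄).encard +
      (sideLines e₁ e₃ e₂ w₁ w₃ w₂ w₄).encard + (sideLines e₁ e₂ e₃ w₁ w₂ w₃ w₄).encard :=
  encard_affineLines_normalForm _ _


theorem NoSingularPoint.encard_111 {a b c d : ℂ} (hs : NoSingularPoint 1 1 1 a b c d) :
    (affineLines (normalForm ![1, 1, 1] ![a, b, c, d])).encard = 24 := by
  rw [encard_affineLines_vec, encard_cornerLines_of_ne one_ne_zero,
    encard_cornerLines_of_ne one_ne_zero, encard_cornerLines_of_ne one_ne_zero,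
    encard_sideLines_one_one_eight hs.rotate one_ne_zero,
    encard_sideLines_one_one_eight hs.swap one_ne_zero,
    encard_sideLines_one_one_eight hs one_ne_zero]
  norm_num

/-- 18 = 4 + (4 + 4 + 6): the lines through the singular corner, then those meeting the three sides
elsewhere. -/
theorem NoSingularPoint.encard_A1 {a b c d : ℂ} (hs : NoSingularPoint 1 1 0 a b c d)
    (hc : c ≠ 0) : (affineLines (normalForm ![1, 1, 0] ![a, b, c, d])).encard = 18 := by
  rw [encard_affineLines_vec, encard_cornerLines_of_ne one_ne_zero,
    encard_cornerLines_of_ne one_ne_zero, encard_cornerLines_A1 hc,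
    encard_nonzeroRoots_four hs.simple_cornerLines_A1 one_ne_zero (by simpa using hc),
    encard_sideLines_one_zero, encard_sideLines_one_zero,
    encard_nonzeroRoots_four hs.rotate.simple_sideLines_one_zero (by simpa using hc) one_ne_zero,
    encard_nonzeroRoots_four hs.swap.simple_sideLines_one_zero (by simpa using hc) one_ne_zero,
    encard_sideLines_one_one_six hs hc]
  norm_num

theorem NoSingularPoint.encard_A2 {a b d : ℂ} (hs : NoSingularPoint 1 1 0 a b 0 d)
    (hd : d ≠ 0) : (affineLines (normalForm ![1, 1, 0] ![a, b, 0, d])).encard = 12 := by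
  have h1 := hs.rotate.simple_sideLines_one_zero
  have h2 := hs.swap.simple_sideLines_one_zero
  simp only [ne_eq, OfNat.ofNat_ne_zero, not_false_eq_true, zero_pow, mul_zero] at h1 h2
  rw [encard_affineLines_vec, encard_cornerLines_of_ne one_ne_zero,
    encard_cornerLines_of_ne one_ne_zero, encard_cornerLines_A2 hd,
    encard_nonzeroRoots_two hs.simple_cornerLines_A2 one_ne_zero hd,
    encard_nonzeroRoots_two hs.rotate.swap.simple_cornerLines_A2 one_ne_zero hd,
    encard_sideLines_one_zero, encard_sideLines_one_zero]
  simp only [ne_eq, OfNat.ofNat_ne_zero, not_false_eq_true, zero_pow, mul_zero]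
  rw [encard_nonzeroRoots_two h1 hd one_ne_zero, encard_nonzeroRoots_two h2 hd one_ne_zero,
    encard_sideLines_one_one_four hs hd]
  norm_num

theorem NoSingularPoint.encard_A3 {a b : ℂ} (hs : NoSingularPoint 1 1 0 a b 0 0)
    (ha : a ≠ 0) (hb : b ≠ 0) :
    (affineLines (normalForm ![1, 1, 0] ![a, b, 0, 0])).encard = 7 := by
  rw [encard_affineLines_vec, encard_cornerLines_of_ne one_ne_zero,
    encard_cornerLines_of_ne one_ne_zero, encard_cornerLines_A3,
    encard_nonzeroRoots_one one_ne_zero ha, encard_nonzeroRoots_one one_ne_zero hb,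
    encard_sideLines_one_zero, encard_sideLines_one_zero]
  simp only [ne_eq, OfNat.ofNat_ne_zero, not_false_eq_true, zero_pow, mul_zero]
  rw [encard_nonzeroRoots_one (neg_ne_zero.2 ha) one_ne_zero,
    encard_nonzeroRoots_one (neg_ne_zero.2 hb) one_ne_zero,
    encard_sideLines_one_one_two hs (mul_ne_zero ha hb)]
  norm_num

theorem NoSingularPoint.encard_A4 {b : ℂ} (hs : NoSingularPoint 1 1 0 0 b 0 0) (hb : b ≠ 0) :
    (affineLines (normalForm ![1, 1, 0] ![0, b, 0, 0])).encard = 3 := by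
  rw [encard_affineLines_vec, encard_cornerLines_of_ne one_ne_zero,
    encard_cornerLines_of_ne one_ne_zero, encard_cornerLines_A3, nonzeroRoots_shift,
    encard_nonzeroRoots_zero one_ne_zero, encard_nonzeroRoots_one one_ne_zero hb,
    encard_sideLines_one_zero, encard_sideLines_one_zero]
  simp only [ne_eq, OfNat.ofNat_ne_zero, not_false_eq_true, zero_pow, mul_zero, neg_zero]
  rw [encard_nonzeroRoots_zero one_ne_zero, encard_nonzeroRoots_one (neg_ne_zero.2 hb) one_ne_zero,
    encard_sideLines_one_one_zero hs (zero_mul b) (by simpa using hb)]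
  norm_num

/-- 13 = (3 + 3) + (1 + 3 + 3): two singular corners, then the three sides. The quartics have one
zero end coefficient, hence three nonzero roots. -/
theorem NoSingularPoint.encard_A1_A1 {a b c d : ℂ} (hs : NoSingularPoint 1 0 0 a b c d)
    (hb : b ≠ 0) (hc : c ≠ 0) :
    (affineLines (normalForm ![1, 0, 0] ![a, b, c, d])).encard = 13 := by
  have h1 := hs.swap.simple_cornerLines_A1
  have h2 := hs.simple_cornerLines_A1
  have h3 := hs.swap.simple_sideLines_one_zero
  have h4 := hs.simple_sideLines_one_zero
  simp only [zero_mul] at h1 h2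
  rw [encard_affineLines_vec, encard_cornerLines_of_ne one_ne_zero,
    encard_cornerLines_A1 hb, encard_cornerLines_A1 hc, encard_sideLines_one_zero,
    encard_sideLines_one_zero, encard_sideLines_zero (mul_ne_zero hb hc)]
  simp only [zero_mul]
  rw [nonzeroRoots_shift, nonzeroRoots_shift, nonzeroRoots_shift, nonzeroRoots_shift,
    encard_nonzeroRoots_three h1.shift one_ne_zero (neg_ne_zero.2 (mul_ne_zero hc hb)),
    encard_nonzeroRoots_three h2.shift one_ne_zero (neg_ne_zero.2 (mul_ne_zero hb hc)),
    encard_nonzeroRoots_three h3.shift (pow_ne_zero 2 hc) (neg_ne_zero.2 hb),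
    encard_nonzeroRoots_three h4.shift (pow_ne_zero 2 hb) (neg_ne_zero.2 hc)]
  norm_num

theorem NoSingularPoint.encard_A1_A1_A1 {a b c d : ℂ} (hs : NoSingularPoint 0 0 0 a b c d)
    (ha : a ≠ 0) (hb : b ≠ 0) (hc : c ≠ 0) :
    (affineLines (normalForm ![0, 0, 0] ![a, b, c, d])).encard = 9 := by
  have h1 := hs.rotate.simple_cornerLines_A1
  have h2 := hs.swap.simple_cornerLines_A1
  have h3 := hs.simple_cornerLines_A1
  simp only [zero_mul] at h1 h2 h3
  rw [encard_affineLines_vec, encard_cornerLines_A1 ha, encard_cornerLines_A1 hb,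
    encard_cornerLines_A1 hc, encard_sideLines_zero (mul_ne_zero hb hc),
    encard_sideLines_zero (mul_ne_zero ha hc), encard_sideLines_zero (mul_ne_zero ha hb)]
  simp only [zero_mul]
  rw [nonzeroRoots_shift, nonzeroRoots_shift, nonzeroRoots_shift,
    encard_nonzeroRoots_two h1.shift hb (neg_ne_zero.2 (mul_ne_zero hc ha)),
    encard_nonzeroRoots_two h2.shift ha (neg_ne_zero.2 (mul_ne_zero hc hb)),
    encard_nonzeroRoots_two h3.shift ha (neg_ne_zero.2 (mul_ne_zero hb hc))]
  norm_num

theorem NoSingularPoint.encard_A1_A2 {a b d : ℂ} (hs : NoSingularPoint 1 0 0 a b 0 d)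
    (hb : b ≠ 0) (hd : d ≠ 0) :
    (affineLines (normalForm ![1, 0, 0] ![a, b, 0, d])).encard = 8 := by
  have h1 := hs.swap.simple_cornerLines_A1
  have h4 := hs.simple_sideLines_one_zero
  simp only [zero_mul, neg_zero] at h1 h4
  rw [encard_affineLines_vec, encard_cornerLines_of_ne one_ne_zero,
    encard_cornerLines_A1 hb, encard_cornerLines_A2 hd, encard_sideLines_one_zero,
    encard_sideLines_one_zero, encard_sideLines_zero_of_mul_eq_zero (mul_zero b) (Or.inr hd)]
  simp only [zero_mul, mul_zero, neg_zero, zero_pow two_ne_zero]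
  simp only [nonzeroRoots_shift]
  rw [encard_nonzeroRoots_two h1.shift.shift one_ne_zero hd,
    encard_nonzeroRoots_one hb hd, encard_nonzeroRoots_one hd (neg_ne_zero.2 hb),
    encard_nonzeroRoots_two h4.shift.shift (pow_ne_zero 2 hb) hd]
  norm_num

theorem encard_affineLines_A1_A1_A2 {a b d : ℂ} (ha : a ≠ 0) (hb : b ≠ 0) (hd : d ≠ 0) :
    (affineLines (normalForm ![0, 0, 0] ![a, b, 0, d])).encard = 5 := by
  rw [encard_affineLines_vec, encard_cornerLines_A1 ha, encard_cornerLines_A1 hb,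
    encard_cornerLines_A2 hd, encard_sideLines_zero_of_mul_eq_zero (mul_zero b) (Or.inr hd),
    encard_sideLines_zero_of_mul_eq_zero (mul_zero a) (Or.inr hd),
    encard_sideLines_zero (mul_ne_zero ha hb)]
  simp only [zero_mul, neg_zero, nonzeroRoots_shift]
  rw [encard_nonzeroRoots_one hb hd, encard_nonzeroRoots_one ha hd]
  norm_num

theorem NoSingularPoint.encard_A2_A2 {a d : ℂ} (hs : NoSingularPoint 1 0 0 a 0 0 d)
    (hd : d ≠ 0) : (affineLines (normalForm ![1, 0, 0] ![a, 0, 0, d])).encard = 4 := by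
  rw [encard_affineLines_vec, encard_cornerLines_of_ne one_ne_zero,
    encard_cornerLines_A2 hd, encard_sideLines_one_zero,
    encard_sideLines_zero_of_mul_eq_zero (mul_zero 0) (Or.inr hd)]
  simp only [mul_zero, neg_zero, zero_pow two_ne_zero, nonzeroRoots_shift]
  rw [encard_nonzeroRoots_two hs.simple_cornerLines_A2 one_ne_zero hd, encard_nonzeroRoots_zero hd]
  norm_num

theorem encard_affineLines_A1_A3 {a b : ℂ} (ha : a ≠ 0) (hb : b ≠ 0) :
    (affineLines (normalForm ![1, 0, 0] ![a, b, 0, 0])).encard = 4 := by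
  rw [encard_affineLines_vec, encard_cornerLines_of_ne one_ne_zero,
    encard_cornerLines_A1 hb, encard_cornerLines_A3, encard_sideLines_one_zero,
    encard_sideLines_one_zero, encard_sideLines_zero_of_mul_eq_zero (mul_zero b) (by simp [hb])]
  simp only [zero_mul, mul_zero, neg_zero, zero_pow two_ne_zero, nonzeroRoots_shift]
  rw [encard_nonzeroRoots_one one_ne_zero ha, encard_nonzeroRoots_zero hb,
    encard_nonzeroRoots_zero (neg_ne_zero.2 hb),
    encard_nonzeroRoots_one (pow_ne_zero 2 hb) (mul_ne_zero ha hb)]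
  norm_num

theorem encard_affineLines_A1_A1_A3 {a b : ℂ} (ha : a ≠ 0) (hb : b ≠ 0) :
    (affineLines (normalForm ![0, 0, 0] ![a, b, 0, 0])).encard = 2 := by
  rw [encard_affineLines_vec, encard_cornerLines_A1 ha, encard_cornerLines_A1 hb,
    encard_cornerLines_A3, encard_sideLines_zero_of_mul_eq_zero (mul_zero b) (by simp [hb]),
    encard_sideLines_zero_of_mul_eq_zero (mul_zero a) (by simp [ha]),
    encard_sideLines_zero (mul_ne_zero ha hb)]
  simp only [zero_mul, neg_zero, nonzeroRoots_shift]
  rw [encard_nonzeroRoots_zero ha, encard_nonzeroRoots_zero hb]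
  norm_num

theorem encard_affineLines_A1_A2_A2 {a d : ℂ} (ha : a ≠ 0) (hd : d ≠ 0) :
    (affineLines (normalForm ![0, 0, 0] ![a, 0, 0, d])).encard = 2 := by
  rw [encard_affineLines_vec, encard_cornerLines_A1 ha, encard_cornerLines_A2 hd, encard_sideLines_zero_of_mul_eq_zero (mul_zero 0) (Or.inr hd),
    encard_sideLines_zero_of_mul_eq_zero (mul_zero a) (Or.inr hd)]
  simp only [zero_mul, neg_zero, nonzeroRoots_shift]
  rw [encard_nonzeroRoots_one ha hd, encard_nonzeroRoots_zero hd]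
  norm_num

theorem encard_affineLines_A1_A4 {b : ℂ} (hb : b ≠ 0) :
    (affineLines (normalForm ![1, 0, 0] ![0, b, 0, 0])).encard = 1 := by
  rw [encard_affineLines_vec, encard_cornerLines_of_ne one_ne_zero,
    encard_cornerLines_A1 hb, encard_cornerLines_A3, encard_sideLines_one_zero,
    encard_sideLines_one_zero, encard_sideLines_zero_of_mul_eq_zero (mul_zero b) (by simp [hb])]
  simp only [zero_mul, mul_zero, neg_zero, zero_pow two_ne_zero, nonzeroRoots_shift]
  rw [encard_nonzeroRoots_zero one_ne_zero, encard_nonzeroRoots_zero hb,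
    encard_nonzeroRoots_zero (neg_ne_zero.2 hb), encard_nonzeroRoots_zero (pow_ne_zero 2 hb)]
  norm_num

theorem encard_affineLines_A2_A2_A2 {d : ℂ} (hd : d ≠ 0) :
    (affineLines (normalForm ![0, 0, 0] ![0, 0, 0, d])).encard = 0 := by
  rw [encard_affineLines_vec, encard_cornerLines_A2 hd,
    encard_sideLines_zero_of_mul_eq_zero (mul_zero 0) (Or.inr hd), encard_nonzeroRoots_zero hd]
  norm_num

theorem encard_affineLines_tableCubic {r : Fin 15} {w : Fin 4 → ℂ} (h : goodParams r w)
    (hs : IsSmoothAffine (tableCubic r w)) :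
    (affineLines (tableCubic r w)).encard = ((table r).lines : ℕ∞) := by
  have hs' := (isSmoothAffine_iff_noSingularPoint _ _).1 hs
  have h1 : (-1 : ℂ) ≠ 0 := neg_ne_zero.2 one_ne_zero
  fin_cases r
  · have h := NoSingularPoint.encard_111 hs'
    have hw : ![w 0, w 1, w 2, w 3] = w := by
      ext i
      fin_cases i <;> rfl
    exact (congrArg (fun v => (affineLines (normalForm ![1, 1, 1] v)).encard) hw).symm.trans h
  · exact NoSingularPoint.encard_A1 hs' h.1
  · exact NoSingularPoint.encard_A2 hs' h
  · exact NoSingularPoint.encard_A3 hs' h h1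
  · exact NoSingularPoint.encard_A4 hs' h1
  · exact NoSingularPoint.encard_A1_A1 hs' h h
  · exact NoSingularPoint.encard_A1_A1_A1 hs' h1 h h1
  · exact NoSingularPoint.encard_A1_A2 hs' h1 one_ne_zero
  · exact encard_affineLines_A1_A1_A2 h1 h1 one_ne_zero
  · exact NoSingularPoint.encard_A2_A2 hs' one_ne_zero
  · exact encard_affineLines_A1_A3 h1 h1
  · exact encard_affineLines_A1_A1_A3 h1 h1
  · exact encard_affineLines_A1_A2_A2 h1 one_ne_zero
  · exact encard_affineLines_A1_A4 h1
  · exact encard_affineLines_A2_A2_A2 one_ne_zero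

/-! ### Generic parameters -/

theorem eval_aeval {σ τ : Type*} (ψ : σ → MvPolynomial τ ℂ) (x : τ → ℂ) (p : MvPolynomial σ ℂ) :
    eval x (aeval ψ p) = eval (fun i => eval x (ψ i)) p := by
  induction p using MvPolynomial.induction_on with
  | C a => simp
  | add p q hp hq => rw [map_add, map_add, map_add, hp, hq]
  | mul_X p i hp => rw [map_mul, map_mul, map_mul, hp, aeval_X, eval_X]

/-- The n + 1 polynomials H, ψ₁, …, ψ_n in n variables are algebraically dependent. If the relation
is not divisible by the variable standing for H, setting H = 0 leaves a nonzero relation among the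
ψ_i on the hypersurface. -/
theorem exists_ne_zero_eval_eq_zero {n : ℕ} {H : MvPolynomial (Fin n) ℂ} (hH : H ≠ 0)
    (ψ : Fin n → MvPolynomial (Fin n) ℂ) :
    ∃ D : MvPolynomial (Fin n) ℂ, D ≠ 0 ∧
      ∀ x, eval x H = 0 → eval (fun i => eval x (ψ i)) D = 0 := by
  let Φ : Polynomial (MvPolynomial (Fin n) ℂ) →+* MvPolynomial (Fin n) ℂ :=
    Polynomial.eval₂RingHom (aeval ψ).toRingHom H
  have hker : ∃ q : Polynomial (MvPolynomial (Fin n) ℂ), q ≠ 0 ∧ Φ q = 0 := by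
    by_contra hno
    push Not at hno
    have hind : AlgebraicIndependent ℂ (fun o : Option (Fin n) => o.elim H ψ) := by
      rw [algebraicIndependent_iff]
      intro Q hQ
      by_contra hQ0
      refine hno (optionEquivLeft ℂ (Fin n) Q) (by simpa using hQ0) ?_
      have : ∀ Q, Φ (optionEquivLeft ℂ (Fin n) Q) =
          aeval (fun o : Option (Fin n) => o.elim H ψ) Q := by
        intro Q
        induction Q using MvPolynomial.induction_on with
        | C a => simp [Φ, optionEquivLeft_C]
        | add p q hp hq => rw [map_add, map_add, map_add, hp, hq]
        | mul_X p o hp =>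
          rw [map_mul, map_mul, map_mul, hp]
          rcases o with _ | i
          · simp [Φ, optionEquivLeft_X_none]
          · simp [Φ, optionEquivLeft_X_some]
      rw [this, hQ]
    have hc := hind.lift_cardinalMk_le_trdeg
    rw [MvPolynomial.trdeg_of_isDomain] at hc
    simp at hc
  obtain ⟨q, hq0, hq⟩ := hker
  -- Removing the full power of the variable standing for H keeps a relation, since H ≠ 0 in a
  -- domain, and makes its constant term nonzero.
  obtain ⟨q', hqq, hnd⟩ := Polynomial.exists_eq_pow_rootMultiplicity_mul_and_not_dvd q hq0 0
  rw [map_zero, sub_zero] at hqq hnd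
  have hq' : Φ q' = 0 := by
    rw [hqq, map_mul, map_pow] at hq
    have hX : Φ Polynomial.X = H := Polynomial.eval₂_X _ _
    rw [hX] at hq
    exact (mul_eq_zero.1 hq).resolve_left (pow_ne_zero _ hH)
  refine ⟨q'.coeff 0, fun h => hnd (Polynomial.X_dvd_iff.2 h), fun x hx => ?_⟩
  obtain ⟨g, hg⟩ : ∃ g, q' = Polynomial.X * g + Polynomial.C (q'.coeff 0) :=
    ⟨q'.divX, (Polynomial.X_mul_divX_add q').symm⟩
  have h0 : Φ q' = H * Φ g + aeval ψ (q'.coeff 0) := by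
    conv_lhs => rw [hg]
    simp [Φ]
  rw [hq'] at h0
  have := congrArg (eval x) h0
  rw [map_zero, map_add, map_mul, hx, zero_mul, zero_add] at this
  rw [← eval_aeval, ← this]

/-- Outside the zero set of a nonzero polynomial, the listed cubic is smooth. -/
def GenericallySmooth (r : Fin 15) : Prop :=
  ∃ D : MvPolynomial (Fin 4) ℂ, D ≠ 0 ∧
    ∀ w, eval w D ≠ 0 → goodParams r w ∧ IsSmoothAffine (tableCubic r w)

theorem ne_zero_of_eval {σ : Type*} {p : MvPolynomial σ ℂ} (x : σ → ℂ) (h : eval x p ≠ 0) :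
    p ≠ 0 := by
  rintro rfl
  exact h (map_zero _)

theorem eq_vec_four (w : Fin 4 → ℂ) : ![w 0, w 1, w 2, w 3] = w := by
  ext i
  fin_cases i <;> rfl

/-- A singular point (x, y, z) determines all of ω polynomially. A dummy fourth variable, set to 0,
makes source and target both four-dimensional. -/
theorem genericallySmooth_zero : GenericallySmooth 0 := by
  obtain ⟨D, hD, h⟩ := exists_ne_zero_eval_eq_zero (X_ne_zero (R := ℂ) (3 : Fin 4))
    ![-(X 1 * X 2 + 2 * X 0), -(X 0 * X 2 + 2 * X 1), -(X 0 * X 1 + 2 * X 2),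
      2 * X 0 * X 1 * X 2 + X 0 ^ 2 + X 1 ^ 2 + X 2 ^ 2]
  refine ⟨D, hD, fun w hw => ⟨trivial, ?_⟩⟩
  refine (isSmoothAffine_iff_noSingularPoint _ _).2 ?_
  change NoSingularPoint 1 1 1 (w 0) (w 1) (w 2) (w 3)
  intro x y z h0 h1 h2 h3
  apply hw
  rw [← h ![x, y, z, 0] (by simp), ← eq_vec_four w]
  congr 2
  ext i
  fin_cases i
  · simp
    linear_combination h1
  · simp
    linear_combination h2
  · simp
    linear_combination h3
  · simp
    linear_combination h0 - x * h1 - y * h2 - z * h3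

theorem genericallySmooth_one : GenericallySmooth 1 := by
  let a : MvPolynomial (Fin 4) ℂ := -(X 1 * X 2 + 2 * X 0)
  let b : MvPolynomial (Fin 4) ℂ := -(X 0 * X 2 + 2 * X 1)
  let c : MvPolynomial (Fin 4) ℂ := -(X 0 * X 1)
  let t : MvPolynomial (Fin 4) ℂ := 2 * X 0 * X 1 * X 2 + X 0 ^ 2 + X 1 ^ 2
  -- A singular point determines ω₁, ω₂, ω₃ as a, b, c and ω₄ as t. This is ω₄ = R with denominators
  -- cleared; the fourth variable is a free dummy.
  have hH : (c ^ 2 - 1) ^ 2 * (1 + c ^ 2 - t) - c * (b + a * c) * (a + b * c) ≠ 0 :=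
    ne_zero_of_eval 0 (by simp [a, b, c, t])
  obtain ⟨D, hD, h⟩ := exists_ne_zero_eval_eq_zero hH ![a, b, c, X 3]
  refine ⟨D * (X 2 * (X 2 ^ 2 - 1)), mul_ne_zero hD
    (ne_zero_of_eval (fun _ => 2) (by simp; norm_num)), fun w hw => ?_⟩
  rw [map_mul, map_mul, map_sub, map_pow, map_one, eval_X] at hw
  have hw1 := left_ne_zero_of_mul hw
  have hw2 := left_ne_zero_of_mul (right_ne_zero_of_mul hw)
  have hw3 := right_ne_zero_of_mul (right_ne_zero_of_mul hw)
  refine ⟨⟨hw2, sub_ne_zero.1 hw3⟩, ?_⟩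
  refine (isSmoothAffine_iff_noSingularPoint _ _).2 ?_
  change NoSingularPoint 1 1 0 (w 0) (w 1) (w 2) (R (w 0) (w 1) (w 2))
  intro x y z h0 h1 h2 h3
  have h4 : R (w 0) (w 1) (w 2) = 2 * x * y * z + x ^ 2 + y ^ 2 := by
    linear_combination h0 - x * h1 - y * h2 - z * h3
  have ha : -(y * z + 2 * x) = w 0 := by linear_combination -h1
  have hb : -(x * z + 2 * y) = w 1 := by linear_combination -h2
  have hc : -(x * y) = w 2 := by linear_combination -h3
  apply hw1
  rw [← h ![x, y, z, w 3] ?_, ← eq_vec_four w]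
  · congr 2
    ext i
    fin_cases i
    · simpa [a] using ha.symm
    · simpa [b] using hb.symm
    · simpa [c] using hc.symm
    · simp
  · rw [R] at h4
    field_simp at h4
    have ea : eval ![x, y, z, w 3] a = w 0 := by simpa [a] using ha
    have eb : eval ![x, y, z, w 3] b = w 1 := by simpa [b] using hb
    have ec : eval ![x, y, z, w 3] c = w 2 := by simpa [c] using hc
    have et : eval ![x, y, z, w 3] t = 2 * x * y * z + x ^ 2 + y ^ 2 := by simp [t]
    clear_value a b c t
    simp only [map_sub, map_mul, map_pow, map_one, map_add, ea, eb, ec, et]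
    linear_combination h4

theorem genericallySmooth_five : GenericallySmooth 5 := by
  -- A singular point has y = z, because ω₂ = ω₃ ≠ 0. Inserting ω₁ = -(z² + 2x) and ω₂ = -xz into
  -- the equation of the surface and dividing by -x leaves this polynomial in x, z.
  have hH : (X 0 * (1 - X 1) ^ 2 + 2 * X 1 ^ 2 + X 1 - X 1 ^ 3 : MvPolynomial (Fin 4) ℂ) ≠ 0 :=
    ne_zero_of_eval ![1, 0, 0, 0] (by simp)
  obtain ⟨D, hD, h⟩ := exists_ne_zero_eval_eq_zero hH
    ![-(X 1 ^ 2 + 2 * X 0), -(X 0 * X 1), X 2, X 3]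
  refine ⟨D * X 1, mul_ne_zero hD (X_ne_zero _), fun w hw => ?_⟩
  rw [map_mul, eval_X] at hw
  have hw1 := left_ne_zero_of_mul hw
  have hw2 := right_ne_zero_of_mul hw
  refine ⟨hw2, ?_⟩
  refine (isSmoothAffine_iff_noSingularPoint _ _).2 ?_
  change NoSingularPoint 1 0 0 (w 0) (w 1) (w 1) (w 1 * (1 + w 0 - w 1))
  intro x y z h0 h1 h2 h3
  have hx : x ≠ 0 := by
    rintro rfl
    exact hw2 (by linear_combination h2)
  have hz : z = y := mul_left_cancel₀ hx (by linear_combination h2 - h3)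
  subst hz
  have ha : -(z ^ 2 + 2 * x) = w 0 := by linear_combination -h1
  have hb : -(x * z) = w 1 := by linear_combination -h2
  apply hw1
  rw [← h ![x, z, w 2, w 3] ?_, ← eq_vec_four w]
  · congr 2
    ext i
    fin_cases i
    · simpa using ha.symm
    · simpa using hb.symm
    · simp
    · simp
  · rw [← ha, ← hb] at h0
    simp
    refine mul_left_cancel₀ hx ?_
    linear_combination -h0

theorem genericallySmooth_two : GenericallySmooth 2 := by
  -- A singular point has xy = 0, and its nonzero coordinate solves y² + ω₂y + ω₁ - 1 = 0 or x² +
  -- ω₁x + ω₁ - 1 = 0 as a double root. The first two factors exclude this, and the last one keeps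
  -- ω₄ ≠ 0.
  refine ⟨(X 1 ^ 2 - 4 * X 0 + 4) * (X 0 - 2) * (X 0 - 1),
    ne_zero_of_eval ![0, 0, 0, 0] (by simp), fun w hw => ?_⟩
  simp at hw
  obtain ⟨⟨hw1, hw2⟩, hw3⟩ := hw
  refine ⟨hw3, (isSmoothAffine_iff_noSingularPoint _ _).2 ?_⟩
  change NoSingularPoint 1 1 0 (w 0) (w 1) 0 (w 0 - 1)
  intro x y z h0 h1 h2 h3
  grind

theorem genericallySmooth_three : GenericallySmooth 3 := by
  refine ⟨X 0, X_ne_zero _, fun w hw => ?_⟩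
  rw [eval_X] at hw
  refine ⟨hw, (isSmoothAffine_iff_noSingularPoint _ _).2 ?_⟩
  change NoSingularPoint 1 1 0 (w 0) (-1) 0 0
  intro x y z h0 h1 h2 h3
  grind

theorem genericallySmooth_six : GenericallySmooth 6 := by
  -- For ω₂ = -1 the point (1, 1, 1) is singular; this is the only singular case with ω₂ ≠ 0.
  refine ⟨X 1 * (X 1 + 1), ne_zero_of_eval 1 (by simp), fun w hw => ?_⟩
  simp at hw
  obtain ⟨hw1, hw2⟩ := hw
  refine ⟨hw1, (isSmoothAffine_iff_noSingularPoint _ _).2 ?_⟩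
  change NoSingularPoint 0 0 0 (-1) (w 1) (-1) (-w 1 + 1)
  intro x y z h0 h1 h2 h3
  grind

theorem genericallySmooth_seven : GenericallySmooth 7 := by
  -- A singular point lies at y = 0 and a double root of x² + ω₁x + 1.
  refine ⟨X 0 ^ 2 - 4, ne_zero_of_eval ![0, 0, 0, 0] (by simp), fun w hw => ?_⟩
  simp at hw
  refine ⟨trivial, (isSmoothAffine_iff_noSingularPoint _ _).2 ?_⟩
  change NoSingularPoint 1 0 0 (w 0) (-1) 0 1
  intro x y z h0 h1 h2 h3
  grind

theorem genericallySmooth_nine : GenericallySmooth 9 := by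
  refine ⟨X 0 ^ 2 - 4, ne_zero_of_eval ![0, 0, 0, 0] (by simp), fun w hw => ?_⟩
  simp at hw
  refine ⟨trivial, (isSmoothAffine_iff_noSingularPoint _ _).2 ?_⟩
  change NoSingularPoint 1 0 0 (w 0) 0 0 1
  intro x y z h0 h1 h2 h3
  grind

theorem GenericallySmooth.of_forall {r : Fin 15} (hg : ∀ w, goodParams r w)
    (h : ∀ w, NoSingularPoint ((table r).eps 0) ((table r).eps 1) ((table r).eps 2)
      ((table r).coeff w 0) ((table r).coeff w 1) ((table r).coeff w 2) ((table r).coeff w 3)) :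
    GenericallySmooth r :=
  ⟨1, one_ne_zero, fun w _ => ⟨hg w, (isSmoothAffine_iff_noSingularPoint _ _).2 (h w)⟩⟩

theorem genericallySmooth (r : Fin 15) : GenericallySmooth r := by
  fin_cases r
  · exact genericallySmooth_zero
  · exact genericallySmooth_one
  · exact genericallySmooth_two
  · exact genericallySmooth_three
  · refine .of_forall (fun _ => trivial) fun w => ?_
    change NoSingularPoint 1 1 0 0 (-1) 0 0
    intro x y z h0 h1 h2 h3
    grind
  · exact genericallySmooth_five
  · exact genericallySmooth_six
  · exact genericallySmooth_seven
  · refine .of_forall (fun _ => trivial) fun w => ?_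
    change NoSingularPoint 0 0 0 (-1) (-1) 0 1
    intro x y z h0 h1 h2 h3
    grind
  · exact genericallySmooth_nine
  · refine .of_forall (fun _ => trivial) fun w => ?_
    change NoSingularPoint 1 0 0 (-1) (-1) 0 0
    intro x y z h0 h1 h2 h3
    grind
  · refine .of_forall (fun _ => trivial) fun w => ?_
    change NoSingularPoint 0 0 0 (-1) (-1) 0 0
    intro x y z h0 h1 h2 h3
    grind
  · refine .of_forall (fun _ => trivial) fun w => ?_
    change NoSingularPoint 0 0 0 (-1) 0 0 1
    intro x y z h0 h1 h2 h3
    grind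
  · refine .of_forall (fun _ => trivial) fun w => ?_
    change NoSingularPoint 1 0 0 0 (-1) 0 0
    intro x y z h0 h1 h2 h3
    grind
  · refine .of_forall (fun _ => trivial) fun w => ?_
    change NoSingularPoint 0 0 0 0 0 0 1
    intro x y z h0 h1 h2 h3
    grind

/-! ### Types of the corners of an irreducible normal form -/

/-- If ε_i vanished as well, x_j would divide the cubic. -/
theorem eps_ne_zero_of_irreducible {ε : Fin 3 → ℂ} {ω : Fin 4 → ℂ}
    (hirr : Irreducible (normalForm ε ω)) {i j k : Fin 3} (hij : i ≠ j) (hjk : j ≠ k)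
    (hki : k ≠ i) (hk : ε k = 0) (hωk : ω k.castSucc = 0) (hω : ω 3 = 0)
    (hωi : ω i.castSucc = 0) : ε i ≠ 0 := by
  intro hi
  have hfac : normalForm ε ω = X j * (X i * X k + C (ε j) * X j + C (ω j.castSucc)) := by
    refine MvPolynomial.funext fun x => ?_
    rw [eval_normalForm]
    simp only [map_mul, map_add, eval_X, eval_C]
    clear hirr
    fin_cases i <;> fin_cases j <;> simp at hij <;> fin_cases k <;>
      simp at hjk hki hk hωk hωi hi <;> simp_all <;> ring
  have hunit : ∀ (p : AffPoly) (x : Fin 3 → ℂ), eval x p = 0 → ¬ IsUnit p := fun p x h hp =>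
    not_isUnit_zero (h ▸ hp.map (eval x))
  rcases hirr.isUnit_or_isUnit hfac with h | h
  · exact hunit _ 0 (by simp) h
  -- A zero of the cofactor, which therefore is not a unit.
  · refine hunit _ (fun m => if m = i then 1 else if m = j then 0 else -ω j.castSucc) ?_ h
    simp [hij.symm, hjk.symm, hki]

theorem isSingularPt_of_coeff_eq_zero {ε : Fin 3 → ℂ} {i j k : Fin 3} (hij : i ≠ j) (hjk : j ≠ k)
    (hki : k ≠ i) (hk : ε k = 0) {p : Fin 4 → ℂ} (hi : p i.succ = 0) (hj : p j.succ = 0) :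
    IsSingularPt (completion (normalForm ε 0)) p := by
  rw [isSingularPt_normalForm_iff, eval_completion_normalForm]
  fin_cases i <;> fin_cases j <;> simp at hij <;> fin_cases k <;> simp at hjk hki hk <;>
    simp at hi hj <;> simp_all

/-- The differential vanishes identically along the singular line X_i = X_j = 0, so the contact
order is unbounded. -/
theorem not_hasSingularityA_of_coeff_eq_zero {ε : Fin 3 → ℂ} {i j k : Fin 3} (hij : i ≠ j)
    (hjk : j ≠ k) (hki : k ≠ i) (hk : ε k = 0) (n : ℕ) :
    ¬ HasSingularityA n (completion (normalForm ε 0)) (atInfinity (coordPt k)) := by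
  intro h
  have hcon : HasContact (n + 1) (completion (normalForm ε 0)) (atInfinity (coordPt k)) := by
    refine ⟨fun t => atInfinity (coordPt k) + t • Pi.single 0 1, Pi.single 0 1, ?_, by simp, ?_,
      fun v => ?_⟩
    · simpa using ((hasDerivAt_id (0 : ℂ)).smul_const (Pi.single 0 1 : Fin 4 → ℂ)).const_add
        (atInfinity (coordPt k))
    · rw [Submodule.mem_span_singleton]
      rintro ⟨c, hc⟩
      have := congrFun hc 0
      simp [atInfinity] at this
    · have hz : ∀ t : ℂ, fderiv ℂ (fun x : Fin 4 → ℂ => eval x (completion (normalForm ε 0)))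
          (atInfinity (coordPt k) + t • Pi.single 0 1) = 0 := fun t =>
        ((isSingularPt_iff _ _).1 (isSingularPt_of_coeff_eq_zero hij hjk hki hk
          (by simp [atInfinity, coordPt, hki.symm]) (by simp [atInfinity, coordPt, hjk]))).2
      simp only [hz]
      simpa using Asymptotics.isBigO_zero _ _
  have := h.le_of_hasContact (completion_isHomogeneous _) hcon
  omega

/-- The listed conditions exclude each other and cover everything except ω = 0, where no A_n occurs.
The converse thus follows from uniqueness of the type. In the A₄ case irreducibility turns ω_i + ω_j
≠ 0 into ε_j ω_i² + ε_i ω_j² ≠ 0. -/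
theorem hasSingularityA_normalForm_iff {ε : Fin 3 → ℂ} {ω : Fin 4 → ℂ}
    (hirr : Irreducible (normalForm ε ω)) {i j k : Fin 3} (hij : i ≠ j) (hjk : j ≠ k)
    (hki : k ≠ i) (hk : ε k = 0) (n : ℕ) :
    HasSingularityA n (completion (normalForm ε ω)) (atInfinity (coordPt k)) ↔
      (n = 1 ∧ ω k.castSucc ≠ 0) ∨
      (n = 2 ∧ ω k.castSucc = 0 ∧ ω 3 ≠ 0) ∨
      (n = 3 ∧ ω k.castSucc = 0 ∧ ω 3 = 0 ∧ ω i.castSucc * ω j.castSucc ≠ 0) ∨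
      (n = 4 ∧ ω k.castSucc = 0 ∧ ω 3 = 0 ∧ ω i.castSucc * ω j.castSucc = 0 ∧
        ω i.castSucc + ω j.castSucc ≠ 0) := by
  have mpr : ∀ n : ℕ, ((n = 1 ∧ ω k.castSucc ≠ 0) ∨
      (n = 2 ∧ ω k.castSucc = 0 ∧ ω 3 ≠ 0) ∨
      (n = 3 ∧ ω k.castSucc = 0 ∧ ω 3 = 0 ∧ ω i.castSucc * ω j.castSucc ≠ 0) ∨
      (n = 4 ∧ ω k.castSucc = 0 ∧ ω 3 = 0 ∧ ω i.castSucc * ω j.castSucc = 0 ∧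
        ω i.castSucc + ω j.castSucc ≠ 0)) →
      HasSingularityA n (completion (normalForm ε ω)) (atInfinity (coordPt k)) := by
    intro n h
    refine hasSingularityA_normalForm hij hjk hki hk ?_
    refine h.imp id (Or.imp id (Or.imp id ?_))
    rintro ⟨hn, hωk, hω, hmul, hadd⟩
    refine ⟨hn, hωk, hω, hmul, ?_⟩
    rcases mul_eq_zero.1 hmul with hi | hj
    · rw [hi, zero_add] at hadd
      simp [hi, hadd, eps_ne_zero_of_irreducible hirr hij hjk hki hk hωk hω hi]
    · rw [hj, add_zero] at hadd
      simp [hj, hadd, eps_ne_zero_of_irreducible hirr hij.symm hki.symm hjk.symm hk hωk hω hj]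
  refine ⟨fun h => ?_, mpr n⟩
  by_cases hωk : ω k.castSucc = 0
  swap
  · exact Or.inl ⟨h.unique (completion_isHomogeneous _) (mpr 1 (Or.inl ⟨rfl, hωk⟩)), hωk⟩
  by_cases hω : ω 3 = 0
  swap
  · exact Or.inr (Or.inl ⟨h.unique (completion_isHomogeneous _)
      (mpr 2 (Or.inr (Or.inl ⟨rfl, hωk, hω⟩))), hωk, hω⟩)
  by_cases hmul : ω i.castSucc * ω j.castSucc = 0
  swap
  · exact Or.inr (Or.inr (Or.inl ⟨h.unique (completion_isHomogeneous _)
      (mpr 3 (Or.inr (Or.inr (Or.inl ⟨rfl, hωk, hω, hmul⟩)))), hωk, hω, hmul⟩))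
  by_cases hadd : ω i.castSucc + ω j.castSucc = 0
  swap
  · exact Or.inr (Or.inr (Or.inr ⟨h.unique (completion_isHomogeneous _)
      (mpr 4 (Or.inr (Or.inr (Or.inr ⟨rfl, hωk, hω, hmul, hadd⟩)))), hωk, hω, hmul, hadd⟩))
  exfalso
  have hi : ω i.castSucc = 0 := by
    have : ω i.castSucc ^ 2 = 0 := by linear_combination ω i.castSucc * hadd - hmul
    exact pow_eq_zero_iff two_ne_zero |>.1 this
  have hj : ω j.castSucc = 0 := by rwa [hi, zero_add] at hadd
  have h0 : ω = 0 := by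
    funext m
    refine Fin.lastCases hω (fun m => ?_) m
    rcases (by clear * - hij hjk hki; revert i j k m; decide : m = i ∨ m = j ∨ m = k) with
      rfl | rfl | rfl
    exacts [hi, hj, hωk]
  rw [h0] at h
  exact not_hasSingularityA_of_coeff_eq_zero hij hjk hki hk n h

/-! ### The row of the table is determined by the types of the corners -/

/-- The symmetric function Σ 10^(n_k) records the multiset of types in its decimal digits, and it
takes different values on the 15 rows. -/
theorem row_eq_of_types {r r' : Fin 15} (ρ : Equiv.Perm (Fin 3))
    (h : ∀ k, (table r').types k = (table r).types (ρ k)) : r' = r := by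
  have hinj : Function.Injective (![3, 12, 102, 1002, 10002, 21, 30, 111, 120, 201, 1011, 1020, 210,
    10011, 300] : Fin 15 → ℕ) := by decide
  have hval : ∀ r, (![3, 12, 102, 1002, 10002, 21, 30, 111, 120, 201, 1011, 1020, 210,
      10011, 300] : Fin 15 → ℕ) r = ∑ k, 10 ^ (table r).types k := by
    intro r
    rw [Fin.sum_univ_three]
    fin_cases r <;> rfl
  apply hinj
  rw [hval, hval]
  simp only [h]
  exact Equiv.sum_comp ρ fun k => 10 ^ (table r).types k

theorem HasConfiguration.unique {f : AffPoly} {P : Fin 3 → Fin 3 → ℂ} {r r' : Fin 15}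
    (h : HasConfiguration f P r) (h' : HasConfiguration f P r') : r' = r := by
  obtain ⟨σ, hσ⟩ := h
  obtain ⟨τ, hτ⟩ := h'
  refine row_eq_of_types (τ.trans σ.symm) fun k => ?_
  refine (hτ k).unique (completion_isHomogeneous _) ?_
  have := hσ (σ.symm (τ k))
  rwa [σ.apply_symm_apply] at this

end AffineCubic

end

/-! ### The main theorem -/

theorem mainTheorem10 :
    -- normal form
    (∀ (f : AffineCubic.AffPoly) (L : Fin 3 → Module.Dual ℂ (Fin 3 → ℂ)) (P : Fin 3 → Fin 3 → ℂ),
      AffineCubic.HasTriangleAtInfinity f L P →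
      ∃ (ε : Fin 3 → ℂ) (ω : Fin 4 → ℂ), (∀ i, ε i = 0 ∨ ε i = 1) ∧
        AffineCubic.AffinelyEquivalent f (AffineCubic.normalForm ε ω)) ∧
    -- the curve at infinity and the corners of a normal form
    (∀ (ε : Fin 3 → ℂ) (ω : Fin 4 → ℂ), (∀ i, ε i = 0 ∨ ε i = 1) →
      AffineCubic.HasTriangleAtInfinity (AffineCubic.normalForm ε ω)
        AffineCubic.coordForm AffineCubic.coordPt ∧
      (∀ y : Fin 3 → ℂ, y ≠ 0 →
        (AffineCubic.IsSingularPt (AffineCubic.completion (AffineCubic.normalForm ε ω))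
            (AffineCubic.atInfinity y) ↔
          ∃ k, ε k = 0 ∧ ∃ c : ℂ, y = c • AffineCubic.coordPt k)) ∧
      (∀ k, AffineCubic.IsRegularPt (AffineCubic.completion (AffineCubic.normalForm ε ω))
          (AffineCubic.atInfinity (AffineCubic.coordPt k)) ↔ ε k = 1) ∧
      (Irreducible (AffineCubic.normalForm ε ω) →
        ∀ i j k : Fin 3, i ≠ j → j ≠ k → k ≠ i → ε k = 0 →
          (∀ n : ℕ, AffineCubic.HasSingularityA n
              (AffineCubic.completion (AffineCubic.normalForm ε ω))
              (AffineCubic.atInfinity (AffineCubic.coordPt k)) ↔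
            (n = 1 ∧ ω k.castSucc ≠ 0) ∨
            (n = 2 ∧ ω k.castSucc = 0 ∧ ω 3 ≠ 0) ∨
            (n = 3 ∧ ω k.castSucc = 0 ∧ ω 3 = 0 ∧ ω i.castSucc * ω j.castSucc ≠ 0) ∨
            (n = 4 ∧ ω k.castSucc = 0 ∧ ω 3 = 0 ∧ ω i.castSucc * ω j.castSucc = 0 ∧
              ω i.castSucc + ω j.castSucc ≠ 0)) ∧
          (ω = 0 → ε i = 1 ∧ ε j = 1 ∧
            ∀ p : Fin 4 → ℂ, p i.succ = 0 → p j.succ = 0 →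
              AffineCubic.IsSingularPt
                (AffineCubic.completion (AffineCubic.normalForm ε ω)) p))) ∧
    -- classification of the smooth surfaces
    (∀ (f : AffineCubic.AffPoly) (L : Fin 3 → Module.Dual ℂ (Fin 3 → ℂ)) (P : Fin 3 → Fin 3 → ℂ),
      AffineCubic.HasTriangleAtInfinity f L P → AffineCubic.IsSmoothAffine f →
      (∀ p : Fin 4 → ℂ, p ≠ 0 → AffineCubic.IsSingularPt (AffineCubic.completion f) p →
        ∃ k, ∃ c : ℂ, p = c • AffineCubic.atInfinity (P k)) ∧
      ∃ r : Fin 15, AffineCubic.HasConfiguration f P r ∧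
        (∀ r' : Fin 15, AffineCubic.HasConfiguration f P r' → r' = r) ∧
        (AffineCubic.affineLines f).encard = ((AffineCubic.table r).lines : ℕ∞) ∧
        ∃ w : Fin 4 → ℂ, (AffineCubic.table r).domain w ∧
          AffineCubic.AffinelyEquivalent f (AffineCubic.tableCubic r w)) ∧
    -- for generic parameters, the listed cubics are smooth and have the listed properties
    (∀ r : Fin 15, ∃ D : MvPolynomial (Fin 4) ℂ, D ≠ 0 ∧
      ∀ w : Fin 4 → ℂ, MvPolynomial.eval w D ≠ 0 →
        (AffineCubic.table r).domain w ∧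
        AffineCubic.IsSmoothAffine (AffineCubic.tableCubic r w) ∧
        (∀ k, AffineCubic.HasPointType (AffineCubic.completion (AffineCubic.tableCubic r w))
          (AffineCubic.atInfinity (AffineCubic.coordPt k)) ((AffineCubic.table r).types k)) ∧
        (AffineCubic.affineLines (AffineCubic.tableCubic r w)).encard =
          ((AffineCubic.table r).lines : ℕ∞)) := by
  refine ⟨fun f L P h => ?_, fun ε ω hε => ⟨AffineCubic.hasTriangleAtInfinity_normalForm ε ω,
    fun y hy => AffineCubic.isSingularPt_atInfinity_iff ε ω hy, fun k => ?_,
    fun hirr i j k hij hjk hki hk => ⟨fun n =>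
      AffineCubic.hasSingularityA_normalForm_iff hirr hij hjk hki hk n, ?_⟩⟩,
    fun f L P h hs => ?_, fun r => ?_⟩
  · obtain ⟨ε, ω, hε, he⟩ := h.exists_equivalent_normalForm
    exact ⟨ε, ω, hε, he.affinelyEquivalent⟩
  · rw [AffineCubic.isRegularPt_corner_iff]
    rcases hε k with h | h <;> simp [h]
  · rintro rfl
    exact ⟨(hε i).resolve_left (AffineCubic.eps_ne_zero_of_irreducible hirr hij hjk hki hk
        rfl rfl rfl),
      (hε j).resolve_left (AffineCubic.eps_ne_zero_of_irreducible hirr hij.symm hki.symm hjk.symm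
        hk rfl rfl rfl),
      fun p hi hj => AffineCubic.isSingularPt_of_coeff_eq_zero hij hjk hki hk hi hj⟩
  · obtain ⟨ε, ω, hε, h₁⟩ := h.exists_equivalent_normalForm
    have hs₁ := h₁.isSmoothAffine hs
    obtain ⟨r, w, hg, h₂⟩ := AffineCubic.hasRow_of_isSmoothAffine hε hs₁
    have he := h₁.trans h₂
    have hr : AffineCubic.HasConfiguration f P r :=
      he.hasConfiguration h.totalDegree_eq.le (AffineCubic.totalDegree_normalForm_le _ _)
        ⟨1, AffineCubic.hasPointType_tableCubic hg⟩
    refine ⟨h₁.singularPt h.totalDegree_eq.le (AffineCubic.totalDegree_normalForm_le _ _)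
      fun p hp hp' => AffineCubic.singularPt_of_isSmoothAffine hs₁ hp hp', r, hr,
      fun r' hr' => hr.unique hr', ?_, w, AffineCubic.domain_of_goodParams hg,
      he.affinelyEquivalent⟩
    rw [he.encard_affineLines]
    exact AffineCubic.encard_affineLines_tableCubic hg (he.isSmoothAffine hs)
  · obtain ⟨D, hD, hr⟩ := AffineCubic.genericallySmooth r
    refine ⟨D, hD, fun w hw => ?_⟩
    obtain ⟨hg, hs⟩ := hr w hw
    exact ⟨AffineCubic.domain_of_goodParams hg, hs, AffineCubic.hasPointType_tableCubic hg,
      AffineCubic.encard_affineLines_tableCubic hg hs⟩
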